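/- **Setting.** A $G$-structure on a connected, locally connected space $U$ is a triple $(\widehat U,G_U,\pi_U)$: a topological group $G_U$ acting continuously on a connected, locally connected space $\widehat U$, and a continuous map $\pi_U:\widehat U\to U$ inducing a homeomorphism $\widehat U/G_U\cong U$. For a connected open $W\subseteq U$, a component $\widehat W$ of $\pi_U^{-1}(W)$ together with its stabilizer $G_W\subseteq G_U$ is a $G$-structure on $W$ *induced* from $U$. An *orbispace* is a space $X$ with a base $\mathcal U$ of connected open sets ("basic open sets"; every connected open subset of a basic open set is assumed to be basic), with a $G$-structure for each $U\in\mathcal U$ and, for $U_\alpha,U_\beta\in\mathcal U$, a set $Tran(U_\alpha,U_\beta)$ of transition maps, non-empty if $U_\alpha\cap U_\beta\ne\emptyset$. Each transition map is realized as an isomorphism $(\phi,\lambda)$ from an induced $G$-structure of $U_\alpha$ on a component of $U_\alpha\cap U_\beta$ onto one of $U_\beta$. Further: * $G_{U_\beta}\times G_{U_\alpha}$ acts on $Tran(U_\alpha,U_\beta)$ by $(h,g)\cdot(\phi,\lambda)=h\circ(\phi,\lambda)\circ g^{-1}$; two transition maps over the same component are in the same orbit; and $h\circ(\phi,\lambda)\circ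 g^{-1}=(\phi,\lambda)$ if and only if $g$ is in the domain of $\lambda$ and $\lambda(g)=h$. * The identity lies in $Tran(U,U)$, which is thereby identified with $G_U$. * There are compositions $\jmath\circ\imath$ of transition maps (one for each component of the set where the composed map is defined). They extend the compositions of the underlying maps, are associative, and agree with the above actions. $Tran(U_\alpha,U_\beta)$ has the topology in which the $G_{U_\beta}$-orbits are open and homeomorphic to $G_{U_\beta}$. A *base-point structure* $\underline o=(o,U_o,\hat o)$ consists of a basic open set $U_o$, a point $o\in U_o$ and $\hat o\in\pi_{U_o}^{-1}(o)$. A *based system* from $(X,\underline o)$ to $(X',\underline{o'})$ consists of a cover $\{U_\alpha\}$ of $X$ by basic open sets, basic open sets $U'_\alpha$ of $X'$, and continuous maps $f_\alpha:\widehat{U_\alpha}\to\widehat{U'_\alpha}$ and $\rho_{\beta\alpha}:Tran(U_\alpha,U_\beta)\to Tran(U'_\alpha,U'_\beta)$ with $f_\beta\circ\imath=\rho_{\beta\alpha}(\imath)\circ f_\alpha$ and $\rho_{\gamma\alpha}(\jmath\circ\imath)=\rho_{\gamma\beta}(\jmath)\circ\rho_{\beta\alpha}(\imath)$, such that $U_o$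 occurs, with an index at which $U_o\mapsto U'_{o'}$ and $f_o(\hat o)=\hat o'$. Two systems over the same families are isomorphic if $f_{\alpha,2}=\delta_\alpha f_{\alpha,1}$ and $\rho_{\beta\alpha,2}=\delta_\beta\,\rho_{\beta\alpha,1}\,\delta_\alpha^{-1}$ for some $\delta_\alpha\in G_{U'_\alpha}$ with $\delta_o=1$. A refinement of a system is obtained by passing to a finer cover $\{U_i\}$, $U_i\subseteq U_{\theta(i)}$, and other targets $U'_i$, through transition maps $\imath_i\in Tran(U_i,U_{\theta(i)})$, $\imath'_i\in Tran(U'_i,U'_{\theta(i)})$ that are trivial at the base index: $f_i=(\imath'_i)^{-1}\circ f_{\theta(i)}\circ\imath_i$ and $\xi_{ji}(a)=(\imath'_j)^{-1}\circ\rho_{\theta(j)\theta(i)}(\imath_j\circ a\circ\imath_i^{-1})\circ\imath'_i$. A *based morphism* is a class of based systems, two systems being equivalent if they have isomorphic refinements. The set $Mor$ of based morphisms $(X,\underline o)\to(X',\underline{o'})$ has the "compact-open" topology generated by the sets of all morphisms representable over given families $(\{U_\alpha\},\{U'_\alpha\})$ by a system with $f_\alpha(K_\alpha)\subseteq V_\alpha$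 and $\rho_{\beta\alpha}(L_{\beta\alpha})\subseteq O_{\beta\alpha}$, for finitely many compact $K_\alpha\subseteq\widehat{U_\alpha}$, $L_{\beta\alpha}\subseteq Tran(U_\alpha,U_\beta)$ and open $V_\alpha\subseteq\widehat{U'_\alpha}$, $O_{\beta\alpha}\subseteq Tran(U'_\alpha,U'_\beta)$. Two based morphisms are *homotopic* if a path in $Mor$ joins them. A based morphism $\tilde f:(X,\underline o)\to(X',\underline{o'})$ is a *homotopy equivalence* if there is a based morphism $\tilde g:(X',\underline{o'})\to(X,\underline o)$ such that $\tilde g\circ\tilde f$ and $\tilde f\circ\tilde g$ are homotopic to the identity morphisms. The *based loop space* $\Omega(X,\underline o)$ is the set of classes of based systems from $S^1=[0,1]/\{0\sim1\}$: covers of $S^1$ by at least three open arcs $I_0\ni 0,I_1,\dots,I_n$ in cyclic order, only cyclically consecutive ones meeting; basic open sets $U_i$ with $U_0=U_o$; continuous $f_i:I_i\to\widehat{U_i}$ with $f_0(0)=\hat o$; and transition maps $\rho_{ji}\in Tran(U_i,U_j)$, for $j$ the cyclic successor of $i$, with $f_j=\rho_{ji}\circ f_i$ on $I_i\cap I_j$.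 The equivalence is again generated by isomorphism and refinement, trivial at the index $0$. The topology is generated by the sets of all loops representable over given $(\{I_i\},\{U_i\})$ by a system with $f_i(K_i)\subseteq V_i$ and $\rho_{ji}\in A_{ji}$ ($K_i\subseteq I_i$ compact, $V_i\subseteq\widehat{U_i}$ and $A_{ji}\subseteq Tran(U_i,U_j)$ open). Let $\tilde o$ be the constant loop, and $\#$ the concatenation of loops. For $k\ge1$, $\pi_k(X,\underline o):=\pi_{k-1}(\Omega(X,\underline o),\tilde o)$; the product on $\pi_1(X,\underline o)=\pi_0(\Omega(X,\underline o))$ is the one induced by $\#$. A based morphism $\tilde f$ induces $f_\#:=\pi_{k-1}(\Omega(\tilde f))$, where $\Omega(\tilde f)(\tilde\gamma)=\tilde f\circ\tilde\gamma$. **Theorem.** Let $(X,\underline o)$ and $(X',\underline{o'})$ be based orbispaces. For every based morphism $\tilde f:(X,\underline o)\to(X',\underline{o'})$ the map $\Omega(\tilde f)$ is well defined, continuous and base-point preserving, so that $f_\#$ is defined; and 1. if two based morphisms $\tilde f_1,\tilde f_2:(X,\underline o)\to(X',\underline{o'})$ are homotopic, then $(f_1)_\#=(f_2)_\#:\pi_k(X,\underline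 o)\to\pi_k(X',\underline{o'})$ for all $k\ge1$; 2. if $\tilde f:(X,\underline o)\to(X',\underline{o'})$ is a homotopy equivalence, then for all $k\ge1$ the map $f_\#:\pi_k(X,\underline o)\to\pi_k(X',\underline{o'})$ is an isomorphism: it is bijective and compatible with the products (for $k=1$: $c$ is a product of $a$ and $b$ if and only if $f_\#(c)$ is a product of $f_\#(a)$ and $f_\#(b)$). -/

import Mathlib

open Set Topology TopologicalSpace
open scoped Pointwise

universe u

/-! ### Orbispaces -/

/-- A `G`-structure on the subspace `U` of `X`: a connected, locally connected space `Hat` with a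
continuous action of a topological group `Grp`, and a continuous map `proj : Hat → U` which induces
a homeomorphism from the orbit space `Hat / Grp` onto `U` (that is, `proj` is a quotient map whose
fibres are exactly the orbits). -/
structure GStructure {X : Type u} [TopologicalSpace X] (U : Set X) where
  Hat : Type u
  Grp : Type u
  [topHat : TopologicalSpace Hat]
  [group : Group Grp]
  [topGrp : TopologicalSpace Grp]
  [isTopologicalGroup : IsTopologicalGroup Grp]
  [action : MulAction Grp Hat]
  [continuousSMul : ContinuousSMul Grp Hat]
  [connected : ConnectedSpace Hat]
  [locallyConnected : LocallyConnectedSpace Hat]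
  proj : Hat → U
  isQuotientMap : IsQuotientMap proj
  proj_eq_iff : ∀ x y, proj x = proj y ↔ ∃ g : Grp, g • x = y

attribute [instance] GStructure.topHat GStructure.group GStructure.topGrp
  GStructure.isTopologicalGroup GStructure.action GStructure.continuousSMul
  GStructure.connected GStructure.locallyConnected

/-- `C` is the underlying space of one of the `G`-structures on the connected open set `W` which
are induced from `A`: a connected component of the preimage of `W`.  The group of the induced
`G`-structure is the stabilizer of `C`. -/
def GStructure.IsInducedOn {X : Type u} [TopologicalSpace X] {U : Set X} (A : GStructure U)
    (W : Set X) (C : Set A.Hat) : Prop :=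
  ∃ x : A.Hat, (A.proj x : X) ∈ W ∧ C = connectedComponentIn {z | (A.proj z : X) ∈ W} x

/-- An isomorphism `(map, iso)` from a `G`-structure, induced from `A`, on a connected component
of `U ∩ V` onto a `G`-structure on the same component induced from `B`. -/
structure Transition {X : Type u} [TopologicalSpace X] {U V : Set X}
    (A : GStructure U) (B : GStructure V) where
  base : Set X
  isComponent : ∃ p ∈ U ∩ V, base = connectedComponentIn (U ∩ V) p
  map : OpenPartialHomeomorph A.Hat B.Hat
  source_induced : A.IsInducedOn base map.source
  target_induced : B.IsInducedOn base map.target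
  iso : MulAction.stabilizer A.Grp map.source ≃ₜ* MulAction.stabilizer B.Grp map.target
  proj_map : ∀ x ∈ map.source, (B.proj (map x) : X) = A.proj x
  equivariant : ∀ (g : MulAction.stabilizer A.Grp map.source), ∀ x ∈ map.source,
    map ((g : A.Grp) • x) = (iso g : B.Grp) • map x

/-- An orbispace structure on `X`.  Transition maps are abstract elements `t : Tran a b`, realized
as isomorphisms `tr t` of induced `G`-structures: as the group actions need not be effective, two
different transition maps may have the same realization.
(Local connectedness of `X` follows from `isBasis` and `isConnected`.) -/
structure Orbispace (X : Type u) [TopologicalSpace X] where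
  /-- the basic open sets -/
  basic : Set (Set X)
  isBasis : IsTopologicalBasis basic
  isConnected : ∀ U ∈ basic, IsConnected U
  /-- standing convention: connected open subsets of basic open sets are basic open sets -/
  mem_of_subset : ∀ U ∈ basic, ∀ W : Set X, W ⊆ U → IsOpen W → IsConnected W → W ∈ basic
  /-- the `G`-structure assigned to a basic open set -/
  chart : ∀ a : basic, GStructure (a : Set X)
  Tran : basic → basic → Type u
  tr : ∀ {a b : basic}, Tran a b → Transition (chart a) (chart b)
  nonempty_tran : ∀ a b : basic, ((a : Set X) ∩ (b : Set X)).Nonempty → Nonempty (Tran a b)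
  /-- `(h, g) • t` is the transition map `h ∘ t ∘ g⁻¹` -/
  [act : ∀ a b : basic, MulAction ((chart b).Grp × (chart a).Grp) (Tran a b)]
  smul_source : ∀ {a b : basic} (h : (chart b).Grp) (g : (chart a).Grp) (t : Tran a b),
    (tr ((h, g) • t)).map.source = g • (tr t).map.source
  smul_map : ∀ {a b : basic} (h : (chart b).Grp) (g : (chart a).Grp) (t : Tran a b),
    ∀ x ∈ (tr ((h, g) • t)).map.source,
      (tr ((h, g) • t)).map x = h • (tr t).map (g⁻¹ • x)
  smul_iso : ∀ {a b : basic} (h : (chart b).Grp) (g : (chart a).Grp) (t : Tran a b)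
    (k : (chart a).Grp)
    (hk : k ∈ MulAction.stabilizer (chart a).Grp (tr ((h, g) • t)).map.source)
    (hk' : g⁻¹ * k * g ∈ MulAction.stabilizer (chart a).Grp (tr t).map.source),
    ((tr ((h, g) • t)).iso ⟨k, hk⟩ : (chart b).Grp) =
      h * ((tr t).iso ⟨g⁻¹ * k * g, hk'⟩ : (chart b).Grp) * h⁻¹
  /-- two transition maps over the same component differ by automorphisms -/
  smul_transitive : ∀ {a b : basic} (t t' : Tran a b), (tr t).base = (tr t').base →
    ∃ (h : (chart b).Grp) (g : (chart a).Grp), t' = (h, g) • t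
  smul_eq_iff : ∀ {a b : basic} (h : (chart b).Grp) (g : (chart a).Grp) (t : Tran a b),
    (h, g) • t = t ↔
      ∃ hg : g ∈ MulAction.stabilizer (chart a).Grp (tr t).map.source,
        ((tr t).iso ⟨g, hg⟩ : (chart b).Grp) = h
  /-- the identity map; `g ↦ (g, 1) • one a` identifies the group of `a` with `Tran a a` -/
  one : ∀ a : basic, Tran a a
  one_source : ∀ a : basic, (tr (one a)).map.source = univ
  one_map : ∀ (a : basic) (x : (chart a).Hat), (tr (one a)).map x = x
  one_iso : ∀ (a : basic) (g : MulAction.stabilizer (chart a).Grp (tr (one a)).map.source),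
    ((tr (one a)).iso g : (chart a).Grp) = g
  /-- the composition `j ∘ i` at a point `x` where it is defined.  It depends on `x` only through
  the connected component of `x` in the domain of the composed map, since the domain of an element
  of `Tran a c` lies over a single component of the intersection. -/
  comp : ∀ {a b c : basic} (j : Tran b c) (i : Tran a b) (x : (chart a).Hat),
    x ∈ (tr i).map.source → (tr i).map x ∈ (tr j).map.source → Tran a c
  comp_mem : ∀ {a b c : basic} (j : Tran b c) (i : Tran a b) (x : (chart a).Hat)
    (hx : x ∈ (tr i).map.source) (hy : (tr i).map x ∈ (tr j).map.source),
    x ∈ (tr (comp j i x hx hy)).map.source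
  comp_map : ∀ {a b c : basic} (j : Tran b c) (i : Tran a b) (x : (chart a).Hat)
    (hx : x ∈ (tr i).map.source) (hy : (tr i).map x ∈ (tr j).map.source),
    (tr (comp j i x hx hy)).map x = (tr j).map ((tr i).map x)
  comp_iso : ∀ {a b c : basic} (j : Tran b c) (i : Tran a b) (x : (chart a).Hat)
    (hx : x ∈ (tr i).map.source) (hy : (tr i).map x ∈ (tr j).map.source)
    (g : MulAction.stabilizer (chart a).Grp (tr i).map.source)
    (hg : ((tr i).iso g : (chart b).Grp) ∈
      MulAction.stabilizer (chart b).Grp (tr j).map.source)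
    (hg' : (g : (chart a).Grp) ∈
      MulAction.stabilizer (chart a).Grp (tr (comp j i x hx hy)).map.source),
    ((tr (comp j i x hx hy)).iso ⟨g, hg'⟩ : (chart c).Grp) = (tr j).iso ⟨(tr i).iso g, hg⟩
  comp_locallyConstant : ∀ {a b c : basic} (j : Tran b c) (i : Tran a b) (x y : (chart a).Hat)
    (hx : x ∈ (tr i).map.source) (hy : (tr i).map x ∈ (tr j).map.source)
    (hx' : y ∈ (tr i).map.source) (hy' : (tr i).map y ∈ (tr j).map.source),
    y ∈ connectedComponentIn
      {z | z ∈ (tr i).map.source ∧ (tr i).map z ∈ (tr j).map.source} x →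
    comp j i x hx hy = comp j i y hx' hy'
  comp_assoc : ∀ {a b c d : basic} (k : Tran c d) (j : Tran b c) (i : Tran a b)
    (x : (chart a).Hat) (hi : x ∈ (tr i).map.source)
    (hj : (tr i).map x ∈ (tr j).map.source)
    (hk : (tr j).map ((tr i).map x) ∈ (tr k).map.source),
    comp k (comp j i x hi hj) x (comp_mem j i x hi hj) (by rw [comp_map]; exact hk) =
      comp (comp k j ((tr i).map x) hj hk) i x hi (comp_mem k j ((tr i).map x) hj hk)
  comp_left : ∀ {a b : basic} (h : (chart b).Grp) (t : Tran a b) (x : (chart a).Hat)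
    (hx : x ∈ (tr t).map.source)
    (hy : (tr t).map x ∈ (tr ((h, (1 : (chart b).Grp)) • one b)).map.source),
    comp ((h, (1 : (chart b).Grp)) • one b) t x hx hy = (h, (1 : (chart a).Grp)) • t
  comp_right : ∀ {a b : basic} (g : (chart a).Grp) (t : Tran a b) (x : (chart a).Hat)
    (hx : x ∈ (tr ((g, (1 : (chart a).Grp)) • one a)).map.source)
    (hy : (tr ((g, (1 : (chart a).Grp)) • one a)).map x ∈ (tr t).map.source),
    comp t ((g, (1 : (chart a).Grp)) • one a) x hx hy = ((1 : (chart b).Grp), g⁻¹) • t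

attribute [instance] Orbispace.act

namespace Orbispace

variable {X : Type u} [TopologicalSpace X] (O : Orbispace X)

/-- The space `Û` of the basic open set `a`. -/
abbrev Hat (a : O.basic) : Type u := (O.chart a).Hat

/-- The group `G_U` of the basic open set `a`. -/
abbrev Grp (a : O.basic) : Type u := (O.chart a).Grp

/-- The map underlying a transition map. -/
abbrev mp {a b : O.basic} (t : O.Tran a b) : OpenPartialHomeomorph (O.Hat a) (O.Hat b) :=
  (O.tr t).map

/-- `t` is the composition `j ∘ i` at the point `x`. -/
def IsComp {a b c : O.basic} (j : O.Tran b c) (i : O.Tran a b) (x : O.Hat a)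
    (t : O.Tran a c) : Prop :=
  ∃ (hx : x ∈ (O.mp i).source) (hy : O.mp i x ∈ (O.mp j).source), O.comp j i x hx hy = t

/-- `r` is the inverse of the transition map `t`. -/
def IsInv {a b : O.basic} (t : O.Tran a b) (r : O.Tran b a) : Prop :=
  ∀ x ∈ (O.mp t).source, O.IsComp r t x (O.one a)

/-- The topology of `Tran a b`: each (free) orbit of the group of `b` is open and carries the
topology of that group.  Thus `Tran a b` is a disjoint union of copies of the groups
of the components of `a ∩ b`. -/
instance tranTopology (a b : O.basic) : TopologicalSpace (O.Tran a b) :=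
  ⨆ t : O.Tran a b, TopologicalSpace.coinduced
    (fun h : O.Grp b => ((h, 1) : O.Grp b × O.Grp a) • t) inferInstance

/-- A base-point structure `(o, U_o, ô)`: a basic open set `U_o` and a point `ô` of its space `Û_o`;
the point `o` of `X` is the image of `ô`. -/
abbrev BasePoint : Type u := Σ a : O.basic, O.Hat a

/-- Transition maps with unspecified end charts. -/
abbrev Arrow : Type u := Σ a : O.basic, Σ b : O.basic, O.Tran a b

/-- A transition map as an `Arrow`. -/
abbrev arrow {a b : O.basic} (t : O.Tran a b) : O.Arrow := ⟨a, b, t⟩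

end Orbispace

/-! ### Morphisms -/

section Morphisms

variable {X Y Z : Type u} [TopologicalSpace X] [TopologicalSpace Y] [TopologicalSpace Z]
variable {O : Orbispace X} {P : Orbispace Y} {Q : Orbispace Z}

/-- A compatible system of maps `({f_α}, {ρ_βα})` defined over two families of basic open sets,
with the same index set. Here `ρ α β` is the map `ρ_βα : Tran(U_α, U_β) → Tran(U'_α, U'_β)`. -/
structure SystemOver (O : Orbispace X) (P : Orbispace Y) {Λ : Type u}
    (src : Λ → O.basic) (tgt : Λ → P.basic) where
  f : ∀ α, C(O.Hat (src α), P.Hat (tgt α))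
  ρ : ∀ α β, C(O.Tran (src α) (src β), P.Tran (tgt α) (tgt β))
  map_mem : ∀ {α β : Λ} (t : O.Tran (src α) (src β)), ∀ x ∈ (O.mp t).source,
    f α x ∈ (P.mp (ρ α β t)).source
  map_eq : ∀ {α β : Λ} (t : O.Tran (src α) (src β)), ∀ x ∈ (O.mp t).source,
    P.mp (ρ α β t) (f α x) = f β (O.mp t x)
  map_comp : ∀ {α β γ : Λ} (j : O.Tran (src β) (src γ)) (i : O.Tran (src α) (src β))
    (x : O.Hat (src α)) (hx : x ∈ (O.mp i).source) (hy : O.mp i x ∈ (O.mp j).source),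
    ρ α γ (O.comp j i x hx hy) = P.comp (ρ β γ j) (ρ α β i) (f α x) (map_mem i x hx)
      (by rw [map_eq i x hx]; exact map_mem j _ hy)

namespace SystemOver

/-- Composition of systems, when the target family of the first one is taken from the source
family of the second one by an index map `κ`. -/
def comp {Λ Λ' : Type u} {src : Λ → O.basic} {src' : Λ' → P.basic} {tgt' : Λ' → Q.basic}
    (τ : SystemOver P Q src' tgt') (κ : Λ → Λ')
    (σ : SystemOver O P src (fun α => src' (κ α))) :
    SystemOver O Q src (fun α => tgt' (κ α)) where
  f α := (τ.f (κ α)).comp (σ.f α)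
  ρ α β := (τ.ρ (κ α) (κ β)).comp (σ.ρ α β)
  map_mem t x hx := τ.map_mem _ _ (σ.map_mem t x hx)
  map_eq t x hx := by
    have h := τ.map_eq _ _ (σ.map_mem t x hx)
    rw [σ.map_eq t x hx] at h
    exact h
  map_comp j i x hx hy := by
    have h := σ.map_comp j i x hx hy
    simp only [ContinuousMap.comp_apply]
    rw [h]
    exact τ.map_comp _ _ _ _ _

/-- Isomorphism of two systems over the same families, through automorphisms `δ_α` with
`δ_o = 1` for the base index `o`. -/
def Iso {Λ : Type u} {src : Λ → O.basic} {tgt : Λ → P.basic}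
    (σ τ : SystemOver O P src tgt) (o : Λ) : Prop :=
  ∃ δ : ∀ α, P.Grp (tgt α), δ o = 1 ∧
    (∀ α x, τ.f α x = δ α • σ.f α x) ∧
    ∀ α β t, τ.ρ α β t = ((δ β, δ α) : P.Grp (tgt β) × P.Grp (tgt α)) • σ.ρ α β t

end SystemOver

/-- A based system from `(X, x)` to `(Y, y)`.  The index `o` is the one of the base chart:
`basePt_map` says that `src o = U_o`, `tgt o = U'_o` and `f_o(ô) = ô'`. -/
structure BasedSystem (O : Orbispace X) (x : O.BasePoint) (P : Orbispace Y)
    (y : P.BasePoint) where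
  Λ : Type u
  src : Λ → O.basic
  tgt : Λ → P.basic
  o : Λ
  cover : ∀ p : X, ∃ α, p ∈ (src α : Set X)
  sys : SystemOver O P src tgt
  basePt_map : ∃ z : O.Hat (src o),
    (⟨src o, z⟩ : O.BasePoint) = x ∧ (⟨tgt o, sys.f o z⟩ : P.BasePoint) = y

namespace BasedSystem

variable {x : O.BasePoint} {y : P.BasePoint} {z : Q.BasePoint}

/-- `τ` is a refinement of `σ`: its source family refines that of `σ` through the index map `θ`,
`f_i = (ι'_i)⁻¹ ∘ f_{θ(i)} ∘ ι_i` and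
`ξ_{ji}(a) = (ι'_j)⁻¹ ∘ ρ_{θ(j)θ(i)}(ι_j ∘ a ∘ ι_i⁻¹) ∘ ι'_i` for some transition maps
`ι_i ∈ Tran(U_i, U_{θ(i)})`, `ι'_i ∈ Tran(U'_i, U'_{θ(i)})`, the ones at the base index being the
identity.  In the last clause `b` stands for `ι_j ∘ a ∘ ι_i⁻¹`. -/
def IsRefinement (τ σ : BasedSystem O x P y) : Prop :=
  ∃ (θ : τ.Λ → σ.Λ) (ι : ∀ i, O.Tran (τ.src i) (σ.src (θ i)))
    (ι' : ∀ i, P.Tran (τ.tgt i) (σ.tgt (θ i))),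
    θ τ.o = σ.o ∧
    O.arrow (ι τ.o) = O.arrow (O.one (τ.src τ.o)) ∧
    P.arrow (ι' τ.o) = P.arrow (P.one (τ.tgt τ.o)) ∧
    (∀ i, (τ.src i : Set X) ⊆ σ.src (θ i)) ∧
    (∀ i p, τ.sys.f i p ∈ (P.mp (ι' i)).source ∧
      P.mp (ι' i) (τ.sys.f i p) = σ.sys.f (θ i) (O.mp (ι i) p)) ∧
    ∀ (i j : τ.Λ) (a : O.Tran (τ.src i) (τ.src j)), ∀ p ∈ (O.mp a).source,
      ∀ (b : O.Tran (σ.src (θ i)) (σ.src (θ j))) (c : O.Tran (τ.src i) (σ.src (θ j))),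
        O.IsComp (ι j) a p c → O.IsComp b (ι i) p c →
        ∃ c' : P.Tran (τ.tgt i) (σ.tgt (θ j)),
          P.IsComp (ι' j) (τ.sys.ρ i j a) (τ.sys.f i p) c' ∧
          P.IsComp (σ.sys.ρ (θ i) (θ j) b) (ι' i) (τ.sys.f i p) c'

/-- The two systems are defined over the same families, and are isomorphic. -/
inductive Isomorphic : BasedSystem O x P y → BasedSystem O x P y → Prop
  | mk {Λ : Type u} {src : Λ → O.basic} {tgt : Λ → P.basic} {o : Λ}
      (cover : ∀ p : X, ∃ α, p ∈ (src α : Set X)) (s t : SystemOver O P src tgt)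
      (hs : ∃ z : O.Hat (src o),
        (⟨src o, z⟩ : O.BasePoint) = x ∧ (⟨tgt o, s.f o z⟩ : P.BasePoint) = y)
      (ht : ∃ z : O.Hat (src o),
        (⟨src o, z⟩ : O.BasePoint) = x ∧ (⟨tgt o, t.f o z⟩ : P.BasePoint) = y)
      (h : s.Iso t o) :
      Isomorphic ⟨Λ, src, tgt, o, cover, s, hs⟩ ⟨Λ, src, tgt, o, cover, t, ht⟩

/-- Direct equivalence: there are isomorphic refinements. -/
def DirectlyEquivalent (σ τ : BasedSystem O x P y) : Prop :=
  ∃ σ' τ' : BasedSystem O x P y, σ'.IsRefinement σ ∧ τ'.IsRefinement τ ∧ Isomorphic σ' τ'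

theorem map_base (τ : BasedSystem O x P y) (β : τ.Λ) (hβ : β = τ.o) (w : O.Hat (τ.src β))
    (hw : (⟨τ.src β, w⟩ : O.BasePoint) = x) :
    (⟨τ.tgt β, τ.sys.f β w⟩ : P.BasePoint) = y := by
  subst hβ
  obtain ⟨z, hz, hz'⟩ := τ.basePt_map
  have h : w = z := eq_of_heq (Sigma.mk.inj (hw.trans hz.symm)).2
  rw [h]
  exact hz'

/-- The identity system. -/
def id (O : Orbispace X) (x : O.BasePoint) : BasedSystem O x O x where
  Λ := O.basic
  src a := a
  tgt a := a
  o := x.1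
  cover p := by
    obtain ⟨U, hU, hp, -⟩ := O.isBasis.exists_subset_of_mem_open (mem_univ p) isOpen_univ
    exact ⟨⟨U, hU⟩, hp⟩
  sys :=
    { f := fun a => ContinuousMap.id _
      ρ := fun a b => ContinuousMap.id _
      map_mem := fun t p hp => hp
      map_eq := fun t p hp => rfl
      map_comp := fun j i p hp hq => rfl }
  basePt_map := ⟨x.2, rfl, rfl⟩

end BasedSystem

/-- Based morphisms: equivalence classes of based systems. -/
def BasedMor (O : Orbispace X) (x : O.BasePoint) (P : Orbispace Y) (y : P.BasePoint) :
    Type (u + 1) :=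
  Quot (BasedSystem.DirectlyEquivalent (O := O) (x := x) (P := P) (y := y))

namespace BasedMor

variable {x : O.BasePoint} {y : P.BasePoint} {z : Q.BasePoint}

/-- The morphism represented by a based system. -/
def mk (σ : BasedSystem O x P y) : BasedMor O x P y := Quot.mk _ σ

/-- The identity morphism. -/
def id (O : Orbispace X) (x : O.BasePoint) : BasedMor O x O x := mk (BasedSystem.id O x)

/-- `h` is the composition `g ∘ f`: there are composable systems representing `f` and `g` whose
composition represents `h`. -/
def IsComposite (g : BasedMor P y Q z) (f : BasedMor O x P y) (h : BasedMor O x Q z) : Prop :=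
  ∃ (τ : BasedSystem P y Q z) (Λ : Type u) (src : Λ → O.basic) (κ : Λ → τ.Λ) (o : Λ)
    (cover : ∀ p : X, ∃ α, p ∈ (src α : Set X))
    (s : SystemOver O P src (fun α => τ.src (κ α)))
    (hs : ∃ w : O.Hat (src o), (⟨src o, w⟩ : O.BasePoint) = x ∧
      (⟨τ.src (κ o), s.f o w⟩ : P.BasePoint) = y)
    (ho : κ o = τ.o),
    g = mk τ ∧ f = mk ⟨Λ, src, _, o, cover, s, hs⟩ ∧
    h = mk ⟨Λ, src, _, o, cover, τ.sys.comp κ s,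
      hs.imp fun w hw => ⟨hw.1, τ.map_base (κ o) ho (s.f o w) hw.2⟩⟩

/-- The set `𝒪(σ, K, V, L, O)` of the morphisms represented by some system over the two given
families (with base index `o`) which maps the compact sets `K α`, for the finitely many `α ∈ A`,
into the open sets `V α`, and the compact sets `L α β`, for the finitely many `(α, β) ∈ B`, into
the open sets `W α β`.  (It is empty unless some system `σ` satisfies these conditions.) -/
def basicSet {Λ : Type u} (src : Λ → O.basic) (tgt : Λ → P.basic) (o : Λ)
    (A : Set Λ) (K : ∀ α, Set (O.Hat (src α))) (V : ∀ α, Set (P.Hat (tgt α)))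
    (B : Set (Λ × Λ)) (L : ∀ α β, Set (O.Tran (src α) (src β)))
    (W : ∀ α β, Set (P.Tran (tgt α) (tgt β))) : Set (BasedMor O x P y) :=
  {g | ∃ (cover : ∀ p : X, ∃ α, p ∈ (src α : Set X)) (s : SystemOver O P src tgt)
    (hs : ∃ z : O.Hat (src o),
      (⟨src o, z⟩ : O.BasePoint) = x ∧ (⟨tgt o, s.f o z⟩ : P.BasePoint) = y),
    g = mk ⟨Λ, src, tgt, o, cover, s, hs⟩ ∧
    (∀ α ∈ A, MapsTo (s.f α) (K α) (V α)) ∧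
    ∀ α β, (α, β) ∈ B → MapsTo (s.ρ α β) (L α β) (W α β)}

/-- The "compact-open" topology on the space of based morphisms. -/
instance : TopologicalSpace (BasedMor O x P y) :=
  TopologicalSpace.generateFrom
    {S | ∃ (Λ : Type u) (src : Λ → O.basic) (tgt : Λ → P.basic) (o : Λ)
      (A : Set Λ) (K : ∀ α, Set (O.Hat (src α))) (V : ∀ α, Set (P.Hat (tgt α)))
      (B : Set (Λ × Λ)) (L : ∀ α β, Set (O.Tran (src α) (src β)))
      (W : ∀ α β, Set (P.Tran (tgt α) (tgt β))),
      A.Finite ∧ (∀ α ∈ A, IsCompact (K α) ∧ IsOpen (V α)) ∧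
      B.Finite ∧ (∀ α β, (α, β) ∈ B → IsCompact (L α β) ∧ IsOpen (W α β)) ∧
      S = basicSet src tgt o A K V B L W}

/-- Two based morphisms are homotopic if they are joined by a path in the space of based
morphisms. -/
def Homotopic (f g : BasedMor O x P y) : Prop := Joined f g

/-- `f` is a based homotopy equivalence. -/
def IsHomotopyEquivalence (f : BasedMor O x P y) : Prop :=
  ∃ g : BasedMor P y O x,
    (∃ h, IsComposite g f h ∧ Homotopic h (id O x)) ∧
    (∃ h, IsComposite f g h ∧ Homotopic h (id P y))

end BasedMor

end Morphisms

/-! ### Based loops -/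

/-- A cover of the circle `ℝ/ℤ` by `n + 3` open arcs `(a_i, b_i)`, numbered in cyclic order, of
which only consecutive ones meet (in an arc), with the base point `0` in the arc number `0`.
The end points are lifted to `ℝ` and continued quasi-periodically. -/
structure ArcCover where
  n : ℕ
  a : ℕ → ℝ
  b : ℕ → ℝ
  a_add : ∀ i, a (i + (n + 3)) = a i + 1
  b_add : ∀ i, b (i + (n + 3)) = b i + 1
  overlap : ∀ i, a (i + 1) < b i
  disjoint : ∀ i, b i ≤ a (i + 2)
  a_zero : a 0 < 0
  b_zero : 0 < b 0

/-- The arc number `i`. -/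
def ArcCover.arc (c : ArcCover) (i : Fin (c.n + 3)) : Set UnitAddCircle :=
  (fun t : ℝ => (t : UnitAddCircle)) '' Ioo (c.a i) (c.b i)

theorem ArcCover.zero_mem (c : ArcCover) : (0 : UnitAddCircle) ∈ c.arc 0 :=
  ⟨0, ⟨by simpa using c.a_zero, by simpa using c.b_zero⟩, by simp⟩

/-- The cover by the three arcs `(i/3 - 1/6, i/3 + 1/3)`. -/
noncomputable def ArcCover.three : ArcCover where
  n := 0
  a i := (i : ℝ) / 3 - 1 / 6
  b i := (i : ℝ) / 3 + 1 / 3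
  a_add i := by push_cast; ring
  b_add i := by push_cast; ring
  overlap i := by push_cast; linarith
  disjoint i := by push_cast; linarith
  a_zero := by norm_num
  b_zero := by norm_num

section Loops

variable {X Y : Type u} [TopologicalSpace X] [TopologicalSpace Y]
variable {O : Orbispace X} {P : Orbispace Y}

/-- A based system `({f_i}, {ρ_{i+1,i}})` from the circle, over the arcs of `c` and the basic open
sets `U i`; the indices are cyclic.  `basePt` says that `U 0 = U_o` and `f_0(∗) = ô`. -/
structure LoopOver (O : Orbispace X) (x : O.BasePoint) (c : ArcCover)
    (U : Fin (c.n + 3) → O.basic) where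
  f : ∀ i, C(c.arc i, O.Hat (U i))
  ρ : ∀ i, O.Tran (U i) (U (i + 1))
  compat : ∀ i t (h : t ∈ c.arc i) (h' : t ∈ c.arc (i + 1)),
    f i ⟨t, h⟩ ∈ (O.mp (ρ i)).source ∧ O.mp (ρ i) (f i ⟨t, h⟩) = f (i + 1) ⟨t, h'⟩
  basePt : (⟨U 0, f 0 ⟨0, c.zero_mem⟩⟩ : O.BasePoint) = x

namespace LoopOver

variable {x : O.BasePoint} {y : P.BasePoint} {c : ArcCover} {U : Fin (c.n + 3) → O.basic}

/-- Isomorphism of loop systems, through automorphisms `δ_i` with `δ_0 = 1`. -/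
def Iso (σ τ : LoopOver O x c U) : Prop :=
  ∃ δ : ∀ i, O.Grp (U i), δ 0 = 1 ∧
    (∀ i t, τ.f i t = δ i • σ.f i t) ∧
    ∀ i, τ.ρ i = ((δ (i + 1), δ i) : O.Grp (U (i + 1)) × O.Grp (U i)) • σ.ρ i

/-- The transition maps `ρ_{ji}` of a loop system for `j = i`, `j = i + 1` and `j + 1 = i`. -/
inductive Link (σ : LoopOver O x c U) :
    ∀ i j : Fin (c.n + 3), O.Tran (U i) (U j) → Prop
  | refl (i) : Link σ i i (O.one (U i))
  | step (i) : Link σ i (i + 1) (σ.ρ i)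
  | back (i) (r : O.Tran (U (i + 1)) (U i)) (hr : O.IsInv (σ.ρ i) r) : Link σ (i + 1) i r

/-- The composition of a loop system with a system of maps. -/
def comp (τ : BasedSystem O x P y) (κ : Fin (c.n + 3) → τ.Λ) (h0 : κ 0 = τ.o)
    (σ : LoopOver O x c (fun i => τ.src (κ i))) : LoopOver P y c (fun i => τ.tgt (κ i)) where
  f i := (τ.sys.f (κ i)).comp (σ.f i)
  ρ i := τ.sys.ρ (κ i) (κ (i + 1)) (σ.ρ i)
  compat i t h h' := by
    obtain ⟨h1, h2⟩ := σ.compat i t h h'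
    refine ⟨τ.sys.map_mem _ _ h1, ?_⟩
    simp only [ContinuousMap.comp_apply]
    rw [← h2]
    exact τ.sys.map_eq _ _ h1
  basePt := τ.map_base (κ 0) h0 _ σ.basePt

end LoopOver

/-- A based system from the circle into `(X, x)`. -/
structure LoopSystem (O : Orbispace X) (x : O.BasePoint) where
  c : ArcCover
  U : Fin (c.n + 3) → O.basic
  sys : LoopOver O x c U

namespace LoopSystem

variable {x : O.BasePoint} {y : P.BasePoint}

/-- `τ` is a refinement of `σ`, through an index map `θ` and transition maps
`j_k ∈ Tran(V_k, U_{θ(k)})`, the base ones being trivial: `g_k = j_k⁻¹ ∘ f_{θ(k)}` and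
`ξ_{lk} = j_l⁻¹ ∘ ρ_{θ(l)θ(k)} ∘ j_k`. -/
def IsRefinement (τ σ : LoopSystem O x) : Prop :=
  ∃ (θ : Fin (τ.c.n + 3) → Fin (σ.c.n + 3)) (j : ∀ k, O.Tran (τ.U k) (σ.U (θ k))),
    θ 0 = 0 ∧
    O.arrow (j 0) = O.arrow (O.one (τ.U 0)) ∧
    (∀ k t (h : t ∈ τ.c.arc k), ∃ h' : t ∈ σ.c.arc (θ k),
      τ.sys.f k ⟨t, h⟩ ∈ (O.mp (j k)).source ∧
      O.mp (j k) (τ.sys.f k ⟨t, h⟩) = σ.sys.f (θ k) ⟨t, h'⟩) ∧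
    ∀ k, ∃ r, σ.sys.Link (θ k) (θ (k + 1)) r ∧
      ∀ t (h : t ∈ τ.c.arc k), t ∈ τ.c.arc (k + 1) →
        ∃ e, O.IsComp (j (k + 1)) (τ.sys.ρ k) (τ.sys.f k ⟨t, h⟩) e ∧
          O.IsComp r (j k) (τ.sys.f k ⟨t, h⟩) e

/-- The two loop systems are equivalent: they have isomorphic refinements. -/
def DirectlyEquivalent (σ τ : LoopSystem O x) : Prop :=
  ∃ (c : ArcCover) (U : Fin (c.n + 3) → O.basic) (s t : LoopOver O x c U),
    IsRefinement ⟨c, U, s⟩ σ ∧ IsRefinement ⟨c, U, t⟩ τ ∧ s.Iso t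

/-- The constant loop system. -/
noncomputable def const (O : Orbispace X) (x : O.BasePoint) : LoopSystem O x where
  c := ArcCover.three
  U _ := x.1
  sys :=
    { f := fun _ => ContinuousMap.const _ x.2
      ρ := fun _ => O.one x.1
      compat := fun _ _ _ _ => ⟨by rw [Orbispace.mp, O.one_source]; trivial, O.one_map _ _⟩
      basePt := rfl }

/-- `σ` is the concatenation of `σ₁` (on the first half of the circle) with `σ₂` (on the second
half). It is formed when the base point lies in no arc of `σ₁` or `σ₂` but the ones number `0`.
These two arcs are cut at the base point, and their halves are joined at the times `0` and `1/2`;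
the other arcs, and all transition maps, are kept. -/
structure IsConcat (σ₁ σ₂ σ : LoopSystem O x) : Prop where
  only₁ : ∀ i : Fin (σ₁.c.n + 3), i ≠ 0 → (0 : UnitAddCircle) ∉ σ₁.c.arc i
  only₂ : ∀ i : Fin (σ₂.c.n + 3), i ≠ 0 → (0 : UnitAddCircle) ∉ σ₂.c.arc i
  card : σ.c.n + 3 = (σ₁.c.n + 3) + (σ₂.c.n + 3)
  a_zero : σ.c.a 0 = σ₂.c.a 0 / 2
  b_zero : σ.c.b 0 = σ₁.c.b 0 / 2
  a_mid : σ.c.a (σ₁.c.n + 3) = (σ₁.c.a 0 + 1) / 2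
  b_mid : σ.c.b (σ₁.c.n + 3) = (σ₂.c.b 0 + 1) / 2
  arc₁ : ∀ i, 0 < i → i < σ₁.c.n + 3 →
    σ.c.a i = σ₁.c.a i / 2 ∧ σ.c.b i = σ₁.c.b i / 2
  arc₂ : ∀ i, 0 < i → i < σ₂.c.n + 3 →
    σ.c.a (σ₁.c.n + 3 + i) = (σ₂.c.a i + 1) / 2 ∧
    σ.c.b (σ₁.c.n + 3 + i) = (σ₂.c.b i + 1) / 2
  ρ₁ : ∀ (i : Fin (σ₁.c.n + 3)) (k : Fin (σ.c.n + 3)), (k : ℕ) = i →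
    O.arrow (σ.sys.ρ k) = O.arrow (σ₁.sys.ρ i)
  ρ₂ : ∀ (i : Fin (σ₂.c.n + 3)) (k : Fin (σ.c.n + 3)), (k : ℕ) = σ₁.c.n + 3 + i →
    O.arrow (σ.sys.ρ k) = O.arrow (σ₂.sys.ρ i)
  f₁ : ∀ (i : Fin (σ₁.c.n + 3)) (k : Fin (σ.c.n + 3)),
    ((k : ℕ) = i ∨ (i = 0 ∧ (k : ℕ) = σ₁.c.n + 3)) → ∀ t ∈ Icc (0 : ℝ) 1,
    ∀ (h : (t : UnitAddCircle) ∈ σ₁.c.arc i)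
      (h' : ((t / 2 : ℝ) : UnitAddCircle) ∈ σ.c.arc k),
    (⟨σ.U k, σ.sys.f k ⟨_, h'⟩⟩ : O.BasePoint) = ⟨σ₁.U i, σ₁.sys.f i ⟨_, h⟩⟩
  f₂ : ∀ (i : Fin (σ₂.c.n + 3)) (k : Fin (σ.c.n + 3)),
    ((k : ℕ) = σ₁.c.n + 3 + i ∨ (i = 0 ∧ k = 0)) → ∀ t ∈ Icc (0 : ℝ) 1,
    ∀ (h : (t : UnitAddCircle) ∈ σ₂.c.arc i)
      (h' : (((t + 1) / 2 : ℝ) : UnitAddCircle) ∈ σ.c.arc k),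
    (⟨σ.U k, σ.sys.f k ⟨_, h'⟩⟩ : O.BasePoint) = ⟨σ₂.U i, σ₂.sys.f i ⟨_, h⟩⟩

end LoopSystem

/-- The based loop space `Ω(X, x)`: equivalence classes of based systems from the circle. -/
def OrbiLoop (O : Orbispace X) (x : O.BasePoint) : Type u :=
  Quot (LoopSystem.DirectlyEquivalent (O := O) (x := x))

namespace OrbiLoop

variable {x : O.BasePoint} {y : P.BasePoint}

/-- The loop represented by a loop system. -/
def mk (σ : LoopSystem O x) : OrbiLoop O x := Quot.mk _ σ

/-- The constant loop `õ`, the base point of the loop space. -/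
noncomputable def base (O : Orbispace X) (x : O.BasePoint) : OrbiLoop O x :=
  mk (LoopSystem.const O x)

/-- The set `𝒪(σ, K, V, A)` of the loops represented by some system `({f_i}, {ρ_{i+1,i}})` over
the given arcs and basic open sets with `f_i(K_i) ⊆ V_i` and `ρ_{i+1,i} ∈ A_i`.
(It is empty unless some system `σ` satisfies these conditions.) -/
def basicSet (c : ArcCover) (U : Fin (c.n + 3) → O.basic) (K : ∀ i, Set (c.arc i))
    (V : ∀ i, Set (O.Hat (U i))) (A : ∀ i, Set (O.Tran (U i) (U (i + 1)))) :
    Set (OrbiLoop O x) :=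
  {γ | ∃ s : LoopOver O x c U, γ = mk ⟨c, U, s⟩ ∧
    (∀ i, MapsTo (s.f i) (K i) (V i)) ∧ ∀ i, s.ρ i ∈ A i}

/-- The "compact-open" topology on the based loop space. -/
instance : TopologicalSpace (OrbiLoop O x) :=
  TopologicalSpace.generateFrom
    {S | ∃ (c : ArcCover) (U : Fin (c.n + 3) → O.basic) (K : ∀ i, Set (c.arc i))
      (V : ∀ i, Set (O.Hat (U i))) (A : ∀ i, Set (O.Tran (U i) (U (i + 1)))),
      (∀ i, IsCompact (K i)) ∧ (∀ i, IsOpen (V i)) ∧ (∀ i, IsOpen (A i)) ∧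
      S = basicSet c U K V A}

instance : Nonempty (OrbiLoop O x) := ⟨base O x⟩

/-- `γ` is the concatenation `γ₁ # γ₂`. -/
def IsConcat (γ₁ γ₂ γ : OrbiLoop O x) : Prop :=
  ∃ σ₁ σ₂ σ : LoopSystem O x, γ₁ = mk σ₁ ∧ γ₂ = mk σ₂ ∧ γ = mk σ ∧ LoopSystem.IsConcat σ₁ σ₂ σ

/-- `γ'` is the composition `f ∘ γ`: there are composable systems representing `γ` and `f` whose
composition represents `γ'`. -/
def IsComposite (f : BasedMor O x P y) (γ : OrbiLoop O x) (γ' : OrbiLoop P y) : Prop :=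
  ∃ (τ : BasedSystem O x P y) (c : ArcCover) (κ : Fin (c.n + 3) → τ.Λ) (h0 : κ 0 = τ.o)
    (s : LoopOver O x c (fun i => τ.src (κ i))),
    f = BasedMor.mk τ ∧ γ = mk ⟨c, _, s⟩ ∧ γ' = mk ⟨c, _, s.comp τ κ h0⟩

/-- The map `Ω(f) : Ω(X, x) → Ω(Y, y)`, `γ ↦ f ∘ γ`. -/
noncomputable def map (f : BasedMor O x P y) (γ : OrbiLoop O x) : OrbiLoop P y :=
  Classical.epsilon (IsComposite f γ)

end OrbiLoop

end Loops

/-! ### Homotopy groups -/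

/-- The map between homotopy groups induced by a continuous map preserving base points. -/
def HomotopyGroup.mapOfContinuous {A B : Type u} [TopologicalSpace A] [TopologicalSpace B]
    (n : ℕ) (φ : C(A, B)) {a : A} {b : B} (h : φ a = b) :
    HomotopyGroup.Pi n A a → HomotopyGroup.Pi n B b :=
  Quotient.map
    (fun p => ⟨φ.comp p.1, fun t ht => by
      rw [ContinuousMap.comp_apply, p.2 t ht, h]⟩)
    (fun _ _ hpq => ContinuousMap.HomotopicRel.comp_continuousMap hpq φ)

section Pi

variable {X Y : Type u} [TopologicalSpace X] [TopologicalSpace Y]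
variable {O : Orbispace X} {P : Orbispace Y} {x : O.BasePoint} {y : P.BasePoint}

/-- `OrbiPi n O x` is the homotopy group `π_{n+1}(X, x)`: the `n`-th homotopy group of the based
loop space.  For `n ≥ 1` it carries Mathlib's group structure. -/
abbrev OrbiPi (n : ℕ) (O : Orbispace X) (x : O.BasePoint) : Type u :=
  HomotopyGroup.Pi n (OrbiLoop O x) (OrbiLoop.base O x)

/-- In `π_1(X, x)`, the set of path components of the loop space, `c` is the product of `a` and
`b`: it is the class of a concatenation of loops in the classes `a` and `b`. -/
def IsPiOneProduct (a b c : OrbiPi 0 O x) : Prop :=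
  ∃ u v w : GenLoop (Fin 0) (OrbiLoop O x) (OrbiLoop.base O x),
    a = Quotient.mk _ u ∧ b = Quotient.mk _ v ∧ c = Quotient.mk _ w ∧
    ∀ t, OrbiLoop.IsConcat (u t) (v t) (w t)

open Classical in
/-- The map `f_# : π_{n+1}(X, x) → π_{n+1}(Y, y)` induced by `Ω(f)`, which is continuous and
preserves the base points (the value in the other case is irrelevant). -/
noncomputable def BasedMor.piMap (n : ℕ) (f : BasedMor O x P y) :
    OrbiPi n O x → OrbiPi n P y :=
  if h : Continuous (OrbiLoop.map f) ∧
      OrbiLoop.map f (OrbiLoop.base O x) = OrbiLoop.base P y then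
    HomotopyGroup.mapOfContinuous n ⟨OrbiLoop.map f, h.1⟩ h.2
  else fun _ => default

end Pi

/-! The composition of two transition maps depends on the point at which it is taken, so the natural
setting is the groupoid of germs: its objects are the points of the charts, and an arrow from `p` to
`q` is a transition map carrying `p` to `q`. A system of maps acts functorially on germs, and a loop
over a cover by arcs is a cocycle of germs. No three distinct arcs have a common point, so the
cocycle condition is automatic.

Two loop systems represent the same loop exactly when a locally constant natural family of germs,
trivial at the base point, connects them (`LoopEqv`, `OrbiLoop.mk_eq_iff`). Unlike the relation
through isomorphic refinements, this one is visibly transitive. Over fixed arcs and charts it is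
isomorphism (`LoopEqv.iso`). To compose a loop with a morphism, represent the loop over a fine cover
in the source charts of a system and apply that system. Functoriality on germs and `compLoop_congr`
show that the result depends only on the two classes.

The difficulty in proving continuity is that a basic open set prescribes arcs and charts, whereas
the composition produces representatives over other ones. The bridge is
`LoopOver.exists_cond_of_eqv`: if a loop over a finer cover, in smaller charts, is equivalent to one
satisfying given conditions, then all nearby loops over the finer data can be represented over the
coarse data so as to satisfy these conditions. It rests on a normal form. Gauge transformations give
a loop near a fixed one the same transition maps as the fixed one, except the last, and the action
on transition maps is free, so such a representative is unique (`exists_cond_normalize`,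
`Iso.eq_of_ρ`). Suitable smaller charts are found by refining the system (`exists_refinement`,
`exists_system_cond`).

For homotopy invariance one needs continuity of `f ∘ γ` when both factors vary. It is proved for
families of loops over a locally compact parameter space (`continuous_map_family`). The normalized
representatives vary continuously, so over a compact neighbourhood they sweep out compact sets of
points and of transition maps, and the compact-open topology controls morphisms on such sets. With a
cube as parameter space, a path of morphisms yields a homotopy relative to the boundary.

The second assertion follows from functoriality and the first. For `k ≥ 2` the product is formed by
concatenation in a cube coordinate, which commutes with composition by any map. For `k = 1` one
shows that morphisms preserve concatenations of loops (`OrbiLoop.IsConcat.map`), by re-charting both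
halves compatibly. The converse implication for products comes from the homotopy inverse. -/

open CategoryTheory

/-! ### Domains, uniqueness and inverses of transition maps -/

namespace Orbispace

variable {X : Type u} [TopologicalSpace X] {O : Orbispace X}

theorem proj_smul {a : O.basic} (g : O.Grp a) (z : O.Hat a) :
    (O.chart a).proj (g • z) = (O.chart a).proj z :=
  (((O.chart a).proj_eq_iff z (g • z)).2 ⟨g, rfl⟩).symm

theorem isOpen_basic (a : O.basic) : IsOpen (a : Set X) := O.isBasis.isOpen a.2

theorem continuous_proj (a : O.basic) : Continuous fun z : O.Hat a => ((O.chart a).proj z : X) :=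
  continuous_subtype_val.comp (O.chart a).isQuotientMap.continuous

theorem locallyConnectedSpace (O : Orbispace X) : LocallyConnectedSpace X := by
  rw [locallyConnectedSpace_iff_subsets_isOpen_isConnected]
  intro x U hU
  obtain ⟨V, hV, hx, hVU⟩ := O.isBasis.mem_nhds_iff.1 hU
  exact ⟨V, hVU, O.isBasis.isOpen hV, hx, O.isConnected V hV⟩

section Source

variable {a b : O.basic} {t t' : O.Tran a b} {p q : O.Hat a}

theorem proj_mem_base (hp : p ∈ (O.mp t).source) : ((O.chart a).proj p : X) ∈ (O.tr t).base := by
  obtain ⟨x, -, e⟩ := (O.tr t).source_induced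
  have : p ∈ (O.tr t).map.source := hp
  rw [e] at this
  exact connectedComponentIn_subset {z | ((O.chart a).proj z : X) ∈ (O.tr t).base} x this

theorem source_eq (hp : p ∈ (O.mp t).source) :
    (O.mp t).source = connectedComponentIn {z | ((O.chart a).proj z : X) ∈ (O.tr t).base} p := by
  obtain ⟨x, -, e⟩ := (O.tr t).source_induced
  have h : p ∈ (O.tr t).map.source := hp
  rw [e] at h
  exact e.trans (connectedComponentIn_eq h)

theorem target_eq {q : O.Hat b} (hq : q ∈ (O.mp t).target) :
    (O.mp t).target = connectedComponentIn {z | ((O.chart b).proj z : X) ∈ (O.tr t).base} q := by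
  obtain ⟨x, -, e⟩ := (O.tr t).target_induced
  have h : q ∈ (O.tr t).map.target := hq
  rw [e] at h
  exact e.trans (connectedComponentIn_eq h)

theorem base_subset (t : O.Tran a b) : (O.tr t).base ⊆ (a : Set X) ∩ b := by
  obtain ⟨x, -, e⟩ := (O.tr t).isComponent
  rw [e]; exact connectedComponentIn_subset _ _

theorem base_eq (hp : p ∈ (O.mp t).source) :
    (O.tr t).base = connectedComponentIn ((a : Set X) ∩ b) ((O.chart a).proj p) := by
  obtain ⟨x, -, e⟩ := (O.tr t).isComponent
  have h := proj_mem_base hp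
  rw [e] at h
  exact e.trans (connectedComponentIn_eq h)

theorem source_nonempty (t : O.Tran a b) : (O.mp t).source.Nonempty := by
  obtain ⟨x, hx, e⟩ := (O.tr t).source_induced
  refine ⟨x, ?_⟩
  rw [mp, e]
  exact mem_connectedComponentIn hx

theorem isPreconnected_source (t : O.Tran a b) : IsPreconnected (O.mp t).source := by
  obtain ⟨p, hp⟩ := source_nonempty t
  rw [source_eq hp]
  exact isPreconnected_connectedComponentIn

theorem isOpen_source (t : O.Tran a b) : IsOpen (O.mp t).source := (O.mp t).open_source

theorem proj_mp (hp : p ∈ (O.mp t).source) :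
    ((O.chart b).proj (O.mp t p) : X) = (O.chart a).proj p := (O.tr t).proj_map p hp

/-- A domain is a full connected component of the preimage of its base. Questions about domains
thereby become questions about connected sets. -/
theorem subset_source {C : Set (O.Hat a)} (hC : IsPreconnected C)
    (hCb : ∀ z ∈ C, ((O.chart a).proj z : X) ∈ (O.tr t).base) (hp : p ∈ (O.mp t).source)
    (hpC : p ∈ C) : C ⊆ (O.mp t).source := by
  rw [source_eq hp]
  exact hC.subset_connectedComponentIn hpC hCb

/-- Translates of the domain are connected and lie over the same base, because the projection is
invariant. A translate that meets the domain is therefore contained in it, and the same applies to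
the inverse element. -/
theorem mem_stabilizer (hp : p ∈ (O.mp t).source) {g : O.Grp a} (hg : g • p ∈ (O.mp t).source) :
    g ∈ MulAction.stabilizer (O.Grp a) (O.mp t).source := by
  have key : ∀ g : O.Grp a, g • p ∈ (O.mp t).source → g • (O.mp t).source ⊆ (O.mp t).source := by
    intro g hg
    refine subset_source ?_ ?_ hg ⟨p, hp, rfl⟩
    · exact (isPreconnected_source t).image _ (continuous_const_smul g).continuousOn
    · rintro _ ⟨z, hz, rfl⟩
      change ((O.chart a).proj (g • z) : X) ∈ _
      rw [proj_smul]; exact proj_mem_base hz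
  have key2 : ∀ g : O.Grp a, ∀ q ∈ (O.mp t).source, g • q ∈ (O.mp t).source →
      g • (O.mp t).source ⊆ (O.mp t).source := by
    intro g q hq hg
    refine subset_source ?_ ?_ hg ⟨q, hq, rfl⟩
    · exact (isPreconnected_source t).image _ (continuous_const_smul g).continuousOn
    · rintro _ ⟨z, hz, rfl⟩
      change ((O.chart a).proj (g • z) : X) ∈ _
      rw [proj_smul]; exact proj_mem_base hz
  rw [MulAction.mem_stabilizer_iff]
  refine (key g hg).antisymm ?_
  rw [Set.subset_smul_set_iff]
  exact key2 g⁻¹ _ hg (by rwa [inv_smul_smul])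

theorem source_left (h : O.Grp b) (t : O.Tran a b) :
    (O.mp ((h, (1 : O.Grp a)) • t)).source = (O.mp t).source := by
  rw [mp, O.smul_source, one_smul]

theorem mp_left (h : O.Grp b) (t : O.Tran a b) (hp : p ∈ (O.mp t).source) :
    O.mp ((h, (1 : O.Grp a)) • t) p = h • O.mp t p := by
  rw [mp, O.smul_map h 1 t p (by rw [← source_left h t] at hp; exact hp), inv_one, one_smul]

/-- Two transition maps defined at a common point differ by an automorphism of the target. -/
theorem exists_left_eq (hp : p ∈ (O.mp t).source) (hp' : p ∈ (O.mp t').source) :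
    ∃ h : O.Grp b, t' = (h, (1 : O.Grp a)) • t := by
  obtain ⟨h, g, e⟩ := O.smul_transitive t t' (by rw [base_eq hp, base_eq hp'])
  have hs : p ∈ g • (O.mp t).source := by
    have := hp'
    rw [mp, e, O.smul_source] at this
    exact this
  -- Both `p` and `g⁻¹ • p` lie in the domain of `t`, so `g` stabilizes it. Then `(λ(g), g)` fixes
  -- `t`, which allows the right factor `g` to be traded for a left factor.
  rw [Set.mem_smul_set_iff_inv_smul_mem] at hs
  have hg := mem_stabilizer hp hs
  have hg : g ∈ MulAction.stabilizer (O.Grp a) (O.tr t).map.source := by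
    simpa using inv_mem hg
  have h1 := (O.smul_eq_iff ((O.tr t).iso ⟨g, hg⟩ : O.Grp b) g t).2 ⟨hg, rfl⟩
  generalize ((O.tr t).iso ⟨g, hg⟩ : O.Grp b) = k at h1
  refine ⟨h * k⁻¹, ?_⟩
  conv_rhs => rw [← h1]
  rw [smul_smul, e, Prod.mk_mul_mk, inv_mul_cancel_right, one_mul]

/-- An element `h` with `(h, 1) • t = t` equals `λ(1) = 1` by `smul_eq_iff`. This freeness is used
whenever an automorphism has to be shown trivial. -/
theorem left_injective (t : O.Tran a b) :
    Function.Injective fun h : O.Grp b => ((h, 1) : O.Grp b × O.Grp a) • t := by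
  have key : ∀ h : O.Grp b, ((h, 1) : O.Grp b × O.Grp a) • t = t → h = 1 := by
    intro h e
    obtain ⟨hg, e⟩ := (O.smul_eq_iff h 1 t).1 e
    rw [← e]
    have : (⟨1, hg⟩ : MulAction.stabilizer (O.Grp a) (O.tr t).map.source) = 1 := rfl
    rw [this, map_one, OneMemClass.coe_one]
  intro h h' e
  have := key (h'⁻¹ * h) (by
    have e2 : ((h'⁻¹ * h, 1) : O.Grp b × O.Grp a) = (h'⁻¹, 1) * (h, 1) := by simp
    rw [e2, mul_smul]
    change _ • ((h, 1) : O.Grp b × O.Grp a) • t = t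
    have e' : ((h, 1) : O.Grp b × O.Grp a) • t = ((h', 1) : O.Grp b × O.Grp a) • t := e
    rw [e', smul_smul]; simp [← Prod.one_eq_mk])
  exact (inv_mul_eq_one.1 this).symm

/-- Here `a ∩ b = a` is connected, so it is the base, and the whole connected space over `a` lies in
a single component. The transition maps of refinements are therefore defined everywhere. -/
theorem source_univ (hab : (a : Set X) ⊆ b) (t : O.Tran a b) : (O.mp t).source = univ := by
  obtain ⟨p, hp⟩ := source_nonempty t
  have hb : (O.tr t).base = a := by
    rw [base_eq hp, inter_eq_left.2 hab]
    exact (O.isConnected a a.2).isPreconnected.connectedComponentIn ((O.chart a).proj p).2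
  refine eq_univ_of_univ_subset (subset_source isPreconnected_univ ?_ hp (mem_univ p))
  intro z _
  rw [hb]; exact ((O.chart a).proj z).2

theorem target_univ (hab : (b : Set X) ⊆ a) (t : O.Tran a b) : (O.mp t).target = univ := by
  obtain ⟨p, hp⟩ := source_nonempty t
  have hb : (O.tr t).base = b := by
    rw [base_eq hp, inter_eq_right.2 hab]
    exact (O.isConnected b b.2).isPreconnected.connectedComponentIn
      (base_subset t (proj_mem_base hp)).2
  rw [target_eq ((O.mp t).map_source hp)]
  have : {z | ((O.chart b).proj z : X) ∈ (O.tr t).base} = univ := by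
    rw [hb]; exact eq_univ_of_forall fun z => ((O.chart b).proj z).2
  rw [this]
  exact isPreconnected_univ.connectedComponentIn (mem_univ _)

end Source

section Comp

variable {a b c d : O.basic}

theorem IsComp.mem {j : O.Tran b c} {i : O.Tran a b} {x : O.Hat a} {t : O.Tran a c}
    (h : O.IsComp j i x t) : x ∈ (O.mp t).source := by
  obtain ⟨hx, hy, rfl⟩ := h
  exact O.comp_mem j i x hx hy

theorem IsComp.map {j : O.Tran b c} {i : O.Tran a b} {x : O.Hat a} {t : O.Tran a c}
    (h : O.IsComp j i x t) : O.mp t x = O.mp j (O.mp i x) := by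
  obtain ⟨hx, hy, rfl⟩ := h
  exact O.comp_map j i x hx hy

theorem IsComp.unique {j : O.Tran b c} {i : O.Tran a b} {x : O.Hat a} {t t' : O.Tran a c}
    (h : O.IsComp j i x t) (h' : O.IsComp j i x t') : t = t' := by
  obtain ⟨hx, hy, rfl⟩ := h
  obtain ⟨_, _, rfl⟩ := h'
  rfl

/-- The composition is constant on preconnected sets. -/
theorem IsComp.of_isPreconnected {j : O.Tran b c} {i : O.Tran a b} {x y : O.Hat a} {t : O.Tran a c}
    (h : O.IsComp j i x t) {C : Set (O.Hat a)} (hC : IsPreconnected C) (hx : x ∈ C) (hy : y ∈ C)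
    (hCs : ∀ z ∈ C, z ∈ (O.mp i).source ∧ O.mp i z ∈ (O.mp j).source) : O.IsComp j i y t := by
  obtain ⟨h1, h2, rfl⟩ := h
  refine ⟨(hCs y hy).1, (hCs y hy).2, ?_⟩
  exact (O.comp_locallyConstant j i x y h1 h2 _ _ (hC.subset_connectedComponentIn hx hCs hy)).symm

theorem isComp_left (h : O.Grp b) (t : O.Tran a b) {x : O.Hat a} (hx : x ∈ (O.mp t).source) :
    O.IsComp ((h, (1 : O.Grp b)) • O.one b) t x ((h, (1 : O.Grp a)) • t) := by
  have hy : O.mp t x ∈ (O.tr ((h, (1 : O.Grp b)) • O.one b)).map.source := by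
    rw [O.smul_source, one_smul, O.one_source]; trivial
  exact ⟨hx, hy, O.comp_left h t x hx hy⟩

theorem one_smul_one (b : O.basic) : ((1 : O.Grp b), (1 : O.Grp b)) • O.one b = O.one b :=
  one_smul _ _

theorem isComp_one_left (t : O.Tran a b) {x : O.Hat a} (hx : x ∈ (O.mp t).source) :
    O.IsComp (O.one b) t x t := by
  have := isComp_left 1 t hx
  rw [one_smul_one] at this
  have e : ((1 : O.Grp b), (1 : O.Grp a)) • t = t := one_smul _ _
  rwa [e] at this

theorem isComp_right (g : O.Grp a) (t : O.Tran a b) {x : O.Hat a} (hx : g • x ∈ (O.mp t).source) :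
    O.IsComp t ((g, (1 : O.Grp a)) • O.one a) x (((1 : O.Grp b), g⁻¹) • t) := by
  have hx1 : x ∈ (O.tr (O.one a)).map.source := by rw [O.one_source]; trivial
  have hx' : x ∈ (O.tr ((g, (1 : O.Grp a)) • O.one a)).map.source := by
    rw [O.smul_source, one_smul]; exact hx1
  have e : (O.tr ((g, (1 : O.Grp a)) • O.one a)).map x = g • x := by
    have := mp_left g (O.one a) hx1
    rwa [mp, mp, O.one_map] at this
  have hy : (O.tr ((g, (1 : O.Grp a)) • O.one a)).map x ∈ (O.tr t).map.source := by
    rw [e]; exact hx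
  exact ⟨hx', hy, O.comp_right g t x hx' hy⟩

theorem isComp_one_right (t : O.Tran a b) {x : O.Hat a} (hx : x ∈ (O.mp t).source) :
    O.IsComp t (O.one a) x t := by
  have := isComp_right 1 t (x := x) (by rwa [one_smul])
  rw [one_smul_one, inv_one] at this
  have e : ((1 : O.Grp b), (1 : O.Grp a)) • t = t := one_smul _ _
  rwa [e] at this

theorem exists_isComp (j : O.Tran b c) (i : O.Tran a b) {x : O.Hat a} (hx : x ∈ (O.mp i).source)
    (hy : O.mp i x ∈ (O.mp j).source) : ∃ t, O.IsComp j i x t := ⟨_, hx, hy, rfl⟩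

theorem IsComp.assoc {k : O.Tran c d} {j : O.Tran b c} {i : O.Tran a b} {x : O.Hat a}
    {ji : O.Tran a c} {kj : O.Tran b d} {t : O.Tran a d}
    (h₁ : O.IsComp j i x ji) (h₂ : O.IsComp k j (O.mp i x) kj) (h : O.IsComp k ji x t) :
    O.IsComp kj i x t := by
  obtain ⟨hx, hy, rfl⟩ := h₁
  obtain ⟨-, hz, rfl⟩ := h₂
  obtain ⟨_, _, rfl⟩ := h
  exact ⟨hx, O.comp_mem _ _ _ _ _, (O.comp_assoc k j i x hx hy hz).symm⟩

/-- There is a transition map through any point over the intersection. -/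
theorem exists_tran (a b : O.basic) (p : O.Hat a) (hp : ((O.chart a).proj p : X) ∈ (b : Set X)) :
    ∃ t : O.Tran a b, p ∈ (O.mp t).source := by
  have := O.locallyConnectedSpace
  set x : X := ((O.chart a).proj p : X) with hx
  have hxab : x ∈ (a : Set X) ∩ b := ⟨((O.chart a).proj p).2, hp⟩
  -- The component `W` is itself basic. The maps `a → W` and `W → b` are total on the side of `W`,
  -- so they compose. A translation in the orbit then moves the domain of the composite to `p`.
  set W := connectedComponentIn ((a : Set X) ∩ b) x
  have hxW : x ∈ W := mem_connectedComponentIn hxab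
  have hWs : W ⊆ (a : Set X) ∩ b := connectedComponentIn_subset _ _
  have hW : W ∈ O.basic := O.mem_of_subset a a.2 W (hWs.trans inter_subset_left)
    (((isOpen_basic a).inter (isOpen_basic b)).connectedComponentIn)
    (isConnected_connectedComponentIn_iff.2 hxab)
  obtain ⟨t₁⟩ := O.nonempty_tran a ⟨W, hW⟩ ⟨x, hxab.1, hxW⟩
  obtain ⟨t₂⟩ := O.nonempty_tran ⟨W, hW⟩ b ⟨x, hxW, hxab.2⟩
  have h₁ : (O.mp t₁).target = univ := target_univ (hWs.trans inter_subset_left) t₁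
  have h₂ : (O.mp t₂).source = univ := source_univ (hWs.trans inter_subset_right) t₂
  obtain ⟨w, hw⟩ := (O.chart ⟨W, hW⟩).isQuotientMap.surjective ⟨x, hxW⟩
  have hwt : w ∈ (O.mp t₁).target := by rw [h₁]; trivial
  have hq := (O.mp t₁).map_target hwt
  obtain ⟨t, ht⟩ := exists_isComp t₂ t₁ hq (by rw [h₂]; trivial)
  have hpq : (O.chart a).proj ((O.mp t₁).symm w) = (O.chart a).proj p := by
    apply Subtype.ext
    rw [← proj_mp hq, (O.mp t₁).right_inv hwt, hw]
  obtain ⟨g, hg⟩ := ((O.chart a).proj_eq_iff _ _).1 hpq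
  refine ⟨((1 : O.Grp b), g) • t, ?_⟩
  rw [mp, O.smul_source, ← hg]
  exact Set.smul_mem_smul_set ht.mem

/-- A transition map `r₀` back from `t p` composes with `t` to a map defined at `p`, which differs
from the identity by an automorphism `h`. Correcting `r₀` by `h` gives an inverse at `p`, and the
connectedness of the domain of `t` spreads this to all its points. -/
theorem exists_isInv (t : O.Tran a b) : ∃ r, O.IsInv t r := by
  obtain ⟨p, hp⟩ := source_nonempty t
  have hpa : ((O.chart b).proj (O.mp t p) : X) ∈ (a : Set X) := by
    rw [proj_mp hp]; exact ((O.chart a).proj p).2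
  obtain ⟨r₀, hr₀⟩ := exists_tran b a (O.mp t p) hpa
  obtain ⟨e, he⟩ := exists_isComp r₀ t hp hr₀
  have h1 : p ∈ (O.mp (O.one a)).source := by rw [mp, O.one_source]; trivial
  obtain ⟨h, hh⟩ := exists_left_eq he.mem h1
  have hr : O.mp t p ∈ (O.mp ((h, (1 : O.Grp b)) • r₀)).source := by rwa [source_left]
  refine ⟨(h, (1 : O.Grp b)) • r₀, ?_⟩
  have hc : O.IsComp ((h, (1 : O.Grp b)) • r₀) t p (O.one a) := by
    refine he.assoc (isComp_left h r₀ hr₀) ?_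
    have := isComp_left h e he.mem
    rwa [← hh] at this
  have hst : ∀ x ∈ (O.mp t).source, O.mp t x ∈ (O.mp ((h, (1 : O.Grp b)) • r₀)).source := by
    intro x hx
    refine subset_source (C := (O.mp t) '' (O.mp t).source)
      ((isPreconnected_source t).image _ (O.mp t).continuousOn) ?_ hr ⟨p, hp, rfl⟩ ⟨x, hx, rfl⟩
    rintro _ ⟨z, hz, rfl⟩
    rw [base_eq hr, proj_mp hz, proj_mp hp, inter_comm, ← base_eq hp]
    exact proj_mem_base hz
  intro x hx
  exact hc.of_isPreconnected (isPreconnected_source t) hp hx fun z hz => ⟨hz, hst z hz⟩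

theorem IsInv.unique {t : O.Tran a b} {r r' : O.Tran b a} (h : O.IsInv t r) (h' : O.IsInv t r') :
    r = r' := by
  obtain ⟨p, hp⟩ := source_nonempty t
  obtain ⟨k, rfl⟩ := exists_left_eq (h p hp).2.1 (h' p hp).2.1
  have h1 := h' p hp
  have h2 : O.IsComp ((k, (1 : O.Grp b)) • r) t p ((k, (1 : O.Grp a)) • O.one a) :=
    (h p hp).assoc (isComp_left k r (h p hp).2.1) (isComp_left k (O.one a) (h p hp).mem)
  have h3 := h2.unique h1
  rw [← one_smul_one] at h3
  have h4 : ((k, 1) : O.Grp a × O.Grp a) • O.one a = ((1, 1) : O.Grp a × O.Grp a) • O.one a := by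
    rw [one_smul_one] at h3 ⊢; exact h3
  have h5 : k = 1 := left_injective (O.one a) h4
  rw [h5]
  exact (one_smul (O.Grp a × O.Grp b) r).symm

/-- The inverse of a transition map. -/
noncomputable def inv (t : O.Tran a b) : O.Tran b a := (exists_isInv t).choose

theorem isInv_inv (t : O.Tran a b) : O.IsInv t (inv t) := (exists_isInv t).choose_spec

theorem mem_source_inv {t : O.Tran a b} {p : O.Hat a} (hp : p ∈ (O.mp t).source) :
    O.mp t p ∈ (O.mp (inv t)).source := (isInv_inv t p hp).2.1

theorem one_mp (p : O.Hat a) : O.mp (O.one a) p = p := O.one_map a p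

theorem mem_source_one (p : O.Hat a) : p ∈ (O.mp (O.one a)).source := by
  rw [mp, O.one_source]; trivial

theorem mp_inv_mp {t : O.Tran a b} {p : O.Hat a} (hp : p ∈ (O.mp t).source) :
    O.mp (inv t) (O.mp t p) = p := by
  rw [← (isInv_inv t p hp).map, one_mp]

/-- The composite `e = t ∘ t⁻¹` satisfies `e ∘ t = t`. It differs from the identity by an
automorphism, which then fixes `t` and is trivial by freeness. -/
theorem isComp_inv_right {t : O.Tran a b} {p : O.Hat a} (hp : p ∈ (O.mp t).source) :
    O.IsComp t (inv t) (O.mp t p) (O.one b) := by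
  have h1 := isInv_inv t p hp
  obtain ⟨e, he⟩ := exists_isComp t (inv t) (mem_source_inv hp) (by rwa [mp_inv_mp hp])
  have h2 : O.IsComp e t p t := h1.assoc he (isComp_one_right t hp)
  obtain ⟨h, rfl⟩ := exists_left_eq (mem_source_one (O.mp t p)) h2.2.1
  have h3 := (isComp_left h t hp).unique h2
  have h5 : h = 1 := left_injective t (h3.trans (one_smul (O.Grp b × O.Grp a) t).symm)
  rw [h5, one_smul_one] at he
  exact he

end Comp

end Orbispace

/-! ### The groupoid of germs -/

namespace Orbispace

variable {X : Type u} [TopologicalSpace X]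

/-- The objects of the groupoid of germs of an orbispace: points of the charts. -/
structure Pt (O : Orbispace X) : Type u where
  chart : O.basic
  pt : O.Hat chart

variable {O : Orbispace X}

/-- A germ from `p` to `q`: a transition map which maps `p` to `q`. -/
@[ext]
structure Germ (p q : O.Pt) : Type u where
  val : O.Tran p.chart q.chart
  mem : p.pt ∈ (O.mp val).source
  mp_eq : O.mp val p.pt = q.pt

/-- The composition of germs. -/
def Germ.comp {p q r : O.Pt} (f : Germ p q) (g : Germ q r) : Germ p r :=
  have h : O.mp f.val p.pt ∈ (O.mp g.val).source := by rw [f.mp_eq]; exact g.mem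
  ⟨O.comp g.val f.val p.pt f.mem h, O.comp_mem _ _ _ _ _, by
    rw [mp, O.comp_map, ← g.mp_eq, ← f.mp_eq]⟩

theorem Germ.isComp {p q r : O.Pt} (f : Germ p q) (g : Germ q r) :
    O.IsComp g.1 f.1 p.pt (f.comp g).1 := ⟨_, _, rfl⟩

theorem Germ.eq_comp {p q r : O.Pt} {f : Germ p q} {g : Germ q r} {k : Germ p r}
    (h : O.IsComp g.1 f.1 p.pt k.1) : k = f.comp g :=
  Germ.ext (h.unique (f.isComp g))

/-- At a fixed point the composition is an honest operation. Cancellation in this groupoid replaces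
all manipulations of compositions at varying points. -/
noncomputable instance : Groupoid O.Pt where
  Hom := Germ
  id p := ⟨O.one p.chart, mem_source_one _, one_mp _⟩
  comp f g := f.comp g
  id_comp f := (Germ.eq_comp (isComp_one_right f.1 (x := _) f.mem)).symm
  comp_id f := (Germ.eq_comp (isComp_one_left f.1 (x := _) f.mem)).symm
  assoc {p q r s} f g h := by
    refine Germ.eq_comp ?_
    have h1 := f.isComp g
    have h2 := g.isComp h
    rw [← f.mp_eq] at h2
    exact h1.assoc h2 ((f.comp g).isComp h)
  inv f := ⟨inv f.1, by rw [← f.mp_eq]; exact mem_source_inv f.mem, by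
    rw [← f.mp_eq]; exact mp_inv_mp f.mem⟩
  inv_comp {p q} f := by
    refine (Germ.eq_comp ?_).symm
    have := isComp_inv_right f.mem
    rwa [f.mp_eq] at this
  comp_inv f := by
    refine (Germ.eq_comp ?_).symm
    exact isInv_inv f.1 _ f.mem

section Hom

variable {p q r s : O.Pt}

theorem Hom.mem (f : p ⟶ q) : p.pt ∈ (O.mp f.1).source := f.2

theorem Hom.mp_eq (f : p ⟶ q) : O.mp f.1 p.pt = q.pt := f.3

theorem Hom.isComp (f : p ⟶ q) (g : q ⟶ r) : O.IsComp g.1 f.1 p.pt (f ≫ g).1 := Germ.isComp f g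

theorem Hom.eq_comp {f : p ⟶ q} {g : q ⟶ r} {k : p ⟶ r} (h : O.IsComp g.1 f.1 p.pt k.1) :
    k = f ≫ g := Germ.eq_comp h

theorem Hom.ext {f g : p ⟶ q} (h : f.1 = g.1) : f = g := Germ.ext h

theorem Hom.inv_val (f : p ⟶ q) : (Groupoid.inv f).1 = inv f.1 := rfl

/-- The germ of a transition map at a point of its domain. -/
def germ {a b : O.basic} (t : O.Tran a b) (z : O.Hat a) (hz : z ∈ (O.mp t).source) :
    (⟨a, z⟩ : O.Pt) ⟶ ⟨b, O.mp t z⟩ := ⟨t, hz, rfl⟩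

/-- A germ which is an identity (up to an equality of the end points). -/
def IsTriv (e : p ⟶ q) : Prop := ∃ h : p = q, e = eqToHom h

theorem IsTriv.comp {e : p ⟶ q} {e' : q ⟶ r} (h : IsTriv e) (h' : IsTriv e') :
    IsTriv (e ≫ e') := by
  obtain ⟨rfl, rfl⟩ := h
  obtain ⟨rfl, rfl⟩ := h'
  exact ⟨rfl, by simp⟩

theorem IsTriv.inv {e : p ⟶ q} (h : IsTriv e) : IsTriv (Groupoid.inv e) := by
  obtain ⟨rfl, rfl⟩ := h
  exact ⟨rfl, by simp [Groupoid.inv_eq_inv]⟩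

theorem isTriv_id (p : O.Pt) : IsTriv (𝟙 p) := ⟨rfl, rfl⟩

theorem IsTriv.arrow_eq {e : p ⟶ q} (h : IsTriv e) : O.arrow e.1 = O.arrow (O.one p.chart) := by
  obtain ⟨rfl, rfl⟩ := h
  rfl

/-- Base conditions are stated as equalities of arrows, because the charts involved agree only
propositionally. This translates them into statements about germs. -/
theorem isTriv_of_arrow_eq {e : p ⟶ q} {d : O.basic} (h : O.arrow e.1 = O.arrow (O.one d)) :
    IsTriv e := by
  obtain ⟨a, x⟩ := p
  obtain ⟨b, y⟩ := q
  obtain ⟨t, h1, h2⟩ := e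
  obtain ⟨rfl, h⟩ := Sigma.mk.inj_iff.1 h
  obtain ⟨hb, h⟩ := Sigma.mk.inj_iff.1 (eq_of_heq h)
  change b = a at hb
  subst hb
  obtain rfl := eq_of_heq h
  change O.mp (O.one b) x = y at h2
  rw [one_mp] at h2
  subst h2
  exact ⟨rfl, rfl⟩

theorem idem_eq_id {e : p ⟶ p} (h : e ≫ e = e) : e = 𝟙 p := by
  have : Groupoid.inv e ≫ e ≫ e = Groupoid.inv e ≫ e := by rw [h]
  simpa using this

end Hom

section Act

variable {a b : O.basic}

/-- The germ of an automorphism. -/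
def autGerm {a : O.basic} (g : O.Grp a) (z : O.Hat a) : (⟨a, z⟩ : O.Pt) ⟶ ⟨a, g • z⟩ :=
  ⟨(g, (1 : O.Grp a)) • O.one a, by rw [source_left]; exact mem_source_one z, by
    rw [mp_left _ _ (mem_source_one z), one_mp]⟩

theorem mem_source_smul (h : O.Grp b) (g : O.Grp a) {t : O.Tran a b} {z : O.Hat a}
    (hz : z ∈ (O.mp t).source) : g • z ∈ (O.mp ((h, g) • t)).source := by
  rw [mp, O.smul_source]; exact smul_mem_smul_set hz

theorem mp_smul (h : O.Grp b) (g : O.Grp a) {t : O.Tran a b} {z : O.Hat a}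
    (hz : z ∈ (O.mp t).source) : O.mp ((h, g) • t) (g • z) = h • O.mp t z := by
  rw [mp, O.smul_map h g t (g • z) (mem_source_smul h g hz), inv_smul_smul]

/-- `(h, g) • t` is `h ∘ t ∘ g⁻¹`. -/
theorem isComp_smul (h : O.Grp b) (g : O.Grp a) {t : O.Tran a b} {z : O.Hat a}
    (hz : z ∈ (O.mp t).source) :
    O.IsComp ((h, g) • t) ((g, (1 : O.Grp a)) • O.one a) z ((h, (1 : O.Grp a)) • t) := by
  have := isComp_right g ((h, g) • t) (mem_source_smul h g hz)
  rwa [smul_smul, Prod.mk_mul_mk, one_mul, inv_mul_cancel] at this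

end Act

/-- Composition of locally constant families of transition maps is locally constant. -/
theorem isLocallyConstant_comp {T : Type*} [TopologicalSpace T] {a b c : O.basic} {v : T → O.Hat a}
    (hv : Continuous v) {J : T → O.Tran b c} {I : T → O.Tran a b} {R : T → O.Tran a c}
    (hI : IsLocallyConstant I) (hJ : IsLocallyConstant J)
    (h : ∀ t, O.IsComp (J t) (I t) (v t) (R t)) : IsLocallyConstant R := by
  rw [IsLocallyConstant.iff_eventually_eq] at hI hJ ⊢
  intro t₀
  -- With `I` and `J` frozen at `t₀`, the composite depends only on the component of `D` containing
  -- `v t`. Since `D` is open in a locally connected space, that component is a neighbourhood of `v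
  -- t₀`.
  set D : Set (O.Hat a) := (O.mp (I t₀)).source ∩ O.mp (I t₀) ⁻¹' (O.mp (J t₀)).source
  have hD : IsOpen D := (O.mp (I t₀)).isOpen_inter_preimage (isOpen_source _)
  have h0 : v t₀ ∈ D := ⟨(h t₀).1, (h t₀).2.1⟩
  have hC := hv.continuousAt.preimage_mem_nhds
    ((hD.connectedComponentIn (x := v t₀)).mem_nhds (mem_connectedComponentIn h0))
  filter_upwards [hI t₀, hJ t₀, hC] with t h1 h2 h3
  have h4 := h t
  rw [h1, h2] at h4
  exact h4.unique ((h t₀).of_isPreconnected isPreconnected_connectedComponentIn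
    (mem_connectedComponentIn h0) h3 fun z hz => connectedComponentIn_subset D (v t₀) hz)

/-! ### The topology of the sets of transition maps -/

section TranTopology

variable {a b : O.basic}

theorem isOpen_tran_iff {S : Set (O.Tran a b)} :
    IsOpen S ↔ ∀ t : O.Tran a b, IsOpen {h : O.Grp b | ((h, 1) : O.Grp b × O.Grp a) • t ∈ S} := by
  rw [tranTopology, isOpen_iSup_iff]
  exact forall_congr' fun t => isOpen_coinduced

theorem continuous_left (t : O.Tran a b) :
    Continuous fun h : O.Grp b => ((h, 1) : O.Grp b × O.Grp a) • t :=
  continuous_iff_coinduced_le.2 (le_iSup (fun t : O.Tran a b => TopologicalSpace.coinduced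
    (fun h : O.Grp b => ((h, 1) : O.Grp b × O.Grp a) • t) inferInstance) t)

theorem left_mul (h k : O.Grp b) (t : O.Tran a b) :
    ((h * k, 1) : O.Grp b × O.Grp a) • t = ((h, 1) : O.Grp b × O.Grp a) •
      ((k, 1) : O.Grp b × O.Grp a) • t := by
  rw [smul_smul, Prod.mk_mul_mk, one_mul]

/-- Seen from another point of the same orbit, the set is a right translate of `N`. Seen from
another orbit, it is empty. -/
theorem isOpen_left_image {N : Set (O.Grp b)} (hN : IsOpen N) (t : O.Tran a b) :
    IsOpen ((fun h : O.Grp b => ((h, 1) : O.Grp b × O.Grp a) • t) '' N) := by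
  rw [isOpen_tran_iff]
  intro t'
  by_cases ht : ∃ k : O.Grp b, t' = ((k, 1) : O.Grp b × O.Grp a) • t
  · obtain ⟨k, rfl⟩ := ht
    convert hN.preimage (continuous_mul_const k) using 1
    ext h
    constructor
    · rintro ⟨n, hn, e⟩
      rw [← left_mul] at e
      obtain rfl := left_injective t e
      exact hn
    · intro hn
      exact ⟨h * k, hn, left_mul _ _ _⟩
  · convert isOpen_empty
    refine eq_empty_of_forall_notMem ?_
    rintro h ⟨n, -, e⟩
    refine ht ⟨h⁻¹ * n, ?_⟩
    rw [left_mul]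
    have e : ((n, 1) : O.Grp b × O.Grp a) • t = ((h, 1) : O.Grp b × O.Grp a) • t' := e
    rw [e, ← left_mul, inv_mul_cancel]
    exact (one_smul (O.Grp b × O.Grp a) t').symm

theorem stabilizer_mem_nhds (t : O.Tran a b) :
    (MulAction.stabilizer (O.Grp a) (O.mp t).source : Set (O.Grp a)) ∈ 𝓝 (1 : O.Grp a) := by
  obtain ⟨p, hp⟩ := source_nonempty t
  have : Continuous fun g : O.Grp a => g • p := by fun_prop
  have h := this.continuousAt.preimage_mem_nhds (x := 1) ((isOpen_source t).mem_nhds (by rwa [one_smul]))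
  exact Filter.mem_of_superset h fun g hg => mem_stabilizer hp hg

open Classical in
/-- The isomorphism of stabilizers of a transition map, continued by `1`. -/
noncomputable def isoExt (t : O.Tran a b) (g : O.Grp a) : O.Grp b :=
  if hg : g ∈ MulAction.stabilizer (O.Grp a) (O.mp t).source then (O.tr t).iso ⟨g, hg⟩ else 1

theorem isoExt_of_mem {t : O.Tran a b} {g : O.Grp a}
    (hg : g ∈ MulAction.stabilizer (O.Grp a) (O.mp t).source) :
    isoExt t g = (O.tr t).iso ⟨g, hg⟩ := dif_pos hg

theorem isoExt_one (t : O.Tran a b) : isoExt t 1 = 1 := by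
  rw [isoExt_of_mem (one_mem _)]
  have : (⟨1, one_mem _⟩ : MulAction.stabilizer (O.Grp a) (O.tr t).map.source) = 1 := rfl
  rw [this, map_one, OneMemClass.coe_one]

theorem isoExt_smul {t : O.Tran a b} {g : O.Grp a}
    (hg : g ∈ MulAction.stabilizer (O.Grp a) (O.mp t).source) :
    ((isoExt t g, g) : O.Grp b × O.Grp a) • t = t :=
  (O.smul_eq_iff _ g t).2 ⟨hg, (isoExt_of_mem hg).symm⟩

/-- The pair `(λ(g), g)` fixes `t`. Elements near `1` stabilize the open domain, so near `1` the
right action reduces to the left one, which defines the topology. -/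
theorem right_eq_left {t : O.Tran a b} {g : O.Grp a}
    (hg : g ∈ MulAction.stabilizer (O.Grp a) (O.mp t).source) :
    ((1, g) : O.Grp b × O.Grp a) • t = (((isoExt t g)⁻¹, 1) : O.Grp b × O.Grp a) • t := by
  have h1 := isoExt_smul hg
  generalize isoExt t g = k at h1 ⊢
  conv_rhs => rw [← h1]
  rw [smul_smul, Prod.mk_mul_mk, inv_mul_cancel, one_mul]

theorem continuousAt_isoExt (t : O.Tran a b) : ContinuousAt (isoExt t) 1 := by
  have h1 := stabilizer_mem_nhds t
  have : ContinuousOn (isoExt t) (MulAction.stabilizer (O.Grp a) (O.mp t).source) := by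
    rw [continuousOn_iff_continuous_domRestrict]
    have : Set.domRestrict (MulAction.stabilizer (O.Grp a) (O.mp t).source : Set (O.Grp a)) (isoExt t)
        = fun g => ((O.tr t).iso g : O.Grp b) := by
      ext g
      exact isoExt_of_mem g.2
    rw [this]
    exact continuous_subtype_val.comp (O.tr t).iso.continuous
  exact this.continuousAt h1

theorem smul_comm_left (h : O.Grp b) (g : O.Grp a) (t : O.Tran a b) :
    ((1, g) : O.Grp b × O.Grp a) • ((h, 1) : O.Grp b × O.Grp a) • t =
      ((h, 1) : O.Grp b × O.Grp a) • ((1, g) : O.Grp b × O.Grp a) • t := by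
  simp [smul_smul]

/-- The right action of the group is continuous at `1`. -/
theorem exists_nhds_right {t : O.Tran a b} {A : Set (O.Tran a b)} (hA : IsOpen A) (ht : t ∈ A) :
    ∃ A' : Set (O.Tran a b), IsOpen A' ∧ t ∈ A' ∧ ∀ᶠ g in 𝓝 (1 : O.Grp a), ∀ t' ∈ A',
      ((1, g) : O.Grp b × O.Grp a) • t' ∈ A := by
  -- The right translate by `g` of `k • t` is `(k * λ(g)⁻¹) • t`. This is continuous in `(k, g)` at
  -- `(1, 1)`, so a product neighbourhood works, and `A'` is the image of its first factor.
  have h1 : ∀ᶠ p in 𝓝 ((1 : O.Grp b), (1 : O.Grp a)),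
      ((p.1 * (isoExt t p.2)⁻¹, 1) : O.Grp b × O.Grp a) • t ∈ A := by
    have hc : ContinuousAt (fun p : O.Grp b × O.Grp a =>
        ((p.1 * (isoExt t p.2)⁻¹, 1) : O.Grp b × O.Grp a) • t) (1, 1) := by
      refine (continuous_left t).continuousAt.comp
        (f := fun p : O.Grp b × O.Grp a => p.1 * (isoExt t p.2)⁻¹) ?_
      exact continuousAt_fst.mul ((continuousAt_isoExt t).comp
        (f := fun p : O.Grp b × O.Grp a => p.2) (x := (1, 1)) continuousAt_snd).inv
    refine hc.eventually (hA.mem_nhds ?_)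
    change ((1 * (isoExt t 1)⁻¹, 1) : O.Grp b × O.Grp a) • t ∈ A
    rw [isoExt_one, inv_one, one_mul]
    rwa [show ((1, 1) : O.Grp b × O.Grp a) • t = t from one_smul (O.Grp b × O.Grp a) t]
  rw [nhds_prod_eq] at h1
  obtain ⟨pa, ha, pb, hb, h⟩ := Filter.eventually_prod_iff.1 h1
  obtain ⟨N, hN, hNo, h1N⟩ := eventually_nhds_iff.1 ha
  refine ⟨_, isOpen_left_image hNo t, ⟨1, h1N, one_smul (O.Grp b × O.Grp a) t⟩, ?_⟩
  filter_upwards [hb, stabilizer_mem_nhds t] with g hg hgs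
  rintro _ ⟨k, hk, rfl⟩
  change ((1, g) : O.Grp b × O.Grp a) • ((k, 1) : O.Grp b × O.Grp a) • t ∈ A
  rw [smul_comm_left, right_eq_left hgs, ← left_mul]
  exact h (hN k hk) hg

end TranTopology

end Orbispace

/-! ### The action of systems on germs -/

section System

variable {X Y : Type u} [TopologicalSpace X] [TopologicalSpace Y]
variable {O : Orbispace X} {P : Orbispace Y}

namespace SystemOver

variable {Λ : Type u} {src : Λ → O.basic} {tgt : Λ → P.basic} (σ : SystemOver O P src tgt)

/-- The action of a system on germs. -/
def onGerm (α β : Λ) {p : O.Hat (src α)} {q : O.Hat (src β)}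
    (e : (⟨src α, p⟩ : O.Pt) ⟶ ⟨src β, q⟩) :
    (⟨tgt α, σ.f α p⟩ : P.Pt) ⟶ ⟨tgt β, σ.f β q⟩ :=
  ⟨σ.ρ α β e.1, σ.map_mem e.1 p e.2, by
    have := σ.map_eq e.1 p e.2
    rw [Orbispace.Hom.mp_eq e] at this
    exact this⟩

theorem onGerm_comp {α β γ : Λ} {p : O.Hat (src α)} {q : O.Hat (src β)} {r : O.Hat (src γ)}
    (e : (⟨src α, p⟩ : O.Pt) ⟶ ⟨src β, q⟩) (e' : (⟨src β, q⟩ : O.Pt) ⟶ ⟨src γ, r⟩) :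
    σ.onGerm α γ (e ≫ e') = σ.onGerm α β e ≫ σ.onGerm β γ e' := by
  refine Orbispace.Hom.eq_comp ⟨_, _, (σ.map_comp e'.1 e.1 p e.2 ?_).symm⟩
  rw [Orbispace.Hom.mp_eq e]; exact e'.2

/-- Preservation of identities is not an axiom of systems. It follows from compatibility with
compositions, since idempotents of a groupoid are identities. -/
theorem onGerm_id (α : Λ) (p : O.Hat (src α)) :
    σ.onGerm α α (𝟙 (⟨src α, p⟩ : O.Pt)) = 𝟙 _ := by
  apply Orbispace.idem_eq_id
  rw [← onGerm_comp, Category.comp_id]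

theorem onGerm_inv {α β : Λ} {p : O.Hat (src α)} {q : O.Hat (src β)}
    (e : (⟨src α, p⟩ : O.Pt) ⟶ ⟨src β, q⟩) :
    σ.onGerm β α (Groupoid.inv e) = Groupoid.inv (σ.onGerm α β e) := by
  rw [← cancel_epi (σ.onGerm α β e), ← onGerm_comp, Groupoid.comp_inv, Groupoid.comp_inv, onGerm_id]

theorem onGerm_isTriv {α β : Λ} (h : α = β) {p : O.Hat (src α)} {q : O.Hat (src β)}
    {e : (⟨src α, p⟩ : O.Pt) ⟶ ⟨src β, q⟩} (he : Orbispace.IsTriv e) :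
    Orbispace.IsTriv (σ.onGerm α β e) := by
  subst h
  obtain ⟨h, rfl⟩ := he
  obtain rfl : p = q := by
    injection h with _ h
  rw [eqToHom_refl, onGerm_id]
  exact Orbispace.isTriv_id _

theorem ρ_one (α : Λ) : σ.ρ α α (O.one (src α)) = P.one (tgt α) := by
  obtain ⟨p, -⟩ := Orbispace.source_nonempty (O.one (src α))
  exact congrArg Orbispace.Germ.val (σ.onGerm_id α p)

theorem ρ_inv {α β : Λ} (t : O.Tran (src α) (src β)) :
    σ.ρ β α (Orbispace.inv t) = Orbispace.inv (σ.ρ α β t) := by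
  obtain ⟨p, hp⟩ := Orbispace.source_nonempty t
  exact congrArg Orbispace.Germ.val (σ.onGerm_inv (Orbispace.germ t p hp))

end SystemOver

end System

/-! ### The circle and its covers by arcs -/

theorem unitAddCircle_coe_eq_iff {u v : ℝ} : (u : UnitAddCircle) = v ↔ ∃ z : ℤ, u = v + z := by
  rw [← sub_eq_zero, ← AddCircle.coe_sub, AddCircle.coe_eq_zero_iff]
  constructor
  · rintro ⟨z, hz⟩
    exact ⟨z, by simp at hz; linarith⟩
  · rintro ⟨z, hz⟩
    exact ⟨z, by simp; linarith⟩

theorem unitAddCircle_coe_add_int (u : ℝ) (z : ℤ) : ((u + z : ℝ) : UnitAddCircle) = u :=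
  unitAddCircle_coe_eq_iff.2 ⟨z, rfl⟩

theorem exists_coe_unitAddCircle (t : UnitAddCircle) :
    ∃ u : ℝ, (u : UnitAddCircle) = t ∧ 0 ≤ u ∧ u < 1 := by
  obtain ⟨v, rfl⟩ := QuotientAddGroup.mk_surjective t
  refine ⟨Int.fract v, ?_, Int.fract_nonneg v, Int.fract_lt_one v⟩
  exact unitAddCircle_coe_eq_iff.2 ⟨-⌊v⌋, by rw [Int.fract]; push_cast; ring⟩

/-- Locally constant functions on open sets, in terms of filters. -/
theorem isLocallyConstant_subtype_iff {T α : Type*} [TopologicalSpace T] {S : Set T}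
    {F : ∀ t, t ∈ S → α} :
    IsLocallyConstant (fun t : S => F t t.2) ↔
      ∀ t₀ (h₀ : t₀ ∈ S), ∀ᶠ t in 𝓝 t₀, ∀ h : t ∈ S, F t h = F t₀ h₀ := by
  rw [IsLocallyConstant.iff_eventually_eq]
  constructor
  · intro h t₀ h₀
    have h1 := h ⟨t₀, h₀⟩
    rw [nhds_subtype_eq_comap, Filter.eventually_comap] at h1
    filter_upwards [h1] with t ht hS
    exact ht ⟨t, hS⟩ rfl
  · rintro h ⟨t₀, h₀⟩
    rw [nhds_subtype_eq_comap, Filter.eventually_comap]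
    filter_upwards [h t₀ h₀] with t ht
    rintro ⟨t', ht'⟩ rfl
    exact ht ht'

theorem Fin.ne_add_one {n : ℕ} (i : Fin (n + 3)) : i + 1 ≠ i := by
  intro h
  have := congrArg Fin.val h
  have hi := i.2
  rw [Fin.val_add, show ((1 : Fin (n + 3)) : ℕ) = 1 from rfl] at this
  by_cases hn : (i : ℕ) + 1 < n + 3
  · rw [Nat.mod_eq_of_lt hn] at this; omega
  · have e : (i : ℕ) + 1 = n + 3 := by omega
    rw [e, Nat.mod_self] at this; omega

theorem Fin.ne_add_two {n : ℕ} (i : Fin (n + 3)) : i + 1 + 1 ≠ i := by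
  intro h
  have := congrArg Fin.val h
  have hi := i.2
  rw [Fin.val_add, Fin.val_add, show ((1 : Fin (n + 3)) : ℕ) = 1 from rfl,
    Nat.mod_add_mod] at this
  by_cases hn : (i : ℕ) + 1 + 1 < n + 3
  · rw [Nat.mod_eq_of_lt hn] at this; omega
  · obtain e | e : (i : ℕ) + 1 + 1 = n + 3 ∨ (i : ℕ) + 1 + 1 = n + 3 + 1 := by omega
    · rw [e, Nat.mod_self] at this; omega
    · rw [e, Nat.add_mod_left, Nat.mod_eq_of_lt (by omega)] at this; omega

namespace ArcCover

variable (c : ArcCover)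

/-- The axioms give `a (j + 1) < b j ≤ a (j + 2)`, which misses the first index. Periodicity
supplies it. -/
theorem a_lt_succ (i : ℕ) : c.a i < c.a (i + 1) := by
  have h : ∀ j, c.a (j + 1) < c.a (j + 2) := fun j => (c.overlap j).trans_le (c.disjoint j)
  have h1 := h (i + (c.n + 2))
  have e1 : i + (c.n + 2) + 1 = i + (c.n + 3) := by ring
  have e2 : i + (c.n + 2) + 2 = i + 1 + (c.n + 3) := by ring
  rw [e1, e2, c.a_add, c.a_add] at h1
  linarith

theorem a_strictMono : StrictMono c.a := strictMono_nat_of_lt_succ c.a_lt_succ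

theorem b_strictMono : StrictMono c.b :=
  strictMono_nat_of_lt_succ fun i => (c.disjoint i).trans_lt (c.overlap (i + 1))

theorem a_lt_b (i : ℕ) : c.a i < c.b i := (c.a_lt_succ i).trans (c.overlap i)

theorem a_add_mul (i z : ℕ) : c.a (i + z * (c.n + 3)) = c.a i + z := by
  induction z with
  | zero => simp
  | succ z ih =>
    have : i + (z + 1) * (c.n + 3) = i + z * (c.n + 3) + (c.n + 3) := by ring
    rw [this, c.a_add, ih]; push_cast; ring

theorem b_add_mul (i z : ℕ) : c.b (i + z * (c.n + 3)) = c.b i + z := by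
  induction z with
  | zero => simp
  | succ z ih =>
    have : i + (z + 1) * (c.n + 3) = i + z * (c.n + 3) + (c.n + 3) := by ring
    rw [this, c.b_add, ih]; push_cast; ring

theorem b_lt_add_one (i : ℕ) : c.b i < c.a i + 1 := by
  have h1 := c.disjoint i
  have h2 : c.a (i + 2) < c.a (i + (c.n + 3)) := c.a_strictMono (by omega)
  rw [c.a_add] at h2
  linarith

theorem neg_one_lt_a_zero : -1 < c.a 0 := by
  have := c.b_lt_add_one 0
  have := c.b_zero
  linarith

theorem b_lt_two {i : ℕ} (hi : i < c.n + 3) : c.b i < 2 := by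
  have h1 := c.disjoint i
  have h2 : c.a (i + 2) ≤ c.a (1 + (c.n + 3)) := c.a_strictMono.monotone (by omega)
  have h3 : c.a 1 < c.a (0 + (c.n + 3)) := c.a_strictMono (by omega)
  have h4 := c.a_zero
  rw [c.a_add] at h2 h3
  linarith

/-- The arc of the circle covered by the `I`-th interval. -/
def index (I : ℕ) : Fin (c.n + 3) := ⟨I % (c.n + 3), Nat.mod_lt _ (by omega)⟩

theorem index_val (i : Fin (c.n + 3)) : c.index i = i := Fin.ext (Nat.mod_eq_of_lt i.2)

theorem index_add (I z : ℕ) : c.index (I + z * (c.n + 3)) = c.index I :=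
  Fin.ext (Nat.add_mul_mod_self_right _ _ _)

theorem index_succ (I : ℕ) : c.index (I + 1) = c.index I + 1 := by
  apply Fin.ext
  simp [index, Fin.val_add]

theorem mem_arc_index {I : ℕ} {u : ℝ} (h : c.a I < u) (h' : u < c.b I) :
    (u : UnitAddCircle) ∈ c.arc (c.index I) := by
  have e : I = I % (c.n + 3) + I / (c.n + 3) * (c.n + 3) := (Nat.mod_add_div' I (c.n + 3)).symm
  rw [e, c.a_add_mul] at h
  rw [e, c.b_add_mul] at h'
  refine ⟨u - (I / (c.n + 3) : ℕ), ⟨?_, ?_⟩, ?_⟩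
  · simp only [index]; linarith
  · simp only [index]; linarith
  · exact unitAddCircle_coe_eq_iff.2 ⟨-((I / (c.n + 3) : ℕ) : ℤ), by rw [Int.cast_neg, Int.cast_natCast]; ring⟩

/-- Intervals are numbered by natural numbers, so they can only be shifted to the right. Since `b i
< 2` for `i < n + 3`, a lift `u ≥ 1` never requires a shift to the left. -/
theorem exists_lift_of_mem {i : Fin (c.n + 3)} {u : ℝ} (hu : 1 ≤ u)
    (h : (u : UnitAddCircle) ∈ c.arc i) : ∃ I, c.index I = i ∧ c.a I < u ∧ u < c.b I := by
  obtain ⟨v, ⟨h1, h2⟩, e⟩ := h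
  obtain ⟨z, hz⟩ := unitAddCircle_coe_eq_iff.1 e
  have h3 := c.b_lt_two i.2
  have h4 : (z : ℝ) < 1 := by linarith
  have h5 : z ≤ 0 := by
    have : z < 1 := by exact_mod_cast h4
    omega
  obtain ⟨k, rfl⟩ : ∃ k : ℕ, z = -k := ⟨(-z).toNat, by omega⟩
  push_cast at hz
  refine ⟨i + k * (c.n + 3), ?_, ?_, ?_⟩
  · rw [index_add, index_val]
  · rw [a_add_mul]; linarith
  · rw [b_add_mul]; linarith

theorem exists_lift (t : UnitAddCircle) : ∃ u : ℝ, 1 ≤ u ∧ u < 2 ∧ (u : UnitAddCircle) = t := by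
  obtain ⟨u, rfl, h0, h1⟩ := exists_coe_unitAddCircle t
  exact ⟨u + 1, by linarith, by linarith, by simp⟩

theorem lift_adj {I J : ℕ} {u : ℝ} (hIb : u < c.b I) (hJa : c.a J < u) (h : I < J) :
    J = I + 1 := by
  have h1 := hJa.trans (hIb.trans_le (c.disjoint I))
  have := c.a_strictMono.lt_iff_lt.1 h1
  omega

theorem exists_mem_arc (t : UnitAddCircle) : ∃ i, t ∈ c.arc i := by
  obtain ⟨u, hu, hu2, rfl⟩ := exists_lift t
  have hex : ∃ I, u ≤ c.a (I + 1) := by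
    -- After three full turns, `a 3 + 3 ≥ a 0 + 3 > 2 > u`.
    refine ⟨2 + 3 * (c.n + 3), ?_⟩
    have h1 := c.neg_one_lt_a_zero
    have h2 : c.a 0 ≤ c.a 3 := c.a_strictMono.monotone (by omega)
    have : 2 + 3 * (c.n + 3) + 1 = 3 + 3 * (c.n + 3) := by ring
    rw [this, c.a_add_mul]
    push_cast
    linarith
  classical
  -- For the first `I` with `u ≤ a (I + 1)`, minimality gives `a I < u` (if `I = 0`, use `a 0 < 0`),
  -- and the overlap gives `u < b I`.
  refine ⟨c.index (Nat.find hex), c.mem_arc_index ?_ ?_⟩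
  · rcases Nat.eq_zero_or_pos (Nat.find hex) with h | h
    · rw [h]; have := c.a_zero; linarith
    · have := Nat.find_min hex (Nat.sub_lt h one_pos)
      rw [not_le, show Nat.find hex - 1 + 1 = Nat.find hex by omega] at this
      exact this
  · exact (Nat.find_spec hex).trans_lt (c.overlap _)

theorem isOpen_arc (i : Fin (c.n + 3)) : IsOpen (c.arc i) :=
  QuotientAddGroup.isOpenMap_coe _ isOpen_Ioo

theorem continuous_coe_circle : Continuous fun u : ℝ => (u : UnitAddCircle) :=
  AddCircle.continuous_mk' 1

theorem isPreconnected_arc (i : Fin (c.n + 3)) : IsPreconnected (c.arc i) :=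
  isPreconnected_Ioo.image _ continuous_coe_circle.continuousOn

theorem arc_nonempty (i : Fin (c.n + 3)) : (c.arc i).Nonempty :=
  (nonempty_Ioo.2 (c.a_lt_b i)).image _

theorem adj {t : UnitAddCircle} {i j : Fin (c.n + 3)} (hi : t ∈ c.arc i) (hj : t ∈ c.arc j) :
    i = j ∨ j = i + 1 ∨ i = j + 1 := by
  obtain ⟨u, hu, hu2, rfl⟩ := exists_lift t
  obtain ⟨I, rfl, h1, h2⟩ := c.exists_lift_of_mem hu hi
  obtain ⟨J, rfl, h3, h4⟩ := c.exists_lift_of_mem hu hj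
  rcases lt_trichotomy I J with h | h | h
  · rw [c.lift_adj h2 h3 h, index_succ]; simp
  · simp [h]
  · rw [c.lift_adj h4 h1 h, index_succ]; simp

/-- The numbers of the intervals containing one lift of `t` differ pairwise by at most one, so three
of them cannot be distinct. -/
theorem adj₃ {t : UnitAddCircle} {i j k : Fin (c.n + 3)} (hi : t ∈ c.arc i) (hj : t ∈ c.arc j)
    (hk : t ∈ c.arc k) : i = j ∨ j = k ∨ i = k := by
  obtain ⟨u, hu, hu2, rfl⟩ := exists_lift t
  obtain ⟨I, rfl, h1, h2⟩ := c.exists_lift_of_mem hu hi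
  obtain ⟨J, rfl, h3, h4⟩ := c.exists_lift_of_mem hu hj
  obtain ⟨K, rfl, h5, h6⟩ := c.exists_lift_of_mem hu hk
  have key : ∀ {I J}, u < c.b I → c.a I < u → u < c.b J → c.a J < u → I = J ∨ J = I + 1 ∨ I = J + 1 := by
    intro I J h1 h2 h3 h4
    rcases lt_trichotomy I J with h | h | h
    · exact Or.inr (Or.inl (c.lift_adj h1 h4 h))
    · exact Or.inl h
    · exact Or.inr (Or.inr (c.lift_adj h3 h2 h))
  have k1 := key h2 h1 h4 h3
  have k2 := key h4 h3 h6 h5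
  have k3 := key h2 h1 h6 h5
  have : I = J ∨ J = K ∨ I = K := by omega
  rcases this with rfl | rfl | rfl <;> simp

/-- With at least three arcs, consecutive ones meet at one end only. Their intersection is therefore
connected, and locally constant transition maps are constant on it. -/
theorem arc_inter_succ (i : Fin (c.n + 3)) :
    c.arc i ∩ c.arc (i + 1) = (fun t : ℝ => (t : UnitAddCircle)) '' Ioo (c.a (i + 1 : ℕ)) (c.b i) := by
  have hi : c.index (i + 1 : ℕ) = i + 1 := by rw [index_succ, index_val]
  ext t
  constructor
  · rintro ⟨h, h'⟩
    obtain ⟨u, hu, hu2, rfl⟩ := exists_lift t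
    obtain ⟨I, hI, h1, h2⟩ := c.exists_lift_of_mem hu h
    obtain ⟨J, hJ, h3, h4⟩ := c.exists_lift_of_mem hu h'
    have hJI : J = I + 1 := by
      rcases lt_trichotomy I J with h | h | h
      · exact c.lift_adj h2 h3 h
      · subst h
        exact absurd (hJ.symm.trans hI) (Fin.ne_add_one i)
      · have := c.lift_adj h4 h1 h
        subst this
        rw [index_succ, hJ] at hI
        exact absurd hI (Fin.ne_add_two i)
    subst hJI
    have e : I = i + I / (c.n + 3) * (c.n + 3) := by
      have := congrArg Fin.val hI
      simp only [index] at this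
      rw [← this]
      exact (Nat.mod_add_div' I (c.n + 3)).symm
    refine ⟨u - (I / (c.n + 3) : ℕ), ⟨?_, ?_⟩, ?_⟩
    · rw [e, add_right_comm, a_add_mul] at h3; linarith
    · rw [e, b_add_mul] at h2; linarith
    · exact unitAddCircle_coe_eq_iff.2 ⟨-((I / (c.n + 3) : ℕ) : ℤ), by rw [Int.cast_neg, Int.cast_natCast]; ring⟩
  · rintro ⟨u, ⟨h1, h2⟩, rfl⟩
    refine ⟨⟨u, ⟨(c.a_lt_succ i).trans h1, h2⟩, rfl⟩, ?_⟩
    rw [← hi]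
    exact c.mem_arc_index h1 (h2.trans (c.b_strictMono (Nat.lt_succ_self _)))

theorem isPreconnected_arc_inter_succ (i : Fin (c.n + 3)) :
    IsPreconnected (c.arc i ∩ c.arc (i + 1)) := by
  rw [arc_inter_succ]
  exact isPreconnected_Ioo.image _ continuous_coe_circle.continuousOn

theorem arc_inter_succ_nonempty (i : Fin (c.n + 3)) : (c.arc i ∩ c.arc (i + 1)).Nonempty := by
  rw [arc_inter_succ]
  exact (nonempty_Ioo.2 (c.overlap i)).image _

end ArcCover

/-! ### Loops as cocycles of germs -/

section Loops

variable {X : Type u} [TopologicalSpace X] {O : Orbispace X} {x : O.BasePoint}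

open Orbispace

namespace LoopOver

variable {c : ArcCover} {U : Fin (c.n + 3) → O.basic} {σ : LoopOver O x c U}

theorem Link.eq_cases {i j : Fin (c.n + 3)} {r : O.Tran (U i) (U j)} (h : σ.Link i j r) :
    (i = j ∧ HEq r (O.one (U i))) ∨ (j = i + 1 ∧ HEq r (σ.ρ i)) ∨
      (i = j + 1 ∧ HEq r (inv (σ.ρ j))) := by
  induction h with
  | refl i => exact Or.inl ⟨rfl, HEq.rfl⟩
  | step i => exact Or.inr (Or.inl ⟨rfl, HEq.rfl⟩)
  | back i r hr => exact Or.inr (Or.inr ⟨rfl, heq_of_eq (hr.unique (isInv_inv _))⟩)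

/-- With at least three arcs the cases `j = i`, `j = i + 1` and `i = j + 1` exclude one another. -/
theorem Link.unique {i j : Fin (c.n + 3)} {r r' : O.Tran (U i) (U j)} (h : σ.Link i j r)
    (h' : σ.Link i j r') : r = r' := by
  have key : ∀ i j : Fin (c.n + 3), j = i + 1 → i ≠ j ∧ i ≠ j + 1 := by
    rintro i j rfl
    exact ⟨(Fin.ne_add_one i).symm, (Fin.ne_add_two i).symm⟩
  rcases h.eq_cases with ⟨e, h1⟩ | ⟨e, h1⟩ | ⟨e, h1⟩ <;>
  rcases h'.eq_cases with ⟨e', h2⟩ | ⟨e', h2⟩ | ⟨e', h2⟩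
  · exact eq_of_heq (h1.trans h2.symm)
  · exact absurd e (key _ _ e').1
  · exact absurd e.symm (key _ _ e').1
  · exact absurd e' (key _ _ e).1
  · exact eq_of_heq (h1.trans h2.symm)
  · exact absurd e' (key _ _ e).2
  · exact absurd e'.symm (key _ _ e).1
  · exact absurd e (key _ _ e').2
  · exact eq_of_heq (h1.trans h2.symm)

/-- The point of the loop at the time `t`, in the chart number `i`. -/
abbrev pt (σ : LoopOver O x c U) (i : Fin (c.n + 3)) (t : UnitAddCircle) (h : t ∈ c.arc i) : O.Pt :=
  ⟨U i, σ.f i ⟨t, h⟩⟩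

theorem exists_link (σ : LoopOver O x c U) (i j : Fin (c.n + 3)) (t : UnitAddCircle)
    (hi : t ∈ c.arc i) (hj : t ∈ c.arc j) : ∃ e : σ.pt i t hi ⟶ σ.pt j t hj, σ.Link i j e.1 := by
  rcases c.adj hi hj with rfl | rfl | rfl
  · exact ⟨𝟙 _, Link.refl i⟩
  · obtain ⟨h1, h2⟩ := σ.compat i t hi hj
    exact ⟨⟨σ.ρ i, h1, h2⟩, Link.step i⟩
  · obtain ⟨h1, h2⟩ := σ.compat j t hj hi
    exact ⟨Groupoid.inv (⟨σ.ρ j, h1, h2⟩ : σ.pt j t hj ⟶ σ.pt (j + 1) t hi), Link.back j _ (isInv_inv _)⟩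

/-- The germ of the transition map between two charts of a loop, at the time `t`. -/
noncomputable def r (σ : LoopOver O x c U) (i j : Fin (c.n + 3)) (t : UnitAddCircle)
    (hi : t ∈ c.arc i) (hj : t ∈ c.arc j) : σ.pt i t hi ⟶ σ.pt j t hj :=
  (σ.exists_link i j t hi hj).choose

theorem r_link (i j : Fin (c.n + 3)) (t : UnitAddCircle)
    (hi : t ∈ c.arc i) (hj : t ∈ c.arc j) : σ.Link i j (σ.r i j t hi hj).1 :=
  (σ.exists_link i j t hi hj).choose_spec

theorem eq_r {i j : Fin (c.n + 3)} {t : UnitAddCircle} {hi : t ∈ c.arc i} {hj : t ∈ c.arc j}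
    {e : σ.pt i t hi ⟶ σ.pt j t hj} (h : σ.Link i j e.1) : e = σ.r i j t hi hj :=
  Hom.ext (h.unique (r_link i j t hi hj))

theorem r_self (i : Fin (c.n + 3)) (t : UnitAddCircle) (hi : t ∈ c.arc i) : σ.r i i t hi hi = 𝟙 _ :=
  (eq_r (e := 𝟙 (σ.pt i t hi)) (Link.refl i)).symm

theorem r_succ (i : Fin (c.n + 3)) (t : UnitAddCircle) (hi : t ∈ c.arc i) (hj : t ∈ c.arc (i + 1)) :
    (σ.r i (i + 1) t hi hj).1 = σ.ρ i :=
  (r_link i (i + 1) t hi hj).unique (Link.step i)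

theorem Link.inv {i j : Fin (c.n + 3)} {r : O.Tran (U i) (U j)} (h : σ.Link i j r) :
    σ.Link j i (Orbispace.inv r) := by
  induction h with
  | refl i =>
    have : Orbispace.inv (O.one (U i)) = O.one (U i) :=
      (isInv_inv _).unique fun x _ => isComp_one_left _ (mem_source_one x)
    rw [this]; exact Link.refl i
  | step i => exact Link.back i _ (isInv_inv _)
  | back i r hr =>
    obtain rfl := hr.unique (isInv_inv _)
    have : Orbispace.inv (Orbispace.inv (σ.ρ i)) = σ.ρ i := by
      obtain ⟨p, hp⟩ := source_nonempty (σ.ρ i)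
      exact congrArg Germ.val (show Groupoid.inv (Groupoid.inv (germ _ p hp)) = germ _ p hp by simp)
    rw [this]; exact Link.step i

theorem r_inv (i j : Fin (c.n + 3)) (t : UnitAddCircle) (hi : t ∈ c.arc i) (hj : t ∈ c.arc j) :
    Groupoid.inv (σ.r i j t hi hj) = σ.r j i t hj hi :=
  eq_r (e := Groupoid.inv (σ.r i j t hi hj)) (r_link i j t hi hj).inv

/-- By `adj₃` two of the three indices coincide, so the cocycle condition reduces to identities and
inverses. -/
theorem r_comp (i j k : Fin (c.n + 3)) (t : UnitAddCircle) (hi : t ∈ c.arc i) (hj : t ∈ c.arc j)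
    (hk : t ∈ c.arc k) : σ.r i j t hi hj ≫ σ.r j k t hj hk = σ.r i k t hi hk := by
  rcases c.adj₃ hi hj hk with rfl | rfl | rfl
  · rw [r_self, Category.id_comp]
  · rw [r_self, Category.comp_id]
  · rw [← r_inv, Groupoid.inv_comp, r_self]

theorem r_val_const (i j : Fin (c.n + 3)) (t t' : UnitAddCircle) (hi : t ∈ c.arc i) (hj : t ∈ c.arc j)
    (hi' : t' ∈ c.arc i) (hj' : t' ∈ c.arc j) : (σ.r i j t hi hj).1 = (σ.r i j t' hi' hj').1 :=
  (r_link i j t hi hj).unique (r_link i j t' hi' hj')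

theorem pt_zero (σ : LoopOver O x c U) : σ.pt 0 0 c.zero_mem = ⟨x.1, x.2⟩ := by
  have := σ.basePt
  rw [Sigma.ext_iff] at this
  obtain ⟨a, p⟩ := x
  obtain ⟨h1, h2⟩ := this
  change U 0 = a at h1
  subst h1
  exact congrArg (Pt.mk _) (eq_of_heq h2)

end LoopOver

/-- An equivalence of loops over arbitrary covers: a family of germs which identifies the
cocycles. -/
structure LoopEqv {c c' : ArcCover} {U : Fin (c.n + 3) → O.basic} {U' : Fin (c'.n + 3) → O.basic}
    (σ : LoopOver O x c U) (σ' : LoopOver O x c' U') where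
  m : ∀ (t : UnitAddCircle) (i : Fin (c.n + 3)) (k : Fin (c'.n + 3)) (hi : t ∈ c.arc i)
    (hk : t ∈ c'.arc k), σ.pt i t hi ⟶ σ'.pt k t hk
  nat : ∀ t i j k l hi hj hk hl,
    σ.r i j t hi hj ≫ m t j l hj hl = m t i k hi hk ≫ σ'.r k l t hk hl
  lc : ∀ i k t₀ hi₀ hk₀, ∀ᶠ t in 𝓝 t₀, ∀ hi hk,
    ((m t i k hi hk).1 : O.Tran (U i) (U' k)) = (m t₀ i k hi₀ hk₀).1
  base : IsTriv (m 0 0 0 c.zero_mem c'.zero_mem)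

namespace LoopEqv

variable {c c' c'' : ArcCover} {U : Fin (c.n + 3) → O.basic} {U' : Fin (c'.n + 3) → O.basic}
  {U'' : Fin (c''.n + 3) → O.basic} {σ : LoopOver O x c U} {σ' : LoopOver O x c' U'}
  {σ'' : LoopOver O x c'' U''}

theorem m_left (E : LoopEqv σ σ') (t i j k hi hj hk) :
    σ.r i j t hi hj ≫ E.m t j k hj hk = E.m t i k hi hk := by
  rw [E.nat t i j k k hi hj hk hk, LoopOver.r_self, Category.comp_id]

theorem m_right (E : LoopEqv σ σ') (t i k l hi hk hl) :
    E.m t i k hi hk ≫ σ'.r k l t hk hl = E.m t i l hi hl := by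
  rw [← E.nat t i i k l hi hi hk hl, LoopOver.r_self, Category.id_comp]

theorem m_const (E : LoopEqv σ σ') {C : Set UnitAddCircle} (hC : IsPreconnected C) {i k}
    (hi : ∀ t ∈ C, t ∈ c.arc i) (hk : ∀ t ∈ C, t ∈ c'.arc k) {t t'} (ht : t ∈ C) (ht' : t' ∈ C) :
    ((E.m t i k (hi t ht) (hk t ht)).1 : O.Tran (U i) (U' k)) =
      (E.m t' i k (hi t' ht') (hk t' ht')).1 := by
  have : PreconnectedSpace C := isPreconnected_iff_preconnectedSpace.1 hC
  have h : IsLocallyConstant (Y := O.Tran (U i) (U' k)) fun s : C => ((E.m s i k (hi s s.2) (hk s s.2)).1 : O.Tran (U i) (U' k)) := by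
    rw [IsLocallyConstant.iff_eventually_eq]
    rintro ⟨t₀, h₀⟩
    rw [nhds_subtype_eq_comap, Filter.eventually_comap]
    filter_upwards [E.lc i k t₀ (hi t₀ h₀) (hk t₀ h₀)] with s hs
    rintro ⟨s', hs'⟩ rfl
    exact hs _ _
  exact h.apply_eq_of_preconnectedSpace ⟨t, ht⟩ ⟨t', ht'⟩

/-- Every loop is equivalent to itself. -/
noncomputable def refl (σ : LoopOver O x c U) : LoopEqv σ σ where
  m t i k hi hk := σ.r i k t hi hk
  nat t i j k l hi hj hk hl := by rw [LoopOver.r_comp, LoopOver.r_comp]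
  lc i k t₀ hi₀ hk₀ := Filter.Eventually.of_forall fun t hi hk => LoopOver.r_val_const ..
  base := by rw [LoopOver.r_self]; exact isTriv_id _

/-- The inverse equivalence. -/
noncomputable def symm (E : LoopEqv σ σ') : LoopEqv σ' σ where
  m t i k hi hk := Groupoid.inv (E.m t k i hk hi)
  nat t i j k l hi hj hk hl := by
    rw [← cancel_epi (E.m t k i hk hi), ← Category.assoc, E.m_right,
      ← Category.assoc, Groupoid.comp_inv, Category.id_comp, ← cancel_mono (E.m t l j hl hj),
      Category.assoc, Groupoid.inv_comp, Category.comp_id, E.m_left]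
  lc i k t₀ hi₀ hk₀ := by
    filter_upwards [E.lc k i t₀ hk₀ hi₀] with t h hi hk
    exact congrArg Orbispace.inv (h hk hi)
  base := E.base.inv

/-- The composite does not depend on the intermediate arc, so an arbitrary choice of one at each
time is harmless. -/
theorem trans_aux (E : LoopEqv σ σ') (E' : LoopEqv σ' σ'') (t i k k' l hi hk hk' hl) :
    E.m t i k hi hk ≫ E'.m t k l hk hl = E.m t i k' hi hk' ≫ E'.m t k' l hk' hl := by
  rw [← E.m_right t i k k' hi hk hk', Category.assoc, E'.m_left]

/-- The composition of equivalences. -/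
noncomputable def trans (E : LoopEqv σ σ') (E' : LoopEqv σ' σ'') : LoopEqv σ σ'' where
  m t i l hi hl := E.m t i (c'.exists_mem_arc t).choose hi (c'.exists_mem_arc t).choose_spec ≫
    E'.m t (c'.exists_mem_arc t).choose l (c'.exists_mem_arc t).choose_spec hl
  nat t i j k l hi hj hk hl := by
    rw [← Category.assoc, E.m_left, Category.assoc, E'.m_right]
  lc i l t₀ hi₀ hl₀ := by
    -- The chosen intermediate arc may jump with `t`. It is frozen at `t₀`, and `trans_aux` compares
    -- it with the actual choice.
    set k := (c'.exists_mem_arc t₀).choose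
    have hk₀ : t₀ ∈ c'.arc k := (c'.exists_mem_arc t₀).choose_spec
    set S := c.arc i ∩ c'.arc k ∩ c''.arc l
    have h1 : IsLocallyConstant (Y := O.Tran (U i) (U' k)) fun t : S => ((E.m t i k t.2.1.1 t.2.1.2).1 : O.Tran (U i) (U' k)) := by
      refine (isLocallyConstant_subtype_iff (S := S) (α := O.Tran (U i) (U' k)) (F := fun t h => ((E.m t i k h.1.1 h.1.2).1 : O.Tran (U i) (U' k)))).2 ?_
      intro t h
      filter_upwards [E.lc i k t h.1.1 h.1.2] with s hs hs'
      exact hs _ _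
    have h2 : IsLocallyConstant (Y := O.Tran (U' k) (U'' l)) fun t : S => ((E'.m t k l t.2.1.2 t.2.2).1 : O.Tran (U' k) (U'' l)) := by
      refine (isLocallyConstant_subtype_iff (S := S) (α := O.Tran (U' k) (U'' l)) (F := fun t h => ((E'.m t k l h.1.2 h.2).1 : O.Tran (U' k) (U'' l)))).2 ?_
      intro t h
      filter_upwards [E'.lc k l t h.1.2 h.2] with s hs hs'
      exact hs _ _
    have h3 := isLocallyConstant_comp (v := fun t : S => σ.f i ⟨t, t.2.1.1⟩)
      (R := fun t : S =>
        ((E.m t i k t.2.1.1 t.2.1.2 ≫ E'.m t k l t.2.1.2 t.2.2).1 : O.Tran (U i) (U'' l)))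
      (by fun_prop) h1 h2 fun t => Hom.isComp (E.m t i k t.2.1.1 t.2.1.2) _
    have h4 := (isLocallyConstant_subtype_iff (α := O.Tran (U i) (U'' l))
      (S := S) (F := fun t h =>
        ((E.m t i k h.1.1 h.1.2 ≫ E'.m t k l h.1.2 h.2).1 : O.Tran (U i) (U'' l)))).1 h3 t₀
      ⟨⟨hi₀, hk₀⟩, hl₀⟩
    filter_upwards [h4, (c'.isOpen_arc k).mem_nhds hk₀] with t ht hk hi hl
    rw [← ht ⟨⟨hi, hk⟩, hl⟩, trans_aux E E' t i _ k l hi _ hk hl]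
  base := by
    rw [trans_aux E E' 0 0 _ 0 0 c.zero_mem _ c'.zero_mem c''.zero_mem]
    exact E.base.comp E'.base

end LoopEqv

end Loops

/-! ### Gluing and re-charting of loops -/

section Loops

variable {X : Type u} [TopologicalSpace X] {O : Orbispace X} {x : O.BasePoint}

open Orbispace

/-- Extending a piece of a loop by a constant allows continuity to be tested with neighbourhoods in
the whole circle. -/
theorem exists_extension_continuousAt {T Z : Type*} [TopologicalSpace T] [TopologicalSpace Z]
    {S : Set T} (hS : IsOpen S) (hne : S.Nonempty) (f : C(S, Z)) :
    ∃ G : T → Z, (∀ t (h : t ∈ S), G t = f ⟨t, h⟩) ∧ ∀ t ∈ S, ContinuousAt G t := by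
  classical
  obtain ⟨s, hs⟩ := hne
  refine ⟨fun t => if h : t ∈ S then f ⟨t, h⟩ else f ⟨s, hs⟩, fun t h => dif_pos h, fun t h => ?_⟩
  rw [← hS.isOpenEmbedding_subtypeVal.continuousAt_iff (x := ⟨t, h⟩)]
  refine f.continuous.continuousAt.congr (Filter.Eventually.of_forall fun t => ?_)
  simp

/-- From `j ∘ i = t` one gets `j = t ∘ i⁻¹`. Together with uniqueness of compositions, this
determines the outer factor from the other two maps. -/
theorem Orbispace.IsComp.symm_right {a b c : O.basic} {j : O.Tran b c} {i : O.Tran a b} {z : O.Hat a}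
    {t : O.Tran a c} (h : O.IsComp j i z t) : O.IsComp t (inv i) (O.mp i z) j := by
  let e : (⟨a, z⟩ : O.Pt) ⟶ ⟨b, O.mp i z⟩ := germ i z h.1
  let e' : (⟨b, O.mp i z⟩ : O.Pt) ⟶ ⟨c, O.mp j (O.mp i z)⟩ := germ j _ h.2.1
  let k : (⟨a, z⟩ : O.Pt) ⟶ ⟨c, O.mp j (O.mp i z)⟩ := ⟨t, h.mem, h.map⟩
  have hk : k = e ≫ e' := Hom.eq_comp h
  have : Groupoid.inv e ≫ k = e' := by rw [hk]; simp
  have h2 := Hom.isComp (Groupoid.inv e) k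
  rw [this] at h2
  exact h2

namespace LoopOver

theorem r_isTriv {c : ArcCover} {U : Fin (c.n + 3) → O.basic} {σ : LoopOver O x c U}
    {i j : Fin (c.n + 3)} (h : i = j) (t hi hj) : IsTriv (σ.r i j t hi hj) := by
  subst h
  rw [r_self]; exact isTriv_id _

section Glue

variable {c c' : ArcCover} {U : Fin (c.n + 3) → O.basic} {U' : Fin (c'.n + 3) → O.basic}

/-- Changing the charts and the cover of a loop along a compatible family of transition maps. -/
theorem exists_glue (σ : LoopOver O x c U)
    (m : ∀ (t : UnitAddCircle) i k, t ∈ c.arc i → t ∈ c'.arc k → O.Tran (U i) (U' k))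
    (hr : ∀ t i j k hi hj hk, O.IsComp (m t j k hj hk) (σ.r i j t hi hj).1 (σ.f i ⟨t, hi⟩)
      (m t i k hi hk))
    (lc : ∀ i k t₀ hi₀ hk₀, ∀ᶠ t in 𝓝 t₀, ∀ hi hk, m t i k hi hk = m t₀ i k hi₀ hk₀)
    (base : O.arrow (m 0 0 0 c.zero_mem c'.zero_mem) = O.arrow (O.one x.1)) :
    ∃ (σ' : LoopOver O x c' U') (E : LoopEqv σ σ'),
      ∀ t i k hi hk, (E.m t i k hi hk).1 = m t i k hi hk := by
  classical
  have hm : ∀ t i k hi hk, σ.f i ⟨t, hi⟩ ∈ (O.mp (m t i k hi hk)).source := fun t i k hi hk =>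
    (hr t i i k hi hi hk).mem
  have hv : ∀ t i j k hi hj hk, O.mp (m t i k hi hk) (σ.f i ⟨t, hi⟩) =
      O.mp (m t j k hj hk) (σ.f j ⟨t, hj⟩) := fun t i j k hi hj hk => by
    rw [(hr t i j k hi hj hk).map]
    exact congrArg _ (Hom.mp_eq (σ.r i j t hi hj))
  -- The new loop is the image of the old one under `m`. The old arc may be chosen arbitrarily at
  -- each time, by `hv`; continuity is checked with a fixed arc near each time.
  let g : ∀ k t, t ∈ c'.arc k → O.Hat (U' k) := fun k t hk =>
    O.mp (m t _ k (c.exists_mem_arc t).choose_spec hk) (σ.f _ ⟨t, (c.exists_mem_arc t).choose_spec⟩)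
  have hg : ∀ t i k hi hk, O.mp (m t i k hi hk) (σ.f i ⟨t, hi⟩) = g k t hk := fun t i k hi hk =>
    hv t i _ k hi _ hk
  let e : ∀ t i k (hi : t ∈ c.arc i) (hk : t ∈ c'.arc k), σ.pt i t hi ⟶ (⟨U' k, g k t hk⟩ : O.Pt) :=
    fun t i k hi hk => ⟨m t i k hi hk, hm t i k hi hk, hg t i k hi hk⟩
  have he : ∀ t i j k hi hj hk, σ.r i j t hi hj ≫ e t j k hj hk = e t i k hi hk :=
    fun t i j k hi hj hk => (Hom.eq_comp (hr t i j k hi hj hk)).symm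
  have gcont : ∀ k, Continuous fun s : c'.arc k => g k s s.2 := by
    intro k
    rw [continuous_iff_continuousAt]
    rintro ⟨t₀, h₀⟩
    obtain ⟨i, hi⟩ := c.exists_mem_arc t₀
    obtain ⟨G, hG, hGc⟩ := exists_extension_continuousAt (c.isOpen_arc i) ⟨t₀, hi⟩ (σ.f i)
    have h1 : ContinuousAt (fun s : c'.arc k => O.mp (m t₀ i k hi h₀) (G s)) ⟨t₀, h₀⟩ := by
      refine ContinuousAt.comp (g := O.mp (m t₀ i k hi h₀)) (f := fun s : c'.arc k => G s) ?_ ?_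
      · refine (O.mp (m t₀ i k hi h₀)).continuousAt ?_
        change G t₀ ∈ _
        rw [hG t₀ hi]; exact hm _ _ _ _ _
      · exact (hGc t₀ hi).comp (f := fun s : c'.arc k => (s : UnitAddCircle))
          continuous_subtype_val.continuousAt
    refine h1.congr ?_
    have h2 := ((c.isOpen_arc i).eventually_mem hi).and (lc i k t₀ hi h₀)
    rw [Filter.EventuallyEq, nhds_subtype_eq_comap, Filter.eventually_comap]
    filter_upwards [h2] with t ht
    rintro ⟨t', h'⟩ rfl
    change O.mp (m t₀ i k hi h₀) (G t') = g k t' h'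
    rw [hG t' ht.1, ← hg t' i k ht.1 h', ht.2 ht.1 h']
  -- The new transition germs are forced: they must complete the triangles formed by the re-charting
  -- germs `e`.
  let q : ∀ t k l (hk : t ∈ c'.arc k) (hl : t ∈ c'.arc l),
      (⟨U' k, g k t hk⟩ : O.Pt) ⟶ ⟨U' l, g l t hl⟩ := fun t k l hk hl =>
    Groupoid.inv (e t _ k (c.exists_mem_arc t).choose_spec hk) ≫
      e t _ l (c.exists_mem_arc t).choose_spec hl
  have hq : ∀ t i k l hi hk hl, e t i k hi hk ≫ q t k l hk hl = e t i l hi hl := by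
    intro t i k l hi hk hl
    simp only [q]
    rw [← he t i _ k hi (c.exists_mem_arc t).choose_spec hk, Category.assoc,
      ← Category.assoc (e t _ k _ hk), Groupoid.comp_inv, Category.id_comp, he]
  have q_self : ∀ t k hk, q t k k hk hk = 𝟙 _ := fun t k hk => Groupoid.inv_comp _
  have q_inv : ∀ t k l hk hl, q t l k hl hk = Groupoid.inv (q t k l hk hl) := by
    intro t k l hk hl
    obtain ⟨i, hi⟩ := c.exists_mem_arc t
    rw [← cancel_epi (e t i l hi hl), hq, ← hq t i k l hi hk hl, Category.assoc,
      Groupoid.comp_inv, Category.comp_id]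
  have q_lc : ∀ k l t₀ hk₀ hl₀, ∀ᶠ t in 𝓝 t₀, ∀ hk hl,
      ((q t k l hk hl).1 : O.Tran (U' k) (U' l)) = (q t₀ k l hk₀ hl₀).1 := by
    intro k l t₀ hk₀ hl₀
    obtain ⟨i, hi₀⟩ := c.exists_mem_arc t₀
    set S := c.arc i ∩ c'.arc k ∩ c'.arc l
    have hm1 : ∀ k (p : ∀ t, t ∈ S → t ∈ c'.arc k), IsLocallyConstant (Y := O.Tran (U i) (U' k))
        fun t : S => m t i k t.2.1.1 (p t t.2) := by
      intro k p
      refine (isLocallyConstant_subtype_iff (S := S) (F := fun t h => m t i k h.1.1 (p t h))).2 ?_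
      intro t h
      filter_upwards [lc i k t h.1.1 (p t h)] with s hs hs'
      exact hs _ _
    have h3 := isLocallyConstant_comp (v := fun t : S => g k t t.2.1.2)
      (I := fun t : S => inv (m t i k t.2.1.1 t.2.1.2)) (J := fun t : S => m t i l t.2.1.1 t.2.2)
      (R := fun t : S => ((q t k l t.2.1.2 t.2.2).1 : O.Tran (U' k) (U' l)))
      ((gcont k).comp (f := fun s : S => (⟨s, s.2.1.2⟩ : c'.arc k)) (by fun_prop))
      ((hm1 k fun t h => h.1.2).comp inv) (hm1 l fun t h => h.2) fun t => by
        have h1 := Hom.isComp (Groupoid.inv (e t i k t.2.1.1 t.2.1.2)) (e t i l t.2.1.1 t.2.2)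
        have h2 : Groupoid.inv (e t i k t.2.1.1 t.2.1.2) ≫ e t i l t.2.1.1 t.2.2 =
            q t k l t.2.1.2 t.2.2 := by
          rw [← hq t i k l t.2.1.1 t.2.1.2 t.2.2, ← Category.assoc, Groupoid.inv_comp,
            Category.id_comp]
        rw [h2] at h1
        exact h1
    have h4 := (isLocallyConstant_subtype_iff (α := O.Tran (U' k) (U' l)) (S := S)
      (F := fun t h => ((q t k l h.1.2 h.2).1 : O.Tran (U' k) (U' l)))).1 h3 t₀ ⟨⟨hi₀, hk₀⟩, hl₀⟩
    filter_upwards [h4, (c.isOpen_arc i).mem_nhds hi₀] with t ht hi hk hl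
    exact ht ⟨⟨hi, hk⟩, hl⟩
  -- A loop system needs one transition map on each overlap. Local constancy suffices, since the
  -- overlaps are connected.
  have q_const : ∀ k, ∀ t t', ∀ hk hl hk' hl', ((q t k (k + 1) hk hl).1 : O.Tran (U' k) (U' (k + 1))) =
      (q t' k (k + 1) hk' hl').1 := by
    intro k t t' hk hl hk' hl'
    have : PreconnectedSpace (c'.arc k ∩ c'.arc (k + 1) : Set _) :=
      isPreconnected_iff_preconnectedSpace.1 (c'.isPreconnected_arc_inter_succ k)
    have h1 := (isLocallyConstant_subtype_iff (α := O.Tran (U' k) (U' (k + 1)))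
      (S := c'.arc k ∩ c'.arc (k + 1))
      (F := fun t h => ((q t k (k + 1) h.1 h.2).1 : O.Tran (U' k) (U' (k + 1))))).2 (by
        intro t h
        filter_upwards [q_lc k (k + 1) t h.1 h.2] with s hs hs'
        exact hs _ _)
    exact h1.apply_eq_of_preconnectedSpace ⟨t, hk, hl⟩ ⟨t', hk', hl'⟩
  have e0 : IsTriv (e 0 0 0 c.zero_mem c'.zero_mem) := isTriv_of_arrow_eq base
  let σ' : LoopOver O x c' U' :=
    { f := fun k => ⟨fun s => g k s s.2, gcont k⟩
      ρ := fun k => (q _ k (k + 1) (c'.arc_inter_succ_nonempty k).some_mem.1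
        (c'.arc_inter_succ_nonempty k).some_mem.2).1
      compat := fun k t hk hl => by
        rw [q_const k _ t _ _ hk hl]
        exact ⟨Hom.mem (q t k (k + 1) hk hl), Hom.mp_eq (q t k (k + 1) hk hl)⟩
      basePt := by
        obtain ⟨h, -⟩ := e0
        rw [σ.pt_zero] at h
        injection h with h1 h2
        exact (Sigma.ext h1 h2).symm }
  have hq' : ∀ t k l hk hl, σ'.r k l t hk hl = q t k l hk hl := by
    intro t k l hk hl
    refine (eq_r (σ := σ') ?_).symm
    rcases c'.adj hk hl with rfl | rfl | rfl
    · rw [q_self]; exact Link.refl _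
    · have h : σ'.ρ k = (q t k (k + 1) hk hl).1 := q_const k _ t _ _ hk hl
      rw [← h]; exact Link.step k
    · have h : σ'.ρ l = (q t l (l + 1) hl hk).1 := q_const l _ t _ _ hl hk
      rw [q_inv t l (l + 1) hl hk, Hom.inv_val, ← h]
      exact Link.back l _ (isInv_inv _)
  refine ⟨σ', ⟨e, ?_, lc, e0⟩, fun t i k hi hk => rfl⟩
  intro t i j k l hi hj hk hl
  rw [he, hq' t k l hk hl, hq]

/-- Changing the charts and the cover of a loop along transition maps which do not depend on the
time. -/
theorem exists_glue_const (σ : LoopOver O x c U) (B : Fin (c'.n + 3) → Set (Fin (c.n + 3)))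
    (n : ∀ k l, l ∈ B k → O.Tran (U l) (U' k))
    (hB : ∀ k t, t ∈ c'.arc k → ∃ l, l ∈ B k ∧ t ∈ c.arc l)
    (hs : ∀ k l (h : l ∈ B k) t (hl : t ∈ c.arc l), t ∈ c'.arc k →
      σ.f l ⟨t, hl⟩ ∈ (O.mp (n k l h)).source)
    (hstep : ∀ k l (h : l ∈ B k) (h' : l + 1 ∈ B k) t (hl : t ∈ c.arc l), t ∈ c.arc (l + 1) →
      t ∈ c'.arc k → O.IsComp (n k (l + 1) h') (σ.ρ l) (σ.f l ⟨t, hl⟩) (n k l h))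
    (h0 : 0 ∈ B 0) (base : O.arrow (n 0 0 h0) = O.arrow (O.one x.1)) :
    ∃ (σ' : LoopOver O x c' U') (E : LoopEqv σ σ'),
      ∀ k l (h : l ∈ B k) t hl hk, (E.m t l k hl hk).1 = n k l h := by
  have key : ∀ k l l' (h : l ∈ B k) (h' : l' ∈ B k) t (hl : t ∈ c.arc l) (hl' : t ∈ c.arc l'),
      t ∈ c'.arc k → O.IsComp (n k l' h') (σ.r l l' t hl hl').1 (σ.f l ⟨t, hl⟩) (n k l h) := by
    intro k l l' h h' t hl hl' hk
    rcases c.adj hl hl' with rfl | rfl | rfl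
    · rw [r_self]; exact isComp_one_right _ (hs k l h t hl hk)
    · rw [r_succ]; exact hstep k l h h' t hl hl' hk
    · have h1 := (hstep k l' h' h t hl' hl hk).symm_right
      have h2 : O.mp (σ.ρ l') (σ.f l' ⟨t, hl'⟩) = σ.f (l' + 1) ⟨t, hl⟩ := (σ.compat l' t hl' hl).2
      rw [h2] at h1
      have h3 : (σ.r (l' + 1) l' t hl hl').1 = inv (σ.ρ l') := by
        rw [← r_inv l' (l' + 1) t hl' hl, Hom.inv_val]
        exact congrArg inv (r_succ l' t hl' hl)
      rw [h3]; exact h1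
  choose L hLB hLt using hB
  let ν : ∀ k l (h : l ∈ B k) t (hl : t ∈ c.arc l) (hk : t ∈ c'.arc k), σ.pt l t hl ⟶
      (⟨U' k, O.mp (n k l h) (σ.f l ⟨t, hl⟩)⟩ : O.Pt) :=
    fun k l h t hl hk => ⟨n k l h, hs k l h t hl hk, rfl⟩
  -- Going from `i` to the new chart `k` through any admissible old arc `l` gives the same
  -- transition map, so the choice `L` has no influence.
  have indep : ∀ k l l' (h : l ∈ B k) (h' : l' ∈ B k) t i (hi : t ∈ c.arc i) (hl : t ∈ c.arc l)
      (hl' : t ∈ c.arc l') (hk : t ∈ c'.arc k),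
      ((σ.r i l t hi hl ≫ ν k l h t hl hk).1 : O.Tran (U i) (U' k)) =
        (σ.r i l' t hi hl' ≫ ν k l' h' t hl' hk).1 := by
    intro k l l' h h' t i hi hl hl' hk
    have h1 := key k l l' h h' t hl hl' hk
    have h2 := Hom.isComp (σ.r i l t hi hl) (ν k l h t hl hk)
    have h3 := Hom.isComp (σ.r i l' t hi hl') (ν k l' h' t hl' hk)
    have h4 := Hom.isComp (σ.r i l t hi hl) (σ.r l l' t hl hl')
    rw [r_comp] at h4
    have h1' : O.IsComp (n k l' h') (σ.r l l' t hl hl').1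
        (O.mp (σ.r i l t hi hl).1 (σ.f i ⟨t, hi⟩)) (n k l h) := by
      have := Hom.mp_eq (σ.r i l t hi hl)
      exact this ▸ h1
    exact h2.unique (h4.assoc h1' h3)
  obtain ⟨σ', E, hE⟩ := exists_glue σ (c' := c') (U' := U')
    (fun t i k hi hk => (σ.r i (L k t hk) t hi (hLt k t hk) ≫
      ν k (L k t hk) (hLB k t hk) t (hLt k t hk) hk).1)
    (fun t i j k hi hj hk => by
      have h1 := Hom.isComp (σ.r i j t hi hj) (σ.r j (L k t hk) t hj (hLt k t hk) ≫
        ν k (L k t hk) (hLB k t hk) t (hLt k t hk) hk)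
      rw [← Category.assoc, r_comp] at h1
      exact h1)
    (fun i k t₀ hi₀ hk₀ => by
      have hl₀ := hLt k t₀ hk₀
      have hb := hLB k t₀ hk₀
      set l := L k t₀ hk₀
      set S := c.arc i ∩ c.arc l ∩ c'.arc k
      have h3 := isLocallyConstant_comp (v := fun t : S => σ.f i ⟨t, t.2.1.1⟩)
        (I := fun t : S => ((σ.r i l t t.2.1.1 t.2.1.2).1 : O.Tran (U i) (U l)))
        (J := fun t : S => n k l hb)
        (R := fun t : S => ((σ.r i l t t.2.1.1 t.2.1.2 ≫ ν k l hb t t.2.1.2 t.2.2).1 :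
          O.Tran (U i) (U' k))) (by fun_prop)
        ((IsLocallyConstant.iff_eventually_eq _).2 fun t => Filter.Eventually.of_forall
          fun s => r_val_const ..) (IsLocallyConstant.const _)
        fun t => Hom.isComp (σ.r i l t t.2.1.1 t.2.1.2) (ν k l hb t t.2.1.2 t.2.2)
      have h4 := (isLocallyConstant_subtype_iff (α := O.Tran (U i) (U' k)) (S := S)
        (F := fun t h => ((σ.r i l t h.1.1 h.1.2 ≫ ν k l hb t h.1.2 h.2).1 :
          O.Tran (U i) (U' k)))).1 h3 t₀ ⟨⟨hi₀, hl₀⟩, hk₀⟩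
      filter_upwards [h4, (c.isOpen_arc l).mem_nhds hl₀] with t ht hl hi hk
      exact (indep k (L k t hk) l _ hb t i hi _ hl hk).trans (ht ⟨⟨hi, hl⟩, hk⟩))
    (by
      have h1 := indep 0 (L 0 0 c'.zero_mem) 0 (hLB 0 0 c'.zero_mem) h0 0 0 c.zero_mem
        (hLt 0 0 c'.zero_mem) c.zero_mem c'.zero_mem
      rw [r_self, Category.id_comp] at h1
      exact (congrArg O.arrow h1).trans base)
  refine ⟨σ', E, fun k l h t hl hk => ?_⟩
  rw [hE]
  refine (indep k (L k t hk) l _ h t l hl _ hl hk).trans ?_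
  rw [r_self, Category.id_comp]

end Glue

end LoopOver

namespace LoopSystem

/-- A refinement of a loop is equivalent to it. -/
theorem IsRefinement.eqv {τ σ : LoopSystem O x} (h : τ.IsRefinement σ) :
    Nonempty (LoopEqv τ.sys σ.sys) := by
  obtain ⟨θ, j, h0, hj0, hj, hc⟩ := h
  have hθ : ∀ k t, t ∈ τ.c.arc k → t ∈ σ.c.arc (θ k) := fun k t h => (hj k t h).1
  let e : ∀ k t (hk : t ∈ τ.c.arc k), τ.sys.pt k t hk ⟶ σ.sys.pt (θ k) t (hθ k t hk) :=
    fun k t hk => ⟨j k, (hj k t hk).2.1, (hj k t hk).2.2⟩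
  have he1 : ∀ k t hk hl, τ.sys.r k (k + 1) t hk hl ≫ e (k + 1) t hl =
      e k t hk ≫ σ.sys.r (θ k) (θ (k + 1)) t (hθ k t hk) (hθ _ t hl) := by
    intro k t hk hl
    obtain ⟨r, hr, hr'⟩ := hc k
    obtain ⟨d, hd, hd'⟩ := hr' t hk hl
    have h1 := Hom.isComp (τ.sys.r k (k + 1) t hk hl) (e (k + 1) t hl)
    rw [LoopOver.r_succ] at h1
    have h2 := Hom.isComp (e k t hk) (σ.sys.r (θ k) (θ (k + 1)) t (hθ k t hk) (hθ _ t hl))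
    rw [(LoopOver.r_link (σ := σ.sys) _ _ t (hθ k t hk) (hθ _ t hl)).unique hr] at h2
    exact Hom.ext ((h1.unique hd).trans (h2.unique hd').symm)
  have he : ∀ k l t hk hl, τ.sys.r k l t hk hl ≫ e l t hl =
      e k t hk ≫ σ.sys.r (θ k) (θ l) t (hθ k t hk) (hθ _ t hl) := by
    intro k l t hk hl
    rcases τ.c.adj hk hl with rfl | rfl | rfl
    · rw [LoopOver.r_self, LoopOver.r_self, Category.id_comp, Category.comp_id]
    · exact he1 k t hk hl
    · rw [← LoopOver.r_inv l (l + 1) t hl hk, ← cancel_epi (τ.sys.r l (l + 1) t hl hk),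
        ← Category.assoc, Groupoid.comp_inv, Category.id_comp, ← Category.assoc, he1 l t hl hk,
        Category.assoc, LoopOver.r_comp, LoopOver.r_self, Category.comp_id]
  -- The refinement only gives germs from `k` to `θ k`. Those to other arcs of `σ` are obtained by
  -- following its cocycle.
  refine ⟨⟨fun t k i hk hi => e k t hk ≫ σ.sys.r (θ k) i t (hθ k t hk) hi, ?_, ?_, ?_⟩⟩
  · intro t k l i i' hk hl hi hi'
    rw [← Category.assoc, he, Category.assoc, Category.assoc, LoopOver.r_comp, LoopOver.r_comp]
  · intro k i t₀ hk₀ hi₀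
    set S := τ.c.arc k ∩ σ.c.arc i
    have h3 := isLocallyConstant_comp (v := fun t : S => τ.sys.f k ⟨t, t.2.1⟩)
      (I := fun t : S => j k)
      (J := fun t : S => ((σ.sys.r (θ k) i t (hθ k t t.2.1) t.2.2).1 : O.Tran (σ.U (θ k)) (σ.U i)))
      (R := fun t : S => ((e k t t.2.1 ≫ σ.sys.r (θ k) i t (hθ k t t.2.1) t.2.2).1 :
        O.Tran (τ.U k) (σ.U i))) (by fun_prop) (IsLocallyConstant.const _)
      ((IsLocallyConstant.iff_eventually_eq _).2 fun t => Filter.Eventually.of_forall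
        fun s => LoopOver.r_val_const ..)
      fun t => Hom.isComp (e k t t.2.1) _
    have h4 := (isLocallyConstant_subtype_iff (α := O.Tran (τ.U k) (σ.U i)) (S := S)
      (F := fun t h => ((e k t h.1 ≫ σ.sys.r (θ k) i t (hθ k t h.1) h.2).1 :
        O.Tran (τ.U k) (σ.U i)))).1 h3 t₀ ⟨hk₀, hi₀⟩
    filter_upwards [h4] with t ht hk hi
    exact ht ⟨hk, hi⟩
  · exact (isTriv_of_arrow_eq (e := e 0 0 τ.c.zero_mem) hj0).comp (LoopOver.r_isTriv h0 _ _ _)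

end LoopSystem

namespace LoopOver

variable {c : ArcCover} {U : Fin (c.n + 3) → O.basic} {s t : LoopOver O x c U}

theorem Iso.isRefinement (h : s.Iso t) : LoopSystem.IsRefinement ⟨c, U, s⟩ ⟨c, U, t⟩ := by
  obtain ⟨δ, h0, hf, hρ⟩ := h
  refine ⟨id, fun k => (δ k, (1 : O.Grp (U k))) • O.one (U k), rfl, ?_, ?_, ?_⟩
  · change O.arrow ((δ 0, (1 : O.Grp (U 0))) • O.one (U 0)) = _
    rw [h0, one_smul_one]
  · intro k u hu
    refine ⟨hu, ?_, ?_⟩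
    · rw [source_left]; exact mem_source_one _
    · rw [mp_left _ _ (mem_source_one _), one_mp]; exact (hf k _).symm
  · intro k
    refine ⟨t.ρ k, Link.step k, fun u hu hu' => ⟨(δ (k + 1), (1 : O.Grp (U k))) • s.ρ k, ?_, ?_⟩⟩
    · exact isComp_left _ _ (s.compat k u hu hu').1
    · rw [hρ]; exact isComp_smul _ _ (s.compat k u hu hu').1

theorem Iso.eqv (h : s.Iso t) : Nonempty (LoopEqv s t) := h.isRefinement.eqv

theorem exists_gauge (s : LoopOver O x c U) (δ : ∀ i, O.Grp (U i)) (h0 : δ 0 = 1) :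
    ∃ t : LoopOver O x c U, s.Iso t ∧ (∀ i u, t.f i u = δ i • s.f i u) ∧
      ∀ i, t.ρ i = ((δ (i + 1), δ i) : O.Grp (U (i + 1)) × O.Grp (U i)) • s.ρ i := by
  refine ⟨⟨fun i => ⟨fun u => δ i • s.f i u, by fun_prop⟩,
    fun i => ((δ (i + 1), δ i) : O.Grp (U (i + 1)) × O.Grp (U i)) • s.ρ i, ?_, ?_⟩,
    ⟨δ, h0, fun _ _ => rfl, fun _ => rfl⟩, fun _ _ => rfl, fun _ => rfl⟩
  · intro i u h h'
    obtain ⟨h1, h2⟩ := s.compat i u h h'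
    refine ⟨mem_source_smul _ _ h1, ?_⟩
    change O.mp ((δ (i + 1), δ i) • s.ρ i) (δ i • s.f i ⟨u, h⟩) = δ (i + 1) • s.f (i + 1) ⟨u, h'⟩
    rw [mp_smul _ _ h1, h2]
  · change (⟨U 0, δ 0 • s.f 0 ⟨0, c.zero_mem⟩⟩ : O.BasePoint) = x
    rw [h0, one_smul]; exact s.basePt

/-- On the connected arc `i` the germ from chart `i` to itself is one automorphism `δ i`. Naturality
over the overlaps is then exactly the gauge formula for the transition maps. -/
theorem _root_.LoopEqv.iso (E : LoopEqv s t) : s.Iso t := by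
  have h1 : ∀ i, ∃ δ : O.Grp (U i), ∀ u hu,
      ((E.m u i i hu hu).1 : O.Tran (U i) (U i)) = (δ, (1 : O.Grp (U i))) • O.one (U i) := by
    intro i
    obtain ⟨u₀, h₀⟩ := c.arc_nonempty i
    obtain ⟨δ, hδ⟩ := exists_left_eq (mem_source_one (s.f i ⟨u₀, h₀⟩)) (Hom.mem (E.m u₀ i i h₀ h₀))
    exact ⟨δ, fun u hu => (E.m_const (c.isPreconnected_arc i) (fun _ h => h) (fun _ h => h)
      hu h₀).trans hδ⟩
  choose δ hδ using h1
  have hf : ∀ i u, t.f i u = δ i • s.f i u := by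
    rintro i ⟨u, hu⟩
    have := Hom.mp_eq (E.m u i i hu hu)
    rw [hδ i u hu] at this
    change O.mp ((δ i, (1 : O.Grp (U i))) • O.one (U i)) (s.f i ⟨u, hu⟩) = t.f i ⟨u, hu⟩ at this
    rw [← this, mp_left _ _ (mem_source_one _), one_mp]
  refine ⟨δ, ?_, hf, ?_⟩
  · have h2 := E.base.arrow_eq
    rw [hδ 0 0 c.zero_mem] at h2
    have h3 : (δ 0, (1 : O.Grp (U 0))) • O.one (U 0) = O.one (U 0) := by
      have h4 := (Sigma.mk.inj_iff.1 h2).2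
      exact eq_of_heq (Sigma.mk.inj_iff.1 (eq_of_heq h4)).2
    exact left_injective (O.one (U 0)) (h3.trans (one_smul_one _).symm)
  · intro i
    obtain ⟨u, hu, hu'⟩ := c.arc_inter_succ_nonempty i
    have h1 := E.nat u i (i + 1) i (i + 1) hu hu' hu hu'
    have h2 := Hom.isComp (s.r i (i + 1) u hu hu') (E.m u (i + 1) (i + 1) hu' hu')
    have h3 := Hom.isComp (E.m u i i hu hu) (t.r i (i + 1) u hu hu')
    rw [r_succ, hδ _ u hu'] at h2
    rw [← h1, r_succ, hδ _ u hu] at h3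
    have hc := (s.compat i u hu hu').1
    have h4 := h2.unique (isComp_left (δ (i + 1)) (s.ρ i) hc)
    rw [h4] at h3
    have h5 := isComp_smul (δ (i + 1)) (δ i) hc
    exact h3.symm_right.unique h5.symm_right

/-- An equivalence of a loop with a loop over a coarser cover is a refinement. -/
theorem _root_.LoopEqv.isRefinement {c' : ArcCover} {U' : Fin (c'.n + 3) → O.basic}
    {σ : LoopOver O x c' U'} (E : LoopEqv s σ) (θ : Fin (c.n + 3) → Fin (c'.n + 3)) (h0 : θ 0 = 0)
    (hθ : ∀ k, c.arc k ⊆ c'.arc (θ k)) : LoopSystem.IsRefinement ⟨c, U, s⟩ ⟨c', U', σ⟩ := by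
  have hs := fun k => (c.arc_nonempty k).some_mem
  have hj : ∀ k u (hu : u ∈ c.arc k), ((E.m _ k (θ k) (hs k) (hθ k (hs k))).1 :
      O.Tran (U k) (U' (θ k))) = (E.m u k (θ k) hu (hθ k hu)).1 := fun k u hu =>
    E.m_const (c.isPreconnected_arc k) (fun _ h => h) (hθ k) (hs k) hu
  refine ⟨θ, fun k => (E.m _ k (θ k) (hs k) (hθ k (hs k))).1, h0, ?_, ?_, ?_⟩
  · change O.arrow (E.m _ 0 (θ 0) (hs 0) (hθ 0 (hs 0))).1 = O.arrow (O.one (U 0))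
    rw [hj 0 0 c.zero_mem]
    have h1 : IsTriv (E.m 0 0 (θ 0) c.zero_mem (hθ 0 c.zero_mem)) := by
      rw [← E.m_right 0 0 0 (θ 0) c.zero_mem c'.zero_mem]
      exact E.base.comp (r_isTriv h0.symm _ _ _)
    exact h1.arrow_eq
  · intro k u hu
    refine ⟨hθ k hu, ?_⟩
    change _ ∈ (O.mp (E.m _ k (θ k) (hs k) (hθ k (hs k))).1).source ∧
      O.mp (E.m _ k (θ k) (hs k) (hθ k (hs k))).1 _ = _
    rw [hj k u hu]
    exact ⟨Hom.mem (E.m u k (θ k) hu (hθ k hu)), Hom.mp_eq (E.m u k (θ k) hu (hθ k hu))⟩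
  · intro k
    obtain ⟨u₀, h₀, h₀'⟩ := c.arc_inter_succ_nonempty k
    refine ⟨_, r_link (σ := σ) (θ k) (θ (k + 1)) u₀ (hθ k h₀) (hθ _ h₀'), fun u hu hu' => ?_⟩
    refine ⟨(s.r k (k + 1) u hu hu' ≫ E.m u (k + 1) (θ (k + 1)) hu' (hθ _ hu')).1, ?_, ?_⟩
    · have h1 := Hom.isComp (s.r k (k + 1) u hu hu') (E.m u (k + 1) (θ (k + 1)) hu' (hθ _ hu'))
      rw [r_succ, ← hj] at h1
      exact h1
    · have h1 := Hom.isComp (E.m u k (θ k) hu (hθ k hu)) (σ.r (θ k) (θ (k + 1)) u (hθ k hu) (hθ _ hu'))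
      rw [← E.nat, ← hj, r_val_const (σ := σ) _ _ u u₀ _ _ (hθ k h₀) (hθ _ h₀')] at h1
      exact h1

end LoopOver

end Loops

/-- The increasing enumeration of a finite subset of `[0, 1)`, continued quasi-periodically. -/
theorem exists_quasiPeriodic (F : Finset ℝ) (h0 : (0 : ℝ) ∈ F) (hF : ∀ y ∈ F, 0 ≤ y ∧ y < 1) :
    ∃ x : ℕ → ℝ, x 0 = 0 ∧ StrictMono x ∧ (∀ k, x (k + F.card) = x k + 1) ∧
      ∀ k, ∀ y ∈ F, ∀ z : ℤ, y + z ≤ x k ∨ x (k + 1) ≤ y + z := by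
  set M := F.card with hM
  have hMpos : 0 < M := Finset.card_pos.2 ⟨0, h0⟩
  let e := F.orderEmbOfFin hM.symm
  have he : ∀ i, 0 ≤ e i ∧ e i < 1 := fun i => hF _ (F.orderEmbOfFin_mem _ i)
  let x : ℕ → ℝ := fun k => e ⟨k % M, Nat.mod_lt _ hMpos⟩ + (k / M : ℕ)
  have hadd : ∀ k, x (k + M) = x k + 1 := by
    intro k
    simp only [x, Nat.add_mod_right, Nat.add_div_right k hMpos, Nat.cast_succ]
    ring
  have hmono : StrictMono x := by
    refine strictMono_nat_of_lt_succ fun k => ?_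
    simp only [x]
    by_cases hk : k % M + 1 < M
    · have h1 : (k + 1) % M = k % M + 1 := by
        rw [Nat.add_mod, Nat.mod_eq_of_lt (show 1 < M by omega), Nat.mod_eq_of_lt hk]
      have h2 : (k + 1) / M = k / M := by
        rw [Nat.succ_div, if_neg, add_zero]
        intro h
        rw [Nat.dvd_iff_mod_eq_zero] at h
        change (k + 1) % M = 0 at h
        omega
      rw [h2]
      have : e ⟨k % M, Nat.mod_lt _ hMpos⟩ < e ⟨(k + 1) % M, Nat.mod_lt _ hMpos⟩ := by
        rw [e.lt_iff_lt, Fin.mk_lt_mk]; omega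
      linarith
    · have hk' : k % M + 1 = M := by have := Nat.mod_lt k hMpos; omega
      have hd : M ∣ k + 1 := by
        rw [Nat.dvd_iff_mod_eq_zero, Nat.add_mod]
        rcases Nat.lt_or_ge 1 M with h | h
        · rw [Nat.mod_eq_of_lt h, hk', Nat.mod_self]
        · have : M = 1 := by omega
          rw [this]; simp [Nat.mod_one]
      have h2 : (k + 1) / M = k / M + 1 := by rw [Nat.succ_div, if_pos hd]
      rw [h2]
      have h3 := (he ⟨k % M, Nat.mod_lt _ hMpos⟩).2
      have h4 := (he ⟨(k + 1) % M, Nat.mod_lt _ hMpos⟩).1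
      push_cast
      linarith
  have hmul : ∀ z k : ℕ, x (k + z * M) = x k + z := by
    intro z k
    induction z with
    | zero => simp
    | succ z ih => rw [show k + (z + 1) * M = k + z * M + M by ring, hadd, ih]; push_cast; ring
  have hx : ∀ y ∈ F, ∃ j, x j = y := by
    intro y hy
    have : y ∈ Set.range e := by rw [F.range_orderEmbOfFin]; exact hy
    obtain ⟨j, rfl⟩ := this
    refine ⟨j, ?_⟩
    simp [x, Nat.mod_eq_of_lt j.2, Nat.div_eq_of_lt j.2]
  have hx0 : x 0 = 0 := by
    obtain ⟨j, hj⟩ := hx 0 h0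
    have h1 : x 0 ≤ x j := hmono.monotone (Nat.zero_le _)
    have h2 : 0 ≤ x 0 := by
      simp only [x, Nat.zero_div, Nat.cast_zero, add_zero]
      exact (he _).1
    linarith
  refine ⟨x, hx0, hmono, hadd, fun k y hy z => ?_⟩
  obtain ⟨j, rfl⟩ := hx y hy
  by_cases hz : 0 ≤ z
  · obtain ⟨m, rfl⟩ := Int.eq_ofNat_of_zero_le hz
    have := hmul m j
    rw [Int.cast_natCast, ← this]
    rcases Nat.lt_or_ge k (j + m * M) with h | h
    · exact Or.inr (hmono.monotone h)
    · exact Or.inl (hmono.monotone h)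
  · left
    have h1 : (z : ℝ) ≤ -1 := by exact_mod_cast (show z ≤ -1 by omega)
    have h2 : x 0 ≤ x k := hmono.monotone (Nat.zero_le _)
    have := (hF _ hy).2
    linarith

/-! ### Fine covers by arcs -/

namespace ArcCover

/-- The cover by small arcs around the points `x k` and the arcs between these points. -/
noncomputable def ofPoints (x : ℕ → ℝ) (M : ℕ) (hM : 2 ≤ M) (ε : ℝ) (h0 : x 0 = 0)
    (hadd : ∀ k, x (k + M) = x k + 1) (hε : 0 < ε)
    (hεx : ∀ k, 2 * ε ≤ x (k + 1) - x k) : ArcCover where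
  -- There are `2 * M` arcs: number `2 * k` is the small arc around `x k`, and number `2 * k + 1` is
  -- the gap between `x k` and `x (k + 1)`.
  n := 2 * M - 3
  a i := if Even i then x (i / 2) - ε else x (i / 2)
  b i := if Even i then x (i / 2) + ε else x (i / 2 + 1)
  a_add i := by
    have h1 : 2 * M - 3 + 3 = 2 * M := by omega
    have h2 : Even (i + 2 * M) ↔ Even i := by simp [Nat.even_add]
    have h3 : (i + 2 * M) / 2 = i / 2 + M := by omega
    rw [h1, h3, hadd]
    simp only [h2]
    split_ifs <;> ring
  b_add i := by
    have h1 : 2 * M - 3 + 3 = 2 * M := by omega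
    have h2 : Even (i + 2 * M) ↔ Even i := by simp [Nat.even_add]
    have h3 : (i + 2 * M) / 2 = i / 2 + M := by omega
    have h4 : i / 2 + M + 1 = i / 2 + 1 + M := by omega
    rw [h1, h3, hadd, h4, hadd]
    simp only [h2]
    split_ifs <;> ring
  overlap i := by
    rcases Nat.even_or_odd' i with ⟨k, rfl | rfl⟩
    · have h1 : ¬ Even (2 * k + 1) := by simp
      have h3 : (2 * k + 1) / 2 = k := by omega
      have h4 : 2 * k / 2 = k := by omega
      rw [if_neg h1, if_pos (even_two_mul k), h3, h4]; linarith
    · have h1 : Even (2 * k + 1 + 1) := ⟨k + 1, by ring⟩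
      have h2 : ¬ Even (2 * k + 1) := by simp
      have h3 : (2 * k + 1 + 1) / 2 = k + 1 := by omega
      have h4 : (2 * k + 1) / 2 = k := by omega
      rw [if_pos h1, if_neg h2, h3, h4]; linarith
  disjoint i := by
    rcases Nat.even_or_odd' i with ⟨k, rfl | rfl⟩
    · have h1 : Even (2 * k + 2) := ⟨k + 1, by ring⟩
      have h3 : (2 * k + 2) / 2 = k + 1 := by omega
      have h4 : 2 * k / 2 = k := by omega
      rw [if_pos h1, if_pos (even_two_mul k), h3, h4]; linarith [hεx k]
    · have h1 : ¬ Even (2 * k + 1 + 2) := by rw [Nat.not_even_iff_odd]; exact ⟨k + 1, by ring⟩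
      have h2 : ¬ Even (2 * k + 1) := by simp
      have h3 : (2 * k + 1 + 2) / 2 = k + 1 := by omega
      have h4 : (2 * k + 1) / 2 = k := by omega
      rw [if_neg h1, if_neg h2, h3, h4]
  a_zero := by simp [h0, hε]
  b_zero := by simp [h0, hε]

/-- There are arbitrarily fine covers by arcs, adapted to a given cover. -/
theorem exists_fine (c' : ArcCover) (𝒲 : UnitAddCircle → Set UnitAddCircle) (h𝒲 : ∀ t, 𝒲 t ∈ 𝓝 t) :
    ∃ (c : ArcCover) (w : Fin (c.n + 3) → UnitAddCircle), (∀ k, c.arc k ⊆ 𝒲 (w k)) ∧ w 0 = 0 ∧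
      (∀ k, k ≠ 0 → (0 : UnitAddCircle) ∉ c.arc k) ∧
      ∀ t, ∃ k, t ∈ c.arc k ∧ (t ≠ 0 → k ≠ 0) ∧ ∀ i, t ∈ c'.arc i → c.arc k ⊆ c'.arc i := by
  classical
  obtain ⟨δ, hδ, hleb⟩ := lebesgue_number_lemma_of_metric (s := Icc (0 : ℝ) 1)
    (c := fun t : UnitAddCircle => (fun u : ℝ => (u : UnitAddCircle)) ⁻¹' interior (𝒲 t))
    isCompact_Icc (fun t => isOpen_interior.preimage continuous_coe_circle) (fun u _ =>
      mem_iUnion.2 ⟨(u : UnitAddCircle), mem_interior_iff_mem_nhds.2 (h𝒲 _)⟩)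
  obtain ⟨m, hm⟩ := exists_nat_one_div_lt hδ
  set K := m + 2 with hK
  have hKpos : (0 : ℝ) < K := by positivity
  have hKδ : 1 / (K : ℝ) < δ := by
    refine lt_of_le_of_lt ?_ hm
    rw [hK]; push_cast
    exact one_div_le_one_div_of_le (by positivity) (by linarith)
  -- The points of division contain a grid finer than the Lebesgue number and all end points of `c'`
  -- modulo `1`. A gap between consecutive points is then small, and it lies inside every arc of
  -- `c'` that it meets.
  let F : Finset ℝ := (Finset.range K).image (fun j : ℕ => (j : ℝ) / K) ∪
    ((Finset.range (c'.n + 3)).image (fun j => Int.fract (c'.a j)) ∪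
      (Finset.range (c'.n + 3)).image (fun j => Int.fract (c'.b j)))
  have hgrid : ∀ j < K, (j : ℝ) / K ∈ F := fun j hj =>
    Finset.mem_union_left _ (Finset.mem_image_of_mem (fun j : ℕ => (j : ℝ) / K) (Finset.mem_range.2 hj))
  have hFa : ∀ j < c'.n + 3, Int.fract (c'.a j) ∈ F := fun j hj => Finset.mem_union_right _
    (Finset.mem_union_left _ (Finset.mem_image_of_mem (fun j => Int.fract (c'.a j)) (Finset.mem_range.2 hj)))
  have hFb : ∀ j < c'.n + 3, Int.fract (c'.b j) ∈ F := fun j hj => Finset.mem_union_right _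
    (Finset.mem_union_right _ (Finset.mem_image_of_mem (fun j => Int.fract (c'.b j)) (Finset.mem_range.2 hj)))
  have h0F : (0 : ℝ) ∈ F := by simpa using hgrid 0 (by omega)
  have hF01 : ∀ y ∈ F, 0 ≤ y ∧ y < 1 := by
    intro y hy
    simp only [F, Finset.mem_union, Finset.mem_image, Finset.mem_range] at hy
    rcases hy with ⟨j, hj, rfl⟩ | ⟨j, hj, rfl⟩ | ⟨j, hj, rfl⟩
    · exact ⟨by positivity, by rw [div_lt_one hKpos]; exact_mod_cast hj⟩
    · exact ⟨Int.fract_nonneg _, Int.fract_lt_one _⟩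
    · exact ⟨Int.fract_nonneg _, Int.fract_lt_one _⟩
  obtain ⟨x, hx0, hx, hadd, hgap⟩ := exists_quasiPeriodic F h0F hF01
  set M := F.card with hMdef
  have hM : 2 ≤ M := by
    have h1 : (1 : ℝ) / K ∈ F := by simpa using hgrid 1 (by omega)
    have h2 : ({0, 1 / (K : ℝ)} : Finset ℝ) ⊆ F := by
      intro y hy
      rw [Finset.mem_insert, Finset.mem_singleton] at hy
      rcases hy with rfl | rfl <;> assumption
    have h3 : (0 : ℝ) ≠ 1 / (K : ℝ) := by positivity
    have := Finset.card_le_card h2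
    rwa [Finset.card_pair h3] at this
  have hxM : x M = 1 := by have := hadd 0; rw [zero_add, hx0] at this; simpa using this
  have hx01 : ∀ k < M, 0 ≤ x k ∧ x k < 1 := fun k hk =>
    ⟨hx0 ▸ hx.monotone (Nat.zero_le k), hxM ▸ hx hk⟩
  have hmesh : ∀ k < M, x (k + 1) ≤ x k + 1 / K := by
    intro k hk
    obtain ⟨h1, h2⟩ := hx01 k hk
    set j := ⌊x k * K⌋₊
    have hj1 : (j : ℝ) ≤ x k * K := Nat.floor_le (by positivity)
    have hj2 : x k * K < j + 1 := Nat.lt_floor_add_one _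
    have hj3 : (j : ℝ) < K := lt_of_le_of_lt hj1 (by nlinarith)
    have hj4 : j + 1 ≤ K := by exact_mod_cast hj3
    have hlt : x k < (j + 1 : ℕ) / K := by rw [lt_div_iff₀ hKpos]; push_cast; exact hj2
    have hle : ((j + 1 : ℕ) : ℝ) / K ≤ x k + 1 / K := by
      rw [div_le_iff₀ hKpos, add_mul, one_div_mul_cancel hKpos.ne']; push_cast; linarith
    rcases hj4.lt_or_eq with h | h
    · rcases hgap k _ (hgrid (j + 1) h) 0 with h3 | h3
      · rw [Int.cast_zero, add_zero] at h3; linarith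
      · rw [Int.cast_zero, add_zero] at h3; linarith
    · rw [h, div_self hKpos.ne'] at hlt hle
      have : x (k + 1) ≤ x M := hx.monotone hk
      linarith
  -- The small arcs around the points of division must also lie in every arc of `c'` containing
  -- their centre.
  let 𝒲' : UnitAddCircle → Set UnitAddCircle := fun t => 𝒲 t ∩ ⋂ i, {s | t ∈ c'.arc i → s ∈ c'.arc i}
  have h𝒲' : ∀ t, 𝒲' t ∈ 𝓝 t := fun t => by
    refine Filter.inter_mem (h𝒲 t) (Filter.iInter_mem.2 fun i => ?_)
    by_cases h : t ∈ c'.arc i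
    · filter_upwards [(c'.isOpen_arc i).mem_nhds h] with s hs _ using hs
    · exact Filter.Eventually.of_forall fun s h' => absurd h' h
  have hεex : ∀ᶠ ε in 𝓝[>] (0 : ℝ), ∀ k : Fin M, 2 * ε ≤ x (k + 1) - x k ∧
      ∀ u ∈ Ioo (x k - ε) (x k + ε), (u : UnitAddCircle) ∈ 𝒲' (x k : ℝ) := by
    rw [Filter.eventually_all]
    intro k
    have h1 := continuous_coe_circle.continuousAt.preimage_mem_nhds (h𝒲' (x k : ℝ))
    obtain ⟨r, hr, hball⟩ := Metric.mem_nhds_iff.1 h1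
    have h2 := hx (Nat.lt_succ_self (k : ℕ))
    have h3 : 0 < min r ((x (k + 1) - x k) / 2) := lt_min hr (by simpa using h2)
    filter_upwards [Ioo_mem_nhdsGT h3] with ε hε
    have h4 := hε.2.trans_le (min_le_left _ _)
    have h5 := hε.2.trans_le (min_le_right _ _)
    refine ⟨by linarith, fun u hu => hball ?_⟩
    rw [Metric.mem_ball, Real.dist_eq, abs_lt]
    exact ⟨by linarith [hu.1], by linarith [hu.2]⟩
  obtain ⟨ε, hε, hεpos⟩ := (hεex.and self_mem_nhdsWithin).exists
  have hεpos : 0 < ε := hεpos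
  have hεx : ∀ k, 2 * ε ≤ x (k + 1) - x k := by
    have hmul : ∀ z k : ℕ, x (k + z * M) = x k + z := by
      intro z k
      induction z with
      | zero => simp
      | succ z ih => rw [show k + (z + 1) * M = k + z * M + M by ring, hadd, ih]; push_cast; ring
    intro k
    have h1 := (hε ⟨k % M, Nat.mod_lt _ (by omega)⟩).1
    have h2 := hmul (k / M) (k % M)
    have h3 := hmul (k / M) (k % M + 1)
    rw [Nat.mod_add_div'] at h2
    rw [add_right_comm, Nat.mod_add_div'] at h3
    rw [h2, h3]
    simpa using h1
  let c := ofPoints x M hM ε hx0 hadd hεpos hεx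
  have hn : c.n + 3 = 2 * M := by change 2 * M - 3 + 3 = 2 * M; omega
  have hgapex : ∀ k < M, ∃ w : UnitAddCircle, ∀ u ∈ Ioo (x k) (x (k + 1)), (u : UnitAddCircle) ∈ 𝒲 w := by
    intro k hk
    obtain ⟨w, hw⟩ := hleb (x k) ⟨(hx01 k hk).1, (hx01 k hk).2.le⟩
    refine ⟨w, fun u hu => interior_subset (hw ?_)⟩
    rw [Metric.mem_ball, Real.dist_eq, abs_lt]
    have := hmesh k hk
    exact ⟨by linarith [hu.1], by linarith [hu.2]⟩
  choose! w hw using hgapex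
  have harc_even : ∀ (i : Fin (c.n + 3)) (k : ℕ), (i : ℕ) = 2 * k → c.arc i =
      (fun u : ℝ => (u : UnitAddCircle)) '' Ioo (x k - ε) (x k + ε) := by
    intro i k hi
    have h1 : (2 * k) / 2 = k := by omega
    simp only [arc, c, ofPoints, hi, even_two_mul k, if_true, h1]
  have harc_odd : ∀ (i : Fin (c.n + 3)) (k : ℕ), (i : ℕ) = 2 * k + 1 → c.arc i =
      (fun u : ℝ => (u : UnitAddCircle)) '' Ioo (x k) (x (k + 1)) := by
    intro i k hi
    have h1 : (2 * k + 1) / 2 = k := by omega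
    have h2 : ¬ Even (2 * k + 1) := by simp
    simp only [arc, c, ofPoints, hi, h2, if_false, h1]
  refine ⟨c, fun i => if Even (i : ℕ) then (x ((i : ℕ) / 2) : ℝ) else w ((i : ℕ) / 2), ?_, ?_, ?_, ?_⟩
  · intro i
    have hi := i.2
    rcases Nat.even_or_odd' (i : ℕ) with ⟨k, h | h⟩
    · dsimp only
      rw [harc_even i k h, if_pos ⟨k, by omega⟩, show (i : ℕ) / 2 = k by omega]
      rintro _ ⟨u, hu, rfl⟩
      exact ((hε ⟨k, by omega⟩).2 u hu).1
    · dsimp only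
      rw [harc_odd i k h, if_neg (by rw [Nat.not_even_iff_odd]; exact ⟨k, h⟩),
        show (i : ℕ) / 2 = k by omega]
      rintro _ ⟨u, hu, rfl⟩
      exact hw k (by omega) u hu
  · simp [hx0]
  · intro i hi0
    have hi := i.2
    have hi0' : (i : ℕ) ≠ 0 := fun h => hi0 (Fin.ext h)
    have key : ∀ u : ℝ, 0 < u → u < 1 → (u : UnitAddCircle) ≠ 0 := by
      intro u h1 h2 h
      obtain ⟨z, hz⟩ := unitAddCircle_coe_eq_iff.1 (h.trans (AddCircle.coe_zero (p := (1 : ℝ))).symm)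
      rw [zero_add] at hz
      rw [hz] at h1 h2
      have h3 : 0 < z := by exact_mod_cast h1
      have h4 : z < 1 := by exact_mod_cast h2
      omega
    rcases Nat.even_or_odd' (i : ℕ) with ⟨k, h | h⟩
    · rw [harc_even i k h]
      rintro ⟨u, hu, e⟩
      obtain ⟨k', rfl⟩ : ∃ k', k = k' + 1 := ⟨k - 1, by omega⟩
      have h1 := hεx k'
      have h2 := hεx (k' + 1)
      have h3 := (hx01 k' (by omega)).1
      have h4 : x (k' + 1 + 1) ≤ x M := hx.monotone (by omega)
      exact key u (by linarith [hu.1]) (by linarith [hu.2]) e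
    · rw [harc_odd i k h]
      rintro ⟨u, hu, e⟩
      have h3 := (hx01 k (by omega)).1
      have h4 : x (k + 1) ≤ x M := hx.monotone (by omega)
      exact key u (by linarith [hu.1]) (by linarith [hu.2]) e
  · intro t
    obtain ⟨u, rfl, hu0, hu1⟩ := exists_coe_unitAddCircle t
    have hex : ∃ k, u < x (k + 1) := ⟨M - 1, by rw [show M - 1 + 1 = M by omega, hxM]; exact hu1⟩
    obtain ⟨k, hk, hmin⟩ : ∃ k, u < x (k + 1) ∧ x k ≤ u := by
      refine ⟨Nat.find hex, Nat.find_spec hex, ?_⟩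
      rcases Nat.eq_zero_or_pos (Nat.find hex) with h | h
      · rw [h, hx0]; exact hu0
      · have := Nat.find_min hex (Nat.sub_lt h one_pos)
        rwa [not_lt, show Nat.find hex - 1 + 1 = Nat.find hex by omega] at this
    have hkM : k < M := by
      rw [← hx.lt_iff_lt, hxM]; exact hmin.trans_lt hu1
    -- A point of division is covered by its small arc; any other time is covered by a gap, whose
    -- number is odd and hence nonzero.
    rcases hmin.eq_or_lt with h | h
    · refine ⟨⟨2 * k, by omega⟩, ?_, fun hu h' => hu ?_, ?_⟩
      · rw [harc_even _ k rfl]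
        exact ⟨u, ⟨by linarith, by linarith⟩, rfl⟩
      · have hk0 : 2 * k = 0 := congrArg Fin.val h'
        rw [← h, show k = 0 by omega, hx0]
        exact AddCircle.coe_zero (p := (1 : ℝ))
      · intro i hi
        rw [harc_even _ k rfl]
        rintro _ ⟨v, hv, rfl⟩
        have := ((hε ⟨k, hkM⟩).2 v hv).2
        rw [mem_iInter] at this
        exact this i (by rw [show x ((⟨k, hkM⟩ : Fin M) : ℕ) = u from h]; exact hi)
    · refine ⟨⟨2 * k + 1, by omega⟩, ?_, fun _ h' => absurd (congrArg Fin.val h')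
        (Nat.succ_ne_zero _), ?_⟩
      · rw [harc_odd _ k rfl]
        exact ⟨u, ⟨h, hk⟩, rfl⟩
      · rintro i ⟨v, ⟨hv1, hv2⟩, hvu⟩
        obtain ⟨z, hz⟩ := unitAddCircle_coe_eq_iff.1 hvu
        have ha := hgap k _ (hFa i i.2) (⌊c'.a i⌋ - z)
        have hb := hgap k _ (hFb i i.2) (⌊c'.b i⌋ - z)
        have ha' : Int.fract (c'.a i) + ((⌊c'.a i⌋ - z : ℤ) : ℝ) = c'.a i - z := by
          rw [Int.fract]; push_cast; ring
        have hb' : Int.fract (c'.b i) + ((⌊c'.b i⌋ - z : ℤ) : ℝ) = c'.b i - z := by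
          rw [Int.fract]; push_cast; ring
        rw [ha'] at ha
        rw [hb'] at hb
        rw [harc_odd _ k rfl]
        rintro _ ⟨s, hs, rfl⟩
        refine ⟨s + z, ⟨?_, ?_⟩, unitAddCircle_coe_add_int s z⟩
        · rcases ha with ha | ha <;> linarith [hs.1, hs.2]
        · rcases hb with hb | hb <;> linarith [hs.1, hs.2]

end ArcCover

/-! ### Equality of loops -/

section Loops

variable {X : Type u} [TopologicalSpace X] {O : Orbispace X} {x : O.BasePoint}

open Orbispace

namespace OrbiLoop

variable {c c' : ArcCover} {U : Fin (c.n + 3) → O.basic} {U' : Fin (c'.n + 3) → O.basic}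
  {σ : LoopOver O x c U} {σ' : LoopOver O x c' U'}

/-- Re-charting of a loop over a finer cover. -/
theorem _root_.LoopOver.exists_rechart (σ : LoopOver O x c U) (θ : Fin (c'.n + 3) → Fin (c.n + 3))
    (hθ : ∀ k, c'.arc k ⊆ c.arc (θ k)) (h0 : θ 0 = 0) (n : ∀ k, O.Tran (U (θ k)) (U' k))
    (hn : ∀ k t (h : t ∈ c'.arc k), σ.f (θ k) ⟨t, hθ k h⟩ ∈ (O.mp (n k)).source)
    (base : O.arrow (n 0) = O.arrow (O.one x.1)) :
    ∃ (σ' : LoopOver O x c' U') (E : LoopEqv σ σ'),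
      ∀ k t hl hk, (E.m t (θ k) k hl hk).1 = n k := by
  obtain ⟨σ', E, hE⟩ := LoopOver.exists_glue_const (U' := U') σ (fun k => {l | l = θ k})
    (fun k l (h : l = θ k) => h ▸ n k) (fun k t ht => ⟨θ k, rfl, hθ k ht⟩)
    (by rintro k l rfl t hl hk; exact hn k t hk)
    (by
      intro k l h h' t hl hl' hk
      exact absurd (h'.trans h.symm) (Fin.ne_add_one l))
    h0.symm (by
      have key : ∀ (l l' : Fin (c.n + 3)) (h : l = l') (d : O.Tran (U l) (U' 0)),
          O.arrow (h ▸ d : O.Tran (U l') (U' 0)) = O.arrow d := by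
        intro l l' h d; subst h; rfl
      rw [← base]
      exact key _ _ _ _)
  exact ⟨σ', E, fun k t hl hk => hE k (θ k) rfl t hl hk⟩

/-- Over a cover finer than both, re-chart `σ` in its own charts. The result refines `σ`, and
composing with `E` shows that it refines `σ'` as well. -/
theorem directlyEquivalent_of_eqv (E : LoopEqv σ σ') :
    LoopSystem.DirectlyEquivalent ⟨c, U, σ⟩ ⟨c', U', σ'⟩ := by
  classical
  -- At the time `0` the arc number `0` is chosen, so that the index maps of the refinements
  -- preserve the base index.
  let i : UnitAddCircle → Fin (c.n + 3) := fun t =>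
    if t = 0 then 0 else (c.exists_mem_arc t).choose
  let i' : UnitAddCircle → Fin (c'.n + 3) := fun t =>
    if t = 0 then 0 else (c'.exists_mem_arc t).choose
  have hi : ∀ t, t ∈ c.arc (i t) := by
    intro t
    by_cases h : t = 0
    · subst h; simp only [i, if_true]; exact c.zero_mem
    · simp only [i, h, if_false]; exact (c.exists_mem_arc t).choose_spec
  have hi' : ∀ t, t ∈ c'.arc (i' t) := by
    intro t
    by_cases h : t = 0
    · subst h; simp only [i', if_true]; exact c'.zero_mem
    · simp only [i', h, if_false]; exact (c'.exists_mem_arc t).choose_spec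
  obtain ⟨d, w, hw, hw0, -, -⟩ := c.exists_fine (fun t => c.arc (i t) ∩ c'.arc (i' t)) fun t =>
    Filter.inter_mem ((c.isOpen_arc _).mem_nhds (hi t)) ((c'.isOpen_arc _).mem_nhds (hi' t))
  have h0 : i (w 0) = 0 := by simp [i, hw0]
  have h0' : i' (w 0) = 0 := by simp [i', hw0]
  have hU0 : U 0 = x.1 := congrArg Sigma.fst σ.basePt
  obtain ⟨τ, E', -⟩ := σ.exists_rechart (c' := d) (U' := fun k => U (i (w k))) (fun k => i (w k))
    (fun k => (hw k).trans inter_subset_left) h0 (fun k => O.one _) (fun k t h => mem_source_one _)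
    (by rw [h0, hU0])
  refine ⟨d, _, τ, τ, E'.symm.isRefinement (fun k => i (w k)) h0 fun k => (hw k).trans inter_subset_left,
    (E'.symm.trans E).isRefinement (fun k => i' (w k)) h0' fun k => (hw k).trans inter_subset_right,
    fun _ => 1, rfl, fun k t => (one_smul _ _).symm, fun k => (one_smul
      (O.Grp (U (i (w (k + 1)))) × O.Grp (U (i (w k)))) (τ.ρ k)).symm⟩

theorem eqv_of_directlyEquivalent {σ τ : LoopSystem O x} (h : σ.DirectlyEquivalent τ) :
    Nonempty (LoopEqv σ.sys τ.sys) := by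
  obtain ⟨c, U, s, t, h1, h2, h3⟩ := h
  obtain ⟨E1⟩ := h1.eqv
  obtain ⟨E2⟩ := h2.eqv
  obtain ⟨E3⟩ := h3.eqv
  exact ⟨(E1.symm.trans E3).trans E2⟩

/-- Equivalences of cocycles can be inverted and composed, so the relation generated by direct
equivalence is no larger than direct equivalence itself. -/
theorem mk_eq_iff {σ τ : LoopSystem O x} : mk σ = mk τ ↔ Nonempty (LoopEqv σ.sys τ.sys) := by
  constructor
  · intro h
    have h1 := Quot.eqvGen_exact h
    clear h
    induction h1 with
    | rel _ _ h => exact eqv_of_directlyEquivalent h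
    | refl σ => exact ⟨LoopEqv.refl _⟩
    | symm _ _ _ ih => exact ih.map LoopEqv.symm
    | trans _ _ _ _ _ ih1 ih2 =>
      obtain ⟨E1⟩ := ih1
      obtain ⟨E2⟩ := ih2
      exact ⟨E1.trans E2⟩
  · rintro ⟨E⟩
    exact Quot.sound (directlyEquivalent_of_eqv E)

theorem mk_eq_mk_iff_iso {s t : LoopOver O x c U} : mk ⟨c, U, s⟩ = mk ⟨c, U, t⟩ ↔ s.Iso t := by
  rw [mk_eq_iff]
  exact ⟨fun ⟨E⟩ => E.iso, fun h => h.eqv⟩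

end OrbiLoop

end Loops

/-! ### Composition of loops with morphisms -/

section Compose

variable {X Y : Type u} [TopologicalSpace X] [TopologicalSpace Y]
variable {O : Orbispace X} {P : Orbispace Y} {x : O.BasePoint} {y : P.BasePoint}

open Orbispace

theorem LoopOver.proj_f_eq {c : ArcCover} {U : Fin (c.n + 3) → O.basic} (σ : LoopOver O x c U)
    {t : UnitAddCircle} {i j : Fin (c.n + 3)} (hi : t ∈ c.arc i) (hj : t ∈ c.arc j) :
    ((O.chart (U i)).proj (σ.f i ⟨t, hi⟩) : X) = (O.chart (U j)).proj (σ.f j ⟨t, hj⟩) := by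
  have h1 := proj_mp (Hom.mem (σ.r i j t hi hj))
  have h2 := Hom.mp_eq (σ.r i j t hi hj)
  rw [h2] at h1
  exact h1.symm

/-- Re-charting a loop in prescribed charts, over a fine cover by arcs. -/
theorem LoopOver.exists_rechart_fine {c : ArcCover} {U : Fin (c.n + 3) → O.basic}
    (σ : LoopOver O x c U) (c' : ArcCover) (V : UnitAddCircle → O.basic)
    (hV : ∀ t i (hi : t ∈ c.arc i), ((O.chart (U i)).proj (σ.f i ⟨t, hi⟩) : X) ∈ (V t : Set X))
    (hV0 : V 0 = x.1) (𝒲 : UnitAddCircle → Set UnitAddCircle) (h𝒲 : ∀ t, 𝒲 t ∈ 𝓝 t) :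
    ∃ (d : ArcCover) (w : Fin (d.n + 3) → UnitAddCircle)
      (σ' : LoopOver O x d fun k => V (w k)), Nonempty (LoopEqv σ σ') ∧
      (∀ k, d.arc k ⊆ 𝒲 (w k)) ∧ w 0 = 0 ∧
      (∀ k, k ≠ 0 → (0 : UnitAddCircle) ∉ d.arc k) ∧
      ∀ t, ∃ k, t ∈ d.arc k ∧ (t ≠ 0 → k ≠ 0) ∧ ∀ i, t ∈ c'.arc i → d.arc k ⊆ c'.arc i := by
  have h1 : ∀ t, ∃ (i : Fin (c.n + 3)) (n : O.Tran (U i) (V t)) (hi : t ∈ c.arc i),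
      σ.f i ⟨t, hi⟩ ∈ (O.mp n).source ∧ (t = 0 → i = 0 ∧ O.arrow n = O.arrow (O.one x.1)) := by
    intro t
    by_cases ht : t = 0
    · subst ht
      have hU0 : U 0 = x.1 := congrArg Sigma.fst σ.basePt
      have key : ∀ a b : O.basic, a = x.1 → b = x.1 → ∀ z : O.Hat a, ∃ n : O.Tran a b,
          z ∈ (O.mp n).source ∧ O.arrow n = O.arrow (O.one x.1) := by
        rintro a b rfl rfl z
        exact ⟨O.one _, mem_source_one z, rfl⟩
      obtain ⟨n, hn, hn'⟩ := key _ _ hU0 hV0 (σ.f 0 ⟨0, c.zero_mem⟩)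
      exact ⟨0, n, c.zero_mem, hn, fun _ => ⟨rfl, hn'⟩⟩
    · obtain ⟨i, hi⟩ := c.exists_mem_arc t
      obtain ⟨n, hn⟩ := exists_tran (U i) (V t) _ (hV t i hi)
      exact ⟨i, n, hi, hn, fun h => absurd h ht⟩
  choose i n hi hn h0 using h1
  obtain ⟨d, w, hw, hw0, hd0, hd⟩ := c'.exists_fine
    (fun t => 𝒲 t ∩ {s | ∃ h : s ∈ c.arc (i t), σ.f (i t) ⟨s, h⟩ ∈ (O.mp (n t)).source}) (fun t => by
      refine Filter.inter_mem (h𝒲 t) ?_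
      have h2 := (σ.f (i t)).continuous.continuousAt.preimage_mem_nhds
        ((isOpen_source (n t)).mem_nhds (hn t))
      rw [nhds_subtype_eq_comap, Filter.mem_comap] at h2
      obtain ⟨N, hN, hN'⟩ := h2
      filter_upwards [hN, (c.isOpen_arc _).mem_nhds (hi t)] with s hs hs'
      exact ⟨hs', hN' (show (⟨s, hs'⟩ : c.arc (i t)) ∈ Subtype.val ⁻¹' N from hs)⟩)
  obtain ⟨σ', E, -⟩ := σ.exists_rechart (c' := d) (U' := fun k => V (w k)) (fun k => i (w k))
    (fun k s hs => (hw k hs).2.1) (h0 _ hw0).1 (fun k => n (w k)) (fun k s hs => (hw k hs).2.2)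
    (h0 _ hw0).2
  exact ⟨d, w, σ', ⟨E⟩, fun k => (hw k).trans inter_subset_left, hw0, hd0, hd⟩

namespace LoopOver

variable {c c' : ArcCover}

theorem Link.map {τ : BasedSystem O x P y} {κ : Fin (c.n + 3) → τ.Λ} {h0 : κ 0 = τ.o}
    {s : LoopOver O x c fun i => τ.src (κ i)} {i j : Fin (c.n + 3)}
    {r : O.Tran (τ.src (κ i)) (τ.src (κ j))} (h : s.Link i j r) :
    (s.comp τ κ h0).Link i j (τ.sys.ρ (κ i) (κ j) r) := by
  rcases h.eq_cases with ⟨rfl, e⟩ | ⟨rfl, e⟩ | ⟨rfl, e⟩ <;> obtain rfl := eq_of_heq e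
  · rw [SystemOver.ρ_one]; exact Link.refl i
  · exact Link.step i
  · rw [SystemOver.ρ_inv]
    exact Link.back j _ (isInv_inv _)

theorem comp_r (τ : BasedSystem O x P y) (κ : Fin (c.n + 3) → τ.Λ) (h0 : κ 0 = τ.o)
    (s : LoopOver O x c fun i => τ.src (κ i)) (i j : Fin (c.n + 3)) (t hi hj) :
    (s.comp τ κ h0).r i j t hi hj = τ.sys.onGerm (κ i) (κ j) (s.r i j t hi hj) :=
  (eq_r (σ := s.comp τ κ h0) (e := τ.sys.onGerm (κ i) (κ j) (s.r i j t hi hj))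
    (r_link i j t hi hj).map).symm

/-- Equivalent loops have equivalent images. -/
def _root_.LoopEqv.map (τ : BasedSystem O x P y) {κ : Fin (c.n + 3) → τ.Λ} (h0 : κ 0 = τ.o)
    {κ' : Fin (c'.n + 3) → τ.Λ} (h0' : κ' 0 = τ.o)
    {s : LoopOver O x c fun i => τ.src (κ i)} {s' : LoopOver O x c' fun i => τ.src (κ' i)}
    (E : LoopEqv s s') : LoopEqv (s.comp τ κ h0) (s'.comp τ κ' h0') where
  m t i k hi hk := τ.sys.onGerm (κ i) (κ' k) (E.m t i k hi hk)
  nat t i j k l hi hj hk hl := by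
    rw [comp_r, comp_r]
    have h1 := τ.sys.onGerm_comp (s.r i j t hi hj) (E.m t j l hj hl)
    have h2 := τ.sys.onGerm_comp (E.m t i k hi hk) (s'.r k l t hk hl)
    exact h1.symm.trans ((congrArg (τ.sys.onGerm (κ i) (κ' l)) (E.nat t i j k l hi hj hk hl)).trans h2)
  lc i k t₀ hi₀ hk₀ := by
    filter_upwards [E.lc i k t₀ hi₀ hk₀] with t h hi hk
    exact congrArg (τ.sys.ρ (κ i) (κ' k)) (h hi hk)
  base := τ.sys.onGerm_isTriv (h0.trans h0'.symm) E.base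

end LoopOver

namespace BasedSystem

open OrbiLoop

/-- `γ'` is the composition of the loop `γ` with the system `τ`. -/
def CompLoop (τ : BasedSystem O x P y) (γ : OrbiLoop O x) (γ' : OrbiLoop P y) : Prop :=
  ∃ (c : ArcCover) (κ : Fin (c.n + 3) → τ.Λ) (h0 : κ 0 = τ.o)
    (s : LoopOver O x c (fun i => τ.src (κ i))),
    γ = OrbiLoop.mk ⟨c, _, s⟩ ∧ γ' = OrbiLoop.mk ⟨c, _, s.comp τ κ h0⟩

/-- Two representatives over source charts of `τ` are equivalent as cocycles, and `τ` carries the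
equivalence over because it acts functorially on germs. -/
theorem CompLoop.unique {τ : BasedSystem O x P y} {γ : OrbiLoop O x} {γ₁ γ₂ : OrbiLoop P y}
    (h₁ : τ.CompLoop γ γ₁) (h₂ : τ.CompLoop γ γ₂) : γ₁ = γ₂ := by
  obtain ⟨c, κ, h0, s, rfl, rfl⟩ := h₁
  obtain ⟨c', κ', h0', s', h, rfl⟩ := h₂
  obtain ⟨E⟩ := mk_eq_iff.1 h
  exact mk_eq_iff.2 ⟨LoopEqv.map τ h0 h0' E⟩

/-- A loop can be represented over the source charts of a system, and over a fine cover. -/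
theorem exists_rechart_src (τ : BasedSystem O x P y) {c : ArcCover} {U : Fin (c.n + 3) → O.basic}
    (σ : LoopOver O x c U) (𝒲 : UnitAddCircle → Set UnitAddCircle) (h𝒲 : ∀ t, 𝒲 t ∈ 𝓝 t) :
    ∃ (d : ArcCover) (w : Fin (d.n + 3) → UnitAddCircle) (κ : Fin (d.n + 3) → τ.Λ) (_ : κ 0 = τ.o)
      (s : LoopOver O x d (fun i => τ.src (κ i))), Nonempty (LoopEqv σ s) ∧
      (∀ k, d.arc k ⊆ 𝒲 (w k)) ∧ w 0 = 0 ∧ ∀ k, k ≠ 0 → (0 : UnitAddCircle) ∉ d.arc k := by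
  classical
  have hτ : τ.src τ.o = x.1 := by
    obtain ⟨z, hz, -⟩ := τ.basePt_map
    exact congrArg Sigma.fst hz
  have hU0 : U 0 = x.1 := congrArg Sigma.fst σ.basePt
  have hα : ∀ t, ∃ α, (∀ i (hi : t ∈ c.arc i),
      ((O.chart (U i)).proj (σ.f i ⟨t, hi⟩) : X) ∈ (τ.src α : Set X)) ∧ (t = 0 → α = τ.o) := by
    intro t
    obtain ⟨i, hi⟩ := c.exists_mem_arc t
    by_cases ht : t = 0
    · subst ht
      refine ⟨τ.o, fun j hj => ?_, fun _ => rfl⟩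
      rw [σ.proj_f_eq hj c.zero_mem, hτ, ← hU0]
      exact Subtype.coe_prop _
    · obtain ⟨α, hα⟩ := τ.cover ((O.chart (U i)).proj (σ.f i ⟨t, hi⟩))
      exact ⟨α, fun j hj => by rw [σ.proj_f_eq hj hi]; exact hα, fun h => absurd h ht⟩
  choose α hα hα0 using hα
  obtain ⟨d, w, σ', hE, hw, hw0, hd, -⟩ := σ.exists_rechart_fine c (fun t => τ.src (α t)) hα
    (by rw [hα0 0 rfl, hτ]) 𝒲 h𝒲
  exact ⟨d, w, fun k => α (w k), hα0 _ hw0, σ', hE, hw, hw0, hd⟩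

/-- A loop can be represented over the source charts of a system. -/
theorem exists_rep (τ : BasedSystem O x P y) (γ : OrbiLoop O x) :
    ∃ (c : ArcCover) (κ : Fin (c.n + 3) → τ.Λ) (_ : κ 0 = τ.o)
      (s : LoopOver O x c (fun i => τ.src (κ i))), γ = OrbiLoop.mk ⟨c, _, s⟩ := by
  obtain ⟨⟨c, U, σ⟩, rfl⟩ := Quot.exists_rep γ
  obtain ⟨d, -, κ, h0, s, hE, -⟩ := τ.exists_rechart_src σ (fun _ => univ) fun _ => Filter.univ_mem
  exact ⟨d, κ, h0, s, mk_eq_iff.2 hE⟩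

theorem exists_compLoop (τ : BasedSystem O x P y) (γ : OrbiLoop O x) : ∃ γ', τ.CompLoop γ γ' := by
  obtain ⟨c, κ, h0, s, rfl⟩ := τ.exists_rep γ
  exact ⟨_, c, κ, h0, s, rfl, rfl⟩

/-- Re-charting the loop along the maps `ι` makes it composable with `τ`. The maps `ι'` then exhibit
the image under `τ'` as a refinement of the image under `τ`. -/
theorem IsRefinement.compLoop {τ' τ : BasedSystem O x P y} (h : τ'.IsRefinement τ)
    {γ : OrbiLoop O x} {γ' : OrbiLoop P y} (hγ : τ'.CompLoop γ γ') : τ.CompLoop γ γ' := by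
  obtain ⟨θ, ι, ι', hθ, hι, hι', hsub, hf, hρ⟩ := h
  obtain ⟨c, κ, h0, s, rfl, rfl⟩ := hγ
  have e1 : ∀ i, i = τ'.o → O.arrow (ι i) = O.arrow (O.one x.1) := by
    rintro i rfl
    obtain ⟨z, hz, -⟩ := τ'.basePt_map
    rw [← (congrArg Sigma.fst hz : τ'.src τ'.o = x.1)]
    exact hι
  have e2 : ∀ i, i = τ'.o → P.arrow (ι' i) = P.arrow (P.one (τ'.tgt i)) := by
    rintro i rfl
    exact hι'
  obtain ⟨s', E, hE⟩ := s.exists_rechart (c' := c) (U' := fun k => τ.src (θ (κ k))) (fun k => k)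
    (fun k => subset_rfl) rfl (fun k => ι (κ k))
    (fun k t h => by rw [source_univ (hsub _)]; trivial) (e1 _ h0)
  have hE' : ∀ k t h, s'.f k ⟨t, h⟩ = O.mp (ι (κ k)) (s.f k ⟨t, h⟩) := by
    intro k t h
    refine (Hom.mp_eq (E.m t k k h h)).symm.trans ?_
    rw [hE]
  refine ⟨c, fun k => θ (κ k), (congrArg θ h0).trans hθ, s', mk_eq_iff.2 ⟨E⟩, ?_⟩
  refine mk_eq_iff.2 (LoopSystem.IsRefinement.eqv ⟨fun k => k, fun k => ι' (κ k), rfl, e2 _ h0, ?_, ?_⟩)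
  · intro k t h
    refine ⟨h, (hf (κ k) _).1, ?_⟩
    refine ((hf (κ k) _).2).trans ?_
    exact congrArg _ (hE' k t h).symm
  · intro k
    refine ⟨_, LoopOver.Link.step k, fun t hk hk' => ?_⟩
    have h1 := Hom.isComp (s.r k (k + 1) t hk hk') (E.m t (k + 1) (k + 1) hk' hk')
    have h2 := Hom.isComp (E.m t k k hk hk) (s'.r k (k + 1) t hk hk')
    rw [← E.nat t k (k + 1) k (k + 1) hk hk' hk hk'] at h2
    rw [LoopOver.r_succ k t hk hk', hE] at h1
    rw [LoopOver.r_succ k t hk hk', hE] at h2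
    exact hρ (κ k) (κ (k + 1)) (s.ρ k) (s.f k ⟨t, hk⟩) (s.compat k t hk hk').1 (s'.ρ k) _ h1 h2

theorem Isomorphic.compLoop {τ' τ : BasedSystem O x P y} (h : Isomorphic τ' τ)
    {γ : OrbiLoop O x} {γ' : OrbiLoop P y} (hγ : τ'.CompLoop γ γ') : τ.CompLoop γ γ' := by
  cases h with
  | mk cover s t hs ht h =>
    obtain ⟨δ, hδ0, hf, hρ⟩ := h
    obtain ⟨c, κ, h0, l, rfl, rfl⟩ := hγ
    refine ⟨c, κ, h0, l, rfl, mk_eq_mk_iff_iso.2 ⟨fun i => δ (κ i), ?_, ?_, ?_⟩⟩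
    · have : κ 0 = _ := h0
      have e : ∀ i, i = κ 0 → δ i = 1 := by
        intro i hi
        rw [hi.trans this]; exact hδ0
      exact e _ rfl
    · exact fun i t => hf (κ i) _
    · exact fun i => hρ (κ i) (κ (i + 1)) _

/-- Existence and uniqueness of compositions upgrade the one-sided implications for refinements and
isomorphisms to equivalences. These pass to the generated equivalence relation. -/
theorem compLoop_congr {τ' τ : BasedSystem O x P y} (h : BasedMor.mk τ' = BasedMor.mk τ)
    {γ : OrbiLoop O x} {γ' : OrbiLoop P y} : τ'.CompLoop γ γ' ↔ τ.CompLoop γ γ' := by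
  have key : ∀ {τ₁ τ₂ : BasedSystem O x P y}, (∀ γ γ', τ₁.CompLoop γ γ' → τ₂.CompLoop γ γ') →
      ∀ γ γ', τ₁.CompLoop γ γ' ↔ τ₂.CompLoop γ γ' := by
    intro τ₁ τ₂ h γ γ'
    refine ⟨h γ γ', fun h' => ?_⟩
    obtain ⟨γ₁, h₁⟩ := τ₁.exists_compLoop γ
    rwa [h'.unique (h _ _ h₁)]
  have h1 := Quot.eqvGen_exact h
  clear h
  suffices ∀ γ γ', τ'.CompLoop γ γ' ↔ τ.CompLoop γ γ' from this γ γ'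
  induction h1 with
  | rel τ₁ τ₂ h =>
    obtain ⟨σ₁, σ₂, h1, h2, h3⟩ := h
    intro γ γ'
    rw [← key (fun _ _ => h1.compLoop) γ γ', ← key (fun _ _ => h2.compLoop) γ γ',
      key (fun _ _ => h3.compLoop) γ γ']
  | refl σ => exact fun _ _ => Iff.rfl
  | symm _ _ _ ih => exact fun γ γ' => (ih γ γ').symm
  | trans _ _ _ _ _ ih1 ih2 => exact fun γ γ' => (ih1 γ γ').trans (ih2 γ γ')

theorem compLoop_base (τ : BasedSystem O x P y) :
    τ.CompLoop (OrbiLoop.base O x) (OrbiLoop.base P y) := by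
  obtain ⟨Λ, src, tgt, o, cover, sys, z, rfl, rfl⟩ := τ
  refine ⟨ArcCover.three, fun _ => o, rfl, (LoopSystem.const O ⟨src o, z⟩).sys, rfl, ?_⟩
  refine mk_eq_mk_iff_iso.2 ⟨fun _ => 1, rfl, fun i t => (one_smul _ _).symm, fun i => ?_⟩
  exact (sys.ρ_one o).trans (one_smul (P.Grp (tgt o) × P.Grp (tgt o)) (P.one (tgt o))).symm

end BasedSystem

namespace OrbiLoop

theorem isComposite_mk_iff {τ : BasedSystem O x P y} {γ : OrbiLoop O x} {γ' : OrbiLoop P y} :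
    IsComposite (BasedMor.mk τ) γ γ' ↔ τ.CompLoop γ γ' := by
  constructor
  · rintro ⟨τ', c, κ, h0, s, h, h1, h2⟩
    exact (BasedSystem.compLoop_congr h).2 ⟨c, κ, h0, s, h1, h2⟩
  · rintro ⟨c, κ, h0, s, h1, h2⟩
    exact ⟨τ, c, κ, h0, s, rfl, h1, h2⟩

theorem existsUnique_isComposite (f : BasedMor O x P y) (γ : OrbiLoop O x) :
    ∃! γ', IsComposite f γ γ' := by
  obtain ⟨τ, rfl⟩ := Quot.exists_rep f
  obtain ⟨γ', h⟩ := τ.exists_compLoop γ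
  exact ⟨γ', isComposite_mk_iff.2 h, fun γ'' h' => (isComposite_mk_iff.1 h').unique h⟩

theorem isComposite_map (f : BasedMor O x P y) (γ : OrbiLoop O x) : IsComposite f γ (map f γ) :=
  Classical.epsilon_spec (existsUnique_isComposite f γ).exists

theorem map_eq {f : BasedMor O x P y} {γ : OrbiLoop O x} {γ' : OrbiLoop P y}
    (h : IsComposite f γ γ') : map f γ = γ' :=
  (existsUnique_isComposite f γ).unique (isComposite_map f γ) h

theorem map_mk_mk (τ : BasedSystem O x P y) {c : ArcCover} (κ : Fin (c.n + 3) → τ.Λ) (h0 : κ 0 = τ.o)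
    (s : LoopOver O x c fun i => τ.src (κ i)) :
    map (BasedMor.mk τ) (mk ⟨c, _, s⟩) = mk ⟨c, _, s.comp τ κ h0⟩ :=
  map_eq (isComposite_mk_iff.2 ⟨c, κ, h0, s, rfl, rfl⟩)

theorem map_base (f : BasedMor O x P y) : map f (base O x) = base P y := by
  obtain ⟨τ, rfl⟩ := Quot.exists_rep f
  exact map_eq (isComposite_mk_iff.2 τ.compLoop_base)

end OrbiLoop

end Compose

/-! ### Normal forms of nearby loops -/

section LocalNormalForm

variable {X : Type u} [TopologicalSpace X] {O : Orbispace X} {x : O.BasePoint}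

open Orbispace

theorem exists_isOpen_smul_subset {G Z : Type*} [Group G] [TopologicalSpace G] [TopologicalSpace Z]
    [MulAction G Z] [ContinuousSMul G Z] {Q V : Set Z} (hQ : IsCompact Q) (hV : IsOpen V)
    (h : Q ⊆ V) : ∃ V', IsOpen V' ∧ Q ⊆ V' ∧ ∀ᶠ g in 𝓝 (1 : G), ∀ z ∈ V', g • z ∈ V := by
  obtain ⟨N, V', hN, hV', h1, h2, h3⟩ := generalized_tube_lemma (isCompact_singleton (x := (1 : G))) hQ
    (hV.preimage (f := fun p : G × Z => p.1 • p.2) (continuous_fst.smul continuous_snd)) (by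
      rintro ⟨g, z⟩ ⟨hg, hz⟩
      rw [mem_singleton_iff] at hg
      subst hg
      change (1 : G) • z ∈ V
      rw [one_smul]; exact h hz)
  exact ⟨V', hV', h2, Filter.mem_of_superset (hN.mem_nhds (h1 (mem_singleton 1))) fun g hg z hz =>
    h3 (mk_mem_prod hg hz)⟩

/-- The data of a basic open set of loops over given arcs and charts. -/
structure LoopCond (O : Orbispace X) (c : ArcCover) (U : Fin (c.n + 3) → O.basic) where
  K : ∀ i, Set (c.arc i)
  V : ∀ i, Set (O.Hat (U i))
  A : ∀ i, Set (O.Tran (U i) (U (i + 1)))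
  isCompact_K : ∀ i, IsCompact (K i)
  isOpen_V : ∀ i, IsOpen (V i)
  isOpen_A : ∀ i, IsOpen (A i)

namespace LoopOver

variable {c : ArcCover} {U : Fin (c.n + 3) → O.basic}

/-- A loop over the given arcs and charts satisfies the conditions of a basic open set. -/
def Sat (s : LoopOver O x c U) (C : LoopCond O c U) : Prop :=
  (∀ i, MapsTo (s.f i) (C.K i) (C.V i)) ∧ ∀ i, s.ρ i ∈ C.A i

/-- For `s'` near `s` the transition map number `k` is `g • s.ρ k` with `g` close to `1`. The gauge
transformation `g⁻¹` at the single index `k + 1` restores it and otherwise moves only `f (k + 1)`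
and `ρ (k + 1)`, slightly. The index `k + 1` must not be the base index, where gauge transformations
are trivial. -/
theorem exists_cond_step (s : LoopOver O x c U) (C : LoopCond O c U) (hs : s.Sat C) :
    ∃ C' : LoopCond O c U, s.Sat C' ∧ ∀ (k : Fin (c.n + 3)), k + 1 ≠ 0 → ∀ s' : LoopOver O x c U,
      s'.Sat C' → ∃ s'' : LoopOver O x c U, s'.Iso s'' ∧ s''.Sat C ∧ s''.ρ k = s.ρ k ∧
        ∀ j, j ≠ k → j ≠ k + 1 → s''.ρ j = s'.ρ j := by
  have h1 : ∀ i, ∃ V', IsOpen V' ∧ MapsTo (s.f i) (C.K i) V' ∧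
      ∀ᶠ g in 𝓝 (1 : O.Grp (U i)), ∀ z ∈ V', g • z ∈ C.V i := fun i => by
    obtain ⟨V', h, h', h''⟩ := exists_isOpen_smul_subset (G := O.Grp (U i))
      ((C.isCompact_K i).image (s.f i).continuous) (C.isOpen_V i) (hs.1 i).image_subset
    exact ⟨V', h, mapsTo_iff_image_subset.2 h', h''⟩
  choose V' hV' hsV' hgV' using h1
  choose A' hA' hsA' hgA' using fun i => exists_nhds_right (C.isOpen_A i) (hs.2 i)
  have h2 : ∀ i, ∃ N : Set (O.Grp (U i)), IsOpen N ∧ (1 : O.Grp (U i)) ∈ N ∧ ∀ g ∈ N,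
      (∀ z ∈ V' i, g⁻¹ • z ∈ C.V i) ∧
      ∀ t' ∈ A' i, ((1, g⁻¹) : O.Grp (U (i + 1)) × O.Grp (U i)) • t' ∈ C.A i := fun i => by
    have h3 := (hgV' i).and (hgA' i)
    have h4 : Filter.Tendsto (fun g : O.Grp (U i) => g⁻¹) (𝓝 1) (𝓝 1) := by
      have := (continuous_inv (G := O.Grp (U i))).tendsto 1
      rwa [inv_one] at this
    obtain ⟨N, hN, hNo, h1N⟩ := eventually_nhds_iff.1 (h4.eventually h3)
    exact ⟨N, hNo, h1N, hN⟩
  choose N hNo h1N hN using h2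
  have hVV : ∀ i, V' i ⊆ C.V i := fun i z hz => by
    have := (hN i 1 (h1N i)).1 z hz
    rwa [inv_one, one_smul] at this
  have hAA : ∀ i, A' i ⊆ C.A i := fun i t ht => by
    have := (hN i 1 (h1N i)).2 t ht
    rwa [inv_one, show ((1, 1) : O.Grp (U (i + 1)) × O.Grp (U i)) • t = t from one_smul
      (O.Grp (U (i + 1)) × O.Grp (U i)) t] at this
  refine ⟨⟨C.K, V', fun i => A' i ∩
    (fun h : O.Grp (U (i + 1)) => ((h, 1) : O.Grp (U (i + 1)) × O.Grp (U i)) • s.ρ i) '' N (i + 1),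
    C.isCompact_K, hV', fun i => (hA' i).inter (isOpen_left_image (hNo _) _)⟩,
    ⟨hsV', fun i => ⟨hsA' i, 1, h1N _, one_smul (O.Grp (U (i + 1)) × O.Grp (U i)) (s.ρ i)⟩⟩, ?_⟩
  rintro k hk s' ⟨hf', hρ'⟩
  obtain ⟨-, g, hg, hgk⟩ := hρ' k
  classical
  obtain ⟨s'', hI, hf, hρ⟩ := s'.exists_gauge (Pi.mulSingle (k + 1) g⁻¹)
    (Pi.mulSingle_eq_of_ne hk.symm _)
  have hk1 : s''.ρ k = s.ρ k := by
    rw [hρ k, Pi.mulSingle_eq_same, Pi.mulSingle_eq_of_ne (Fin.ne_add_one k).symm, ← hgk]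
    change ((g⁻¹, 1) : O.Grp (U (k + 1)) × O.Grp (U k)) •
      ((g, 1) : O.Grp (U (k + 1)) × O.Grp (U k)) • s.ρ k = s.ρ k
    rw [smul_smul, Prod.mk_mul_mk, inv_mul_cancel, one_mul]
    exact one_smul (O.Grp (U (k + 1)) × O.Grp (U k)) (s.ρ k)
  have hρj : ∀ j, j ≠ k → j ≠ k + 1 → s''.ρ j = s'.ρ j := by
    intro j hj hj'
    rw [hρ j, Pi.mulSingle_eq_of_ne hj', Pi.mulSingle_eq_of_ne fun h => hj (add_right_cancel h)]
    exact one_smul (O.Grp (U (j + 1)) × O.Grp (U j)) (s'.ρ j)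
  refine ⟨s'', hI, ⟨fun i t ht => ?_, fun i => ?_⟩, hk1, hρj⟩
  · rw [hf]
    by_cases h : i = k + 1
    · subst h
      rw [Pi.mulSingle_eq_same]
      exact (hN _ g hg).1 _ (hf' _ ht)
    · rw [Pi.mulSingle_eq_of_ne h, one_smul]
      exact hVV i (hf' i ht)
  · by_cases h : i = k
    · subst h
      rw [hk1]; exact hs.2 i
    · by_cases h' : i = k + 1
      · subst h'
        rw [hρ, Pi.mulSingle_eq_same, Pi.mulSingle_eq_of_ne (Fin.ne_add_one _)]
        exact (hN _ g hg).2 _ (hρ' _).1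
      · rw [hρj i h h']; exact hAA i (hρ' i).1

/-- Loops near a given one can be represented by systems which have the same transition maps,
except for the last one. -/
theorem exists_cond_normalize (s : LoopOver O x c U) (C : LoopCond O c U) (hs : s.Sat C) :
    ∃ C' : LoopCond O c U, s.Sat C' ∧ ∀ s' : LoopOver O x c U, s'.Sat C' →
      ∃ s'' : LoopOver O x c U, s'.Iso s'' ∧ s''.Sat C ∧ ∀ j, j + 1 ≠ 0 → s''.ρ j = s.ρ j := by
  have key : ∀ m ≤ c.n + 2, ∀ C : LoopCond O c U, s.Sat C →
      ∃ C' : LoopCond O c U, s.Sat C' ∧ ∀ s' : LoopOver O x c U, s'.Sat C' →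
      ∃ s'' : LoopOver O x c U, s'.Iso s'' ∧ s''.Sat C ∧
        ∀ j : Fin (c.n + 3), (j : ℕ) < m → s''.ρ j = s.ρ j := by
    intro m hm
    induction m with
    | zero =>
      exact fun C hs => ⟨C, hs, fun s' hs' => ⟨s', ⟨fun _ => 1, rfl, fun i t => (one_smul _ _).symm,
        fun i => (one_smul (O.Grp (U (i + 1)) × O.Grp (U i)) (s'.ρ i)).symm⟩, hs', fun j hj =>
          absurd hj (Nat.not_lt_zero _)⟩⟩
    | succ m ih =>
      intro C hs
      -- The conditions are shrunk in reverse order: the first `m` corrections have to end in `C₁`,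
      -- so that the correction number `m` ends in `C`.
      obtain ⟨C₁, hs₁, h₁⟩ := s.exists_cond_step C hs
      obtain ⟨C₂, hs₂, h₂⟩ := ih (by omega) C₁ hs₁
      refine ⟨C₂, hs₂, fun s' hs' => ?_⟩
      obtain ⟨t, hI, ht, hρ⟩ := h₂ s' hs'
      let k : Fin (c.n + 3) := ⟨m, by omega⟩
      have hk1 : ((k + 1 : Fin (c.n + 3)) : ℕ) = m + 1 := by
        rw [Fin.val_add, show ((1 : Fin (c.n + 3)) : ℕ) = 1 from rfl]
        exact Nat.mod_eq_of_lt (by change m + 1 < c.n + 3; omega)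
      obtain ⟨r, hI', hr, hrk, hrj⟩ := h₁ k (fun h => by
        rw [h] at hk1; simp at hk1) t ht
      refine ⟨r, (hI.eqv.some.trans hI'.eqv.some).iso, hr, fun j hj => ?_⟩
      by_cases hjk : j = k
      · rw [hjk]; exact hrk
      · have h1 : (j : ℕ) ≠ m := fun h => hjk (Fin.ext h)
        have h2 : j ≠ k + 1 := fun h => by rw [h, hk1] at hj; omega
        rw [hrj j hjk h2]
        exact hρ j (by omega)
  obtain ⟨C', h1, h2⟩ := key (c.n + 2) le_rfl C hs
  refine ⟨C', h1, fun s' hs' => ?_⟩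
  obtain ⟨s'', h3, h4, h5⟩ := h2 s' hs'
  refine ⟨s'', h3, h4, fun j hj => h5 j ?_⟩
  have h6 := j.2
  rcases Nat.lt_or_ge (j : ℕ) (c.n + 2) with h | h
  · exact h
  · exact absurd (Fin.ext (by
      rw [Fin.val_add, show ((1 : Fin (c.n + 3)) : ℕ) = 1 from rfl, show (j : ℕ) + 1 = c.n + 3 by omega,
        Nat.mod_self]; rfl)) hj

theorem ext_of_f_ρ {s t : LoopOver O x c U} (hf : ∀ i u, s.f i u = t.f i u)
    (hρ : ∀ i, s.ρ i = t.ρ i) : s = t := by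
  obtain ⟨f, ρ, h1, h2⟩ := s
  obtain ⟨f', ρ', h1', h2'⟩ := t
  obtain rfl : f = f' := funext fun i => ContinuousMap.ext (hf i)
  obtain rfl : ρ = ρ' := funext hρ
  rfl

/-- A representation is determined by all transition maps but the last one. -/
theorem Iso.eq_of_ρ {s t : LoopOver O x c U} (h : s.Iso t) (hρ : ∀ j, j + 1 ≠ 0 → s.ρ j = t.ρ j) :
    s = t := by
  obtain ⟨δ, h0, hf, hδ⟩ := h
  -- Freeness propagates `δ 0 = 1` along the transition maps on which the two systems agree. The
  -- last one is not needed to reach every index.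
  have key : ∀ m (hm : m < c.n + 3), δ ⟨m, hm⟩ = 1 := by
    intro m
    induction m with
    | zero => exact fun _ => h0
    | succ m ih =>
      intro hm
      let k : Fin (c.n + 3) := ⟨m, by omega⟩
      have hk1 : k + 1 = ⟨m + 1, hm⟩ := Fin.ext (by
        rw [Fin.val_add, show ((1 : Fin (c.n + 3)) : ℕ) = 1 from rfl]
        exact Nat.mod_eq_of_lt (by omega))
      have hne : k + 1 ≠ 0 := by rw [hk1]; exact fun h => by simpa using congrArg Fin.val h
      have h1 := hδ k
      rw [← hρ k hne, ih (by omega)] at h1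
      rw [← hk1]
      exact left_injective (s.ρ k) (h1.symm.trans (one_smul (O.Grp (U (k + 1)) × O.Grp (U k)) (s.ρ k)).symm)
  have key' : ∀ i, δ i = 1 := fun i => key i i.2
  refine ext_of_f_ρ (fun i u => ?_) fun i => ?_
  · rw [hf, key', one_smul]
  · rw [hδ, key', key']
    exact (one_smul (O.Grp (U (i + 1)) × O.Grp (U i)) (s.ρ i)).symm

end LoopOver

namespace OrbiLoop

theorem basicSet_mem_nhds {c : ArcCover} {U : Fin (c.n + 3) → O.basic} (C : LoopCond O c U)
    {s : LoopOver O x c U} (hs : s.Sat C) :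
    ∀ᶠ γ in 𝓝 (mk ⟨c, U, s⟩), ∃ s' : LoopOver O x c U, γ = mk ⟨c, U, s'⟩ ∧ s'.Sat C := by
  have h : IsOpen (basicSet (x := x) c U C.K C.V C.A) := isOpen_generateFrom_of_mem
    ⟨c, U, C.K, C.V, C.A, C.isCompact_K, C.isOpen_V, C.isOpen_A, rfl⟩
  exact h.mem_nhds ⟨s, rfl, hs⟩

/-- A continuous family of loops has, locally, a continuous family of representatives. -/
theorem exists_local_rep {T : Type*} [TopologicalSpace T] {a : T → OrbiLoop O x} (ha : Continuous a)
    {c : ArcCover} {U : Fin (c.n + 3) → O.basic} {u₀ : T} {s : LoopOver O x c U}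
    (hs : a u₀ = mk ⟨c, U, s⟩) :
    ∃ (T₀ : Set T) (r : T → LoopOver O x c U), IsOpen T₀ ∧ u₀ ∈ T₀ ∧ r u₀ = s ∧
      (∀ u ∈ T₀, a u = mk ⟨c, U, r u⟩) ∧
      (∀ k, ∀ u ∈ T₀, ∀ t, ContinuousAt (fun p : T × c.arc k => (r p.1).f k p.2) (u, t)) ∧
      ∀ k, ∀ u ∈ T₀, ContinuousAt (fun u => (r u).ρ k) u := by
  classical
  -- No conditions are imposed here; only the normalization of the transition maps is wanted.
  obtain ⟨C', hC', h⟩ := s.exists_cond_normalize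
    ⟨fun _ => ∅, fun _ => univ, fun _ => univ, fun _ => isCompact_empty, fun _ => isOpen_univ,
      fun _ => isOpen_univ⟩ ⟨fun _ => mapsTo_empty _ _, fun _ => trivial⟩
  have h1 : ∀ᶠ u in 𝓝 u₀, ∃ r : LoopOver O x c U, a u = mk ⟨c, U, r⟩ ∧
      ∀ j, j + 1 ≠ 0 → r.ρ j = s.ρ j := by
    have h2 := basicSet_mem_nhds C' hC'
    rw [← hs] at h2
    filter_upwards [ha.continuousAt.eventually h2] with u hu
    obtain ⟨s', hs', hs''⟩ := hu
    obtain ⟨r, hr, -, hr'⟩ := h s' hs''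
    exact ⟨r, hs'.trans (mk_eq_mk_iff_iso.2 hr), hr'⟩
  obtain ⟨T₀, hT, hTo, hu₀⟩ := eventually_nhds_iff.1 h1
  let r : T → LoopOver O x c U := fun u => if h : u ∈ T₀ then (hT u h).choose else s
  have hr : ∀ u ∈ T₀, a u = mk ⟨c, U, r u⟩ ∧ ∀ j, j + 1 ≠ 0 → (r u).ρ j = s.ρ j := by
    intro u hu
    simp only [r, hu, dif_pos]
    exact (hT u hu).choose_spec
  -- The representatives were chosen pointwise. Normalizing once more, relative to `r u`, gives a
  -- system satisfying `C`; by uniqueness of the normal form it is `r u'`. Hence the choice is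
  -- continuous.
  have key : ∀ u ∈ T₀, ∀ C, (r u).Sat C → ∀ᶠ u' in 𝓝 u, u' ∈ T₀ ∧ (r u').Sat C := by
    intro u hu C hC
    obtain ⟨C₁, hC₁, h₁⟩ := (r u).exists_cond_normalize C hC
    have h2 := basicSet_mem_nhds C₁ hC₁
    rw [← (hr u hu).1] at h2
    filter_upwards [ha.continuousAt.eventually h2, hTo.mem_nhds hu] with u' hu' hu'T
    refine ⟨hu'T, ?_⟩
    obtain ⟨s', hs', hs''⟩ := hu'
    obtain ⟨q, hq, hqC, hqρ⟩ := h₁ s' hs''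
    have h3 : (r u').Iso q := mk_eq_mk_iff_iso.1 (((hr u' hu'T).1.symm.trans hs').trans
      (mk_eq_mk_iff_iso.2 hq))
    rwa [h3.eq_of_ρ fun j hj => ((hr u' hu'T).2 j hj).trans
      ((hqρ j hj).trans ((hr u hu).2 j hj)).symm]
  refine ⟨T₀, r, hTo, hu₀, ?_, fun u hu => (hr u hu).1, ?_, ?_⟩
  · exact (mk_eq_mk_iff_iso.1 ((hr u₀ hu₀).1.symm.trans hs)).eq_of_ρ (hr u₀ hu₀).2
  · intro k u hu t V hV
    obtain ⟨V', hV'V, hV'o, hV'⟩ := mem_nhds_iff.1 hV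
    have : LocallyCompactSpace (c.arc k) := (c.isOpen_arc k).locallyCompactSpace
    obtain ⟨K, hKt, hKV, hK⟩ := LocallyCompactSpace.local_compact_nhds t _
      (((r u).f k).continuous.continuousAt.preimage_mem_nhds (hV'o.mem_nhds hV'))
    -- The conditions are vacuous except at the index `k`.
    let C : LoopCond O c U :=
      { K := fun i => if h : i = k then h ▸ K else ∅
        V := fun i => if h : i = k then h ▸ V' else univ
        A := fun i => univ
        isCompact_K := fun i => by
          by_cases h : i = k
          · subst h; simpa using hK
          · simp [h]
        isOpen_V := fun i => by
          by_cases h : i = k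
          · subst h; simpa using hV'o
          · simp [h]
        isOpen_A := fun i => isOpen_univ }
    have hCK : C.K k = K := by simp [C]
    have hCV : C.V k = V' := by simp [C]
    have hC : (r u).Sat C := by
      refine ⟨fun i => ?_, fun i => trivial⟩
      by_cases h : i = k
      · subst h; rw [hCK, hCV]; exact hKV
      · have : C.K i = ∅ := by simp [C, h]
        rw [this]; exact mapsTo_empty _ _
    change ∀ᶠ p : T × c.arc k in 𝓝 (u, t), (r p.1).f k p.2 ∈ V
    rw [nhds_prod_eq]
    filter_upwards [(key u hu C hC).prod_mk hKt] with p hp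
    have := hp.1.2.1 k (hCK.symm ▸ hp.2)
    rw [hCV] at this
    exact hV'V this
  · intro k u hu A hA
    obtain ⟨A', hA'A, hA'o, hA'⟩ := mem_nhds_iff.1 hA
    let C : LoopCond O c U :=
      { K := fun i => ∅
        V := fun i => univ
        A := fun i => if h : i = k then h ▸ A' else univ
        isCompact_K := fun i => isCompact_empty
        isOpen_V := fun i => isOpen_univ
        isOpen_A := fun i => by
          by_cases h : i = k
          · subst h; simpa using hA'o
          · simp [h] }
    have hCA : C.A k = A' := by simp [C]
    have hC : (r u).Sat C := by
      refine ⟨fun i => mapsTo_empty _ _, fun i => ?_⟩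
      by_cases h : i = k
      · subst h; rw [hCA]; exact hA'
      · have : C.A i = univ := by simp [C, h]
        rw [this]; trivial
    change ∀ᶠ u' in 𝓝 u, (r u').ρ k ∈ A
    filter_upwards [key u hu C hC] with u' hu'
    have := hu'.2.2 k
    rw [hCA] at this
    exact hA'A this

end OrbiLoop

end LocalNormalForm

/-! ### Compositions and automorphisms -/

namespace Orbispace

variable {X : Type u} [TopologicalSpace X] {O : Orbispace X} {a b c : O.basic}

/-- The image of `C` is a connected subset of `a ∩ b` meeting the base, which is a component. Lying
over `b` thus already implies lying over the base. -/
theorem subset_source_of_proj {t : O.Tran a b} {p : O.Hat a} (hp : p ∈ (O.mp t).source)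
    {C : Set (O.Hat a)} (hC : IsPreconnected C) (hpC : p ∈ C)
    (h : ∀ z ∈ C, ((O.chart a).proj z : X) ∈ (b : Set X)) : C ⊆ (O.mp t).source := by
  refine subset_source hC (fun z hz => ?_) hp hpC
  rw [base_eq hp]
  refine (hC.image (fun z => ((O.chart a).proj z : X)) (continuous_proj a).continuousOn
    ).subset_connectedComponentIn (mem_image_of_mem _ hpC) ?_ (mem_image_of_mem _ hz)
  rintro _ ⟨w, hw, rfl⟩
  exact ⟨Subtype.coe_prop _, h w hw⟩

theorem inv_inv (t : O.Tran a b) : inv (inv t) = t := by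
  obtain ⟨p, hp⟩ := source_nonempty t
  exact congrArg Germ.val (show Groupoid.inv (Groupoid.inv (germ _ p hp)) = germ _ p hp by simp)

theorem IsComp.of_source_univ_left {j : O.Tran b c} {i : O.Tran a b} {z z' : O.Hat a} {t : O.Tran a c}
    (h : O.IsComp j i z t) (hj : (O.mp j).source = univ) (hz' : z' ∈ (O.mp i).source) :
    O.IsComp j i z' t :=
  h.of_isPreconnected (isPreconnected_source i) h.1 hz' fun w hw => ⟨hw, by rw [hj]; trivial⟩

/-- Rewriting `j ∘ i = t` as `t ∘ i⁻¹ = j` makes the total map `t` the outer factor. -/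
theorem IsComp.of_source_univ {j : O.Tran b c} {i : O.Tran a b} {z z' : O.Hat a} {t : O.Tran a c}
    (h : O.IsComp j i z t) (ht : (O.mp t).source = univ) (hz' : z' ∈ (O.mp i).source) :
    O.IsComp j i z' t := by
  have h1 := (h.symm_right.of_source_univ_left ht (mem_source_inv hz')).symm_right
  rwa [inv_inv, mp_inv_mp hz'] at h1

theorem IsComp.smul_left {j : O.Tran b c} {i : O.Tran a b} {z : O.Hat a} {t : O.Tran a c}
    (h : O.IsComp j i z t) (k : O.Grp c) :
    O.IsComp ((k, (1 : O.Grp b)) • j) i z ((k, (1 : O.Grp a)) • t) :=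
  h.assoc (isComp_left k j h.2.1) (isComp_left k t h.mem)

theorem IsComp.smul_smul {j : O.Tran b c} {i : O.Tran a b} {z : O.Hat a} {t : O.Tran a c}
    (h : O.IsComp j i z t) (k : O.Grp c) (g : O.Grp b) :
    O.IsComp ((k, g) • j) ((g, (1 : O.Grp a)) • i) z ((k, (1 : O.Grp a)) • t) := by
  obtain ⟨t', ht'⟩ := exists_isComp ((k, g) • j) ((g, (1 : O.Grp a)) • i) (x := z)
    (by rw [source_left]; exact h.1) (by rw [mp_left _ _ h.1]; exact mem_source_smul k g h.2.1)
  have h1 := (isComp_left g i h.1).assoc (isComp_smul k g h.2.1) ht'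
  rwa [h1.unique (h.smul_left k)] at ht'

/-- An automorphism `g` inserted between `i` and `t` passes through `t` and becomes `λ(g)` on the
last chart. The two inverses in the formula come from writing the right action by `g⁻¹` as a left
action. -/
theorem IsComp.smul_right {t : O.Tran b c} {i : O.Tran a b} {z : O.Hat a} {t₀ : O.Tran a c}
    (h : O.IsComp t i z t₀) (g : O.Grp b)
    (hg : O.mp ((g, (1 : O.Grp a)) • i) z ∈ (O.mp t).source) :
    O.IsComp t ((g, (1 : O.Grp a)) • i) z (((isoExt t g⁻¹)⁻¹, (1 : O.Grp a)) • t₀) := by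
  obtain ⟨t', ht'⟩ := exists_isComp t ((g, (1 : O.Grp a)) • i) (x := z)
    (by rw [source_left]; exact h.1) hg
  rw [mp_left _ _ h.1] at hg
  have h1 := (isComp_left g i h.1).assoc (isComp_right g t hg) ht'
  rw [right_eq_left (inv_mem (mem_stabilizer h.2.1 hg))] at h1
  rwa [h1.unique (h.smul_left _)] at ht'

theorem eventually_smul_mem {t : O.Tran a b} {A : Set (O.Tran a b)} (hA : IsOpen A) (ht : t ∈ A) :
    ∀ᶠ p in 𝓝 ((1 : O.Grp b), (1 : O.Grp a)), p • t ∈ A := by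
  obtain ⟨A', hA', htA', h⟩ := exists_nhds_right hA ht
  have h1 : ∀ᶠ k in 𝓝 (1 : O.Grp b), ((k, 1) : O.Grp b × O.Grp a) • t ∈ A' := by
    refine (continuous_left t).continuousAt.eventually (hA'.mem_nhds ?_)
    change ((1, 1) : O.Grp b × O.Grp a) • t ∈ A'
    rwa [show ((1, 1) : O.Grp b × O.Grp a) • t = t from one_smul (O.Grp b × O.Grp a) t]
  rw [nhds_prod_eq]
  filter_upwards [h1.prod_mk h] with p hp
  have := hp.2 _ hp.1
  rwa [smul_smul, Prod.mk_mul_mk, one_mul, mul_one] at this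

end Orbispace

open Orbispace

/-- The base arc of a finer cover carries the base chart, which need not be contained in the other
charts. A time different from `0` permits working with the remaining arcs. -/
theorem ArcCover.exists_mem_inter_ne_zero (c : ArcCover) (i : Fin (c.n + 3)) :
    ∃ t, t ∈ c.arc i ∧ t ∈ c.arc (i + 1) ∧ t ≠ 0 := by
  have h1 := c.arc_inter_succ i
  obtain ⟨u, hu1, hu2⟩ := exists_between (c.overlap i)
  obtain ⟨v, hv1, hv2⟩ := exists_between hu2
  have hu : (u : UnitAddCircle) ∈ c.arc i ∩ c.arc (i + 1) := by rw [h1]; exact ⟨u, ⟨hu1, hu2⟩, rfl⟩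
  have hv : (v : UnitAddCircle) ∈ c.arc i ∩ c.arc (i + 1) := by
    rw [h1]; exact ⟨v, ⟨hu1.trans hv1, hv2⟩, rfl⟩
  by_cases h : (u : UnitAddCircle) = 0
  · refine ⟨v, hv.1, hv.2, fun h' => ?_⟩
    obtain ⟨z, hz⟩ := unitAddCircle_coe_eq_iff.1 (h'.trans h.symm)
    have h2 := c.b_lt_add_one i
    have h3 := c.a_lt_succ i
    have h4 : (0 : ℝ) < z := by linarith
    have h5 : (z : ℝ) < 1 := by linarith
    have h4 : 0 < z := by exact_mod_cast h4
    have h5 : z < 1 := by exact_mod_cast h5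
    omega
  · exact ⟨u, hu.1, hu.2, h⟩

theorem ArcCover.exists_notMem_arc (c : ArcCover) (i : Fin (c.n + 3)) : ∃ t, t ∉ c.arc i := by
  obtain ⟨t, h1, h2⟩ := c.arc_inter_succ_nonempty (i + 1)
  refine ⟨t, fun h => ?_⟩
  rcases c.adj₃ h h1 h2 with h | h | h
  · exact Fin.ne_add_one i h.symm
  · exact Fin.ne_add_one (i + 1) h.symm
  · exact Fin.ne_add_two i h.symm

/-! ### Conditions on loops under change of cover and charts -/

section Stability

variable {X : Type u} [TopologicalSpace X] {O : Orbispace X} {x : O.BasePoint}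

/-- The equivalence gives fixed maps `m i k` from the fine to the coarse charts, re-charting `σ`
into `s`. A nearby loop, once normalized, has the transition maps of `σ` except the last, which is
changed by some `g` close to `1`. The same maps `m i k` re-chart it, after corrections by
automorphisms close to `1` that absorb `g`. All conditions are open, so they survive for small `g`.
-/
theorem LoopOver.exists_cond_of_eqv {c d : ArcCover} {U : Fin (c.n + 3) → O.basic}
    {W : Fin (d.n + 3) → O.basic} {s : LoopOver O x c U} {C : LoopCond O c U} (hs : s.Sat C)
    {σ : LoopOver O x d W} (E : LoopEqv σ s)
    (h0 : ∀ k, k ≠ 0 → (0 : UnitAddCircle) ∉ d.arc k)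
    (hd : ∀ t, ∃ k, t ∈ d.arc k ∧ (t ≠ 0 → k ≠ 0) ∧ ∀ i, t ∈ c.arc i → d.arc k ⊆ c.arc i)
    (hW : ∀ k i, k ≠ 0 → d.arc k ⊆ c.arc i → (W k : Set X) ⊆ U i)
    (hK : ∀ k i, d.arc k ⊆ c.arc i → (∃ t ∈ C.K i, (t : UnitAddCircle) ∈ d.arc k) →
      ∀ t (h : t ∈ c.arc i), t ∈ d.arc k → s.f i ⟨t, h⟩ ∈ C.V i) :
    ∃ D : LoopCond O d W, σ.Sat D ∧ ∀ τ : LoopOver O x d W, τ.Sat D →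
      ∃ s' : LoopOver O x c U, OrbiLoop.mk ⟨d, W, τ⟩ = OrbiLoop.mk ⟨c, U, s'⟩ ∧ s'.Sat C := by
  classical
  have hm : ∀ i k, d.arc k ⊆ c.arc i → ∃ m : O.Tran (W k) (U i), ∀ t hk hi,
      (E.m t k i hk hi).1 = m := fun i k h =>
    ⟨(E.m _ k i (d.arc_nonempty k).some_mem (h (d.arc_nonempty k).some_mem)).1, fun t hk hi =>
      E.m_const (d.isPreconnected_arc k) (fun _ h => h) h hk _⟩
  choose m hm using hm
  have hmsrc : ∀ i k h t (hk : t ∈ d.arc k), σ.f k ⟨t, hk⟩ ∈ (O.mp (m i k h)).source ∧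
      O.mp (m i k h) (σ.f k ⟨t, hk⟩) = s.f i ⟨t, h hk⟩ := by
    intro i k h t hk
    rw [← hm i k h t hk (h hk)]
    exact ⟨Hom.mem (E.m t k i hk (h hk)), Hom.mp_eq (E.m t k i hk (h hk))⟩
  have hmcomp : ∀ i k h h', ∃ z, O.IsComp (m i (k + 1) h') (σ.ρ k) z (m i k h) := by
    intro i k h h'
    obtain ⟨t, ht, ht'⟩ := d.arc_inter_succ_nonempty k
    have h1 := Hom.isComp (σ.r k (k + 1) t ht ht') (E.m t (k + 1) i ht' (h' ht'))
    rw [E.m_left, LoopOver.r_succ, hm _ _ h, hm _ _ h'] at h1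
    exact ⟨_, h1⟩
  have hmuniv : ∀ i k h, k ≠ 0 → (O.mp (m i k h)).source = univ := fun i k h hk =>
    source_univ (hW k i hk h) _
  have hmcomp' : ∀ i k h h' z, z ∈ (O.mp (σ.ρ k)).source →
      O.IsComp (m i (k + 1) h') (σ.ρ k) z (m i k h) := by
    intro i k h h' z hz
    obtain ⟨z₀, hz₀⟩ := hmcomp i k h h'
    by_cases hk : k = 0
    · refine hz₀.of_source_univ_left (hmuniv _ _ _ ?_) hz
      subst hk; exact Fin.ne_add_one 0
    · exact hz₀.of_source_univ (hmuniv _ _ _ hk) hz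
  -- indices outside
  have hks : ∀ i, ∃ k, ¬ d.arc k ⊆ c.arc i := by
    intro i
    obtain ⟨t, ht⟩ := c.exists_notMem_arc i
    obtain ⟨k, hk⟩ := d.exists_mem_arc t
    exact ⟨k, fun h => ht (h hk)⟩
  choose ks hks using hks
  obtain ⟨l, hl, hlmax⟩ : ∃ l : Fin (d.n + 3), l + 1 = 0 ∧ ∀ k, k ≤ l :=
    ⟨Fin.last _, Fin.last_add_one _, Fin.le_last⟩
  have hsucc : ∀ k : Fin (d.n + 3), k ≠ l → ((k + 1 : Fin (d.n + 3)) : ℕ) = k + 1 := by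
    intro k hk
    rw [Fin.val_add, show ((1 : Fin (d.n + 3)) : ℕ) = 1 from rfl]
    refine Nat.mod_eq_of_lt ?_
    have h1 := l.2
    have h2 : (k : ℕ) ≤ l := hlmax k
    have h3 : (k : ℕ) ≠ l := fun h => hk (Fin.ext h)
    omega
  -- the gauge transformations
  let e : ∀ i, O.Grp (W (l + 1)) → O.Grp (U i) := fun i g =>
    if h : d.arc (l + 1) ⊆ c.arc i then (isoExt (m i (l + 1) h) g⁻¹)⁻¹ else 1
  have he : ∀ i, Filter.Tendsto (e i) (𝓝 1) (𝓝 1) := by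
    intro i
    by_cases h : d.arc (l + 1) ⊆ c.arc i
    · have h1 : Filter.Tendsto (fun g : O.Grp (W (l + 1)) => g⁻¹) (𝓝 1) (𝓝 1) := by
        have := (continuous_inv (G := O.Grp (W (l + 1)))).tendsto 1
        rwa [inv_one] at this
      have h2 := continuousAt_isoExt (m i (l + 1) h)
      rw [ContinuousAt, isoExt_one] at h2
      have h3 := (h2.comp h1).inv
      rw [inv_one] at h3
      simpa only [e, dif_pos h, Function.comp_def] using h3
    · simpa only [e, dif_neg h] using tendsto_const_nhds
  -- The fine arcs inside the coarse arc `i` miss the number `ks i`, so the cyclic order can be cut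
  -- there. Those numbered below `ks i` need no correction. Those above it precede the passage from
  -- `l` to `0` and need `e i g`, the transport of `g` through `m i 0`.
  let ε : ∀ (i : Fin (c.n + 3)), Fin (d.n + 3) → O.Grp (W (l + 1)) → O.Grp (U i) := fun i k g =>
    if k < ks i then 1 else e i g
  have hε : ∀ i k, Filter.Tendsto (ε i k) (𝓝 1) (𝓝 1) := by
    intro i k
    by_cases h : k < ks i
    · simpa only [ε, if_pos h] using tendsto_const_nhds
    · simpa only [ε, if_neg h] using he i
  -- compact pieces
  have hQ : ∀ i, ∃ Q : Fin (d.n + 3) → Set UnitAddCircle, (∀ k, IsCompact (Q k)) ∧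
      (∀ k, Q k ⊆ {t | d.arc k ⊆ c.arc i ∧ t ∈ d.arc k}) ∧
      Subtype.val '' C.K i = ⋃ k ∈ (Finset.univ : Finset (Fin (d.n + 3))), Q k := by
    intro i
    refine ((C.isCompact_K i).image continuous_subtype_val).finite_compact_cover Finset.univ
      (fun k => {t | d.arc k ⊆ c.arc i ∧ t ∈ d.arc k}) (fun k _ => ?_) ?_
    · by_cases h : d.arc k ⊆ c.arc i
      · simpa only [h, true_and, ofPred_mem_eq] using d.isOpen_arc k
      · simp only [h, false_and, ofPred_false]; exact isOpen_empty
    · rintro _ ⟨t, -, rfl⟩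
      obtain ⟨k, hk, -, hk'⟩ := hd t
      exact mem_iUnion₂.2 ⟨k, Finset.mem_univ k, hk' i t.2, hk⟩
  choose Q hQc hQs hQK using hQ
  -- A fine arc may serve several coarse ones, and `R k` collects all compact pieces that it has to
  -- control. By `hK`, each relevant `s.f i` maps all of them into `C.V i`.
  let R : Fin (d.n + 3) → Set UnitAddCircle := fun k => ⋃ i, Q i k
  have hRc : ∀ k, IsCompact (R k) := fun k => isCompact_iUnion fun i => hQc i k
  have hRd : ∀ k, R k ⊆ d.arc k := fun k => iUnion_subset fun i t ht => (hQs i k ht).2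
  have hpre : ∀ {S : Set UnitAddCircle} k, R k ⊆ S → IsCompact (Subtype.val ⁻¹' R k : Set S) :=
    fun k h => (IsInducing.subtypeVal.isCompact_preimage_iff (by simpa using h)).2 (hRc k)
  have hV : ∀ i k, ∃ V', IsOpen V' ∧ (d.arc k ⊆ c.arc i → (Q i k).Nonempty →
      (∀ t ∈ R k, ∀ h, s.f i ⟨t, h⟩ ∈ V') ∧
      ∀ᶠ g in 𝓝 (1 : O.Grp (U i)), ∀ z ∈ V', g • z ∈ C.V i) := by
    intro i k
    by_cases h : d.arc k ⊆ c.arc i ∧ (Q i k).Nonempty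
    · obtain ⟨h, t₀, ht₀⟩ := h
      have h1 : ∃ t ∈ C.K i, (t : UnitAddCircle) ∈ d.arc k := by
        have h2 : t₀ ∈ Subtype.val '' C.K i := by
          rw [hQK]; exact mem_iUnion₂.2 ⟨k, Finset.mem_univ k, ht₀⟩
        obtain ⟨t, ht, rfl⟩ := h2
        exact ⟨t, ht, (hQs i k ht₀).2⟩
      obtain ⟨V', hV', h3, h4⟩ := exists_isOpen_smul_subset (G := O.Grp (U i))
        ((hpre k ((hRd k).trans h)).image (s.f i).continuous) (C.isOpen_V i) (by
          rintro _ ⟨t, ht, rfl⟩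
          exact hK k i h h1 t t.2 (hRd k ht))
      exact ⟨V', hV', fun _ _ => ⟨fun t ht hi => h3 ⟨⟨t, hi⟩, ht, rfl⟩, h4⟩⟩
    · exact ⟨univ, isOpen_univ, fun h1 h2 => absurd ⟨h1, h2⟩ h⟩
  choose V' hV'o hV' using hV
  -- the neighbourhood of the identity
  have hN : ∀ᶠ g in 𝓝 (1 : O.Grp (W (l + 1))),
      (∀ i k, d.arc k ⊆ c.arc i → (Q i k).Nonempty → ∀ z ∈ V' i k, ε i k g • z ∈ C.V i) ∧
      ∀ i k, ((ε (i + 1) k g, ε i k g) : O.Grp (U (i + 1)) × O.Grp (U i)) • s.ρ i ∈ C.A i := by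
    refine Filter.Eventually.and ?_ ?_
    · rw [Filter.eventually_all]; intro i
      rw [Filter.eventually_all]; intro k
      by_cases h : d.arc k ⊆ c.arc i ∧ (Q i k).Nonempty
      · filter_upwards [(hε i k).eventually (hV' i k h.1 h.2).2] with g hg _ _ using hg
      · exact Filter.Eventually.of_forall fun g h1 h2 => absurd ⟨h1, h2⟩ h
    · rw [Filter.eventually_all]; intro i
      rw [Filter.eventually_all]; intro k
      have := (hε (i + 1) k).prodMk_nhds (hε i k)
      exact this.eventually (eventually_smul_mem (C.isOpen_A i) (hs.2 i))
  obtain ⟨N, hN, hNo, h1N⟩ := eventually_nhds_iff.1 hN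
  -- Among the transition maps only the last needs a condition, namely `g ∈ N`; the normalization
  -- takes care of the others.
  obtain ⟨A, hAo, hσA, hA⟩ : ∃ A : ∀ k, Set (O.Tran (W k) (W (k + 1))), (∀ k, IsOpen (A k)) ∧
      (∀ k, σ.ρ k ∈ A k) ∧ A l = (fun g : O.Grp (W (l + 1)) =>
        ((g, 1) : O.Grp (W (l + 1)) × O.Grp (W l)) • σ.ρ l) '' N := by
    refine ⟨fun k => if h : k = l then h ▸ ((fun g : O.Grp (W (l + 1)) =>
        ((g, 1) : O.Grp (W (l + 1)) × O.Grp (W l)) • σ.ρ l) '' N) else univ, fun k => ?_, fun k => ?_, ?_⟩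
    · by_cases h : k = l
      · subst h; simpa only [dif_pos] using isOpen_left_image hNo _
      · simp only [dif_neg h]; exact isOpen_univ
    · by_cases h : k = l
      · subst h
        simp only [dif_pos]
        exact ⟨1, h1N, one_smul (O.Grp (W (k + 1)) × O.Grp (W k)) (σ.ρ k)⟩
      · simp only [dif_neg h]; trivial
    · simp only [dif_pos]
  let VV : ∀ k, Set (O.Hat (W k)) := fun k => ⋂ i, {z | ∀ h : d.arc k ⊆ c.arc i, (Q i k).Nonempty →
      z ∈ (O.mp (m i k h)).source ∩ O.mp (m i k h) ⁻¹' V' i k}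
  have hVVo : ∀ k, IsOpen (VV k) := by
    intro k
    refine isOpen_iInter_of_finite fun i => ?_
    by_cases h : d.arc k ⊆ c.arc i ∧ (Q i k).Nonempty
    · simp only [h, forall_true_left]
      exact (O.mp (m i k h.1)).isOpen_inter_preimage (hV'o i k)
    · convert isOpen_univ
      exact eq_univ_of_forall fun z h1 h2 => absurd ⟨h1, h2⟩ h
  let D₀ : LoopCond O d W := ⟨fun k => Subtype.val ⁻¹' R k, VV, A, fun k => hpre k (hRd k), hVVo, hAo⟩
  obtain ⟨D, hσD, hD⟩ := σ.exists_cond_normalize D₀ ⟨fun k t ht => by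
    refine mem_iInter.2 fun i h1 h2 => ⟨(hmsrc i k h1 t t.2).1, ?_⟩
    change O.mp (m i k h1) (σ.f k ⟨t, t.2⟩) ∈ V' i k
    rw [(hmsrc i k h1 t t.2).2]
    exact (hV' i k h1 h2).1 t ht _, hσA⟩
  refine ⟨D, hσD, fun τ₀ hτ₀ => ?_⟩
  obtain ⟨τ, hI, hτ, hτρ⟩ := hD τ₀ hτ₀
  suffices ∃ s' : LoopOver O x c U, Nonempty (LoopEqv τ s') ∧ s'.Sat C by
    obtain ⟨s', ⟨F⟩, hs'⟩ := this
    obtain ⟨F'⟩ := hI.eqv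
    exact ⟨s', OrbiLoop.mk_eq_iff.2 ⟨F'.trans F⟩, hs'⟩
  have hl' := hτ.2 l
  change τ.ρ l ∈ A l at hl'
  rw [hA] at hl'
  obtain ⟨g, hgN, hgρ⟩ := hl'
  have hgρ : τ.ρ l = ((g, 1) : O.Grp (W (l + 1)) × O.Grp (W l)) • σ.ρ l := hgρ.symm
  have hρk : ∀ k, k ≠ l → τ.ρ k = σ.ρ k := fun k hk => hτρ k fun h =>
    hk (add_right_cancel (h.trans hl.symm))
  have hρsrc : ∀ k, (O.mp (τ.ρ k)).source = (O.mp (σ.ρ k)).source := by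
    intro k
    by_cases h : k = l
    · subst h; rw [hgρ, source_left]
    · rw [hρk k h]
  -- For `k ≠ 0` the map `m i k` is total. For `k = 0` the piece of the loop is connected and starts
  -- at the base point, which lies in the domain. At other times it lies over some `W k` with `k ≠
  -- 0`, hence over `U i`.
  have hτsrc : ∀ i k h t (hk : t ∈ d.arc k), τ.f k ⟨t, hk⟩ ∈ (O.mp (m i k h)).source := by
    intro i k h t hk
    by_cases hk0 : k = 0
    · subst hk0
      have : PreconnectedSpace (d.arc 0) := isPreconnected_iff_preconnectedSpace.1 (d.isPreconnected_arc 0)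
      have hbase : τ.f 0 ⟨0, d.zero_mem⟩ = σ.f 0 ⟨0, d.zero_mem⟩ :=
        eq_of_heq (Sigma.mk.inj_iff.1 (τ.basePt.trans σ.basePt.symm)).2
      have hp : τ.f 0 ⟨0, d.zero_mem⟩ ∈ (O.mp (m i 0 h)).source := by
        rw [hbase]; exact (hmsrc i 0 h 0 _).1
      refine subset_source_of_proj hp (isPreconnected_range (τ.f 0).continuous) ⟨_, rfl⟩ ?_ ⟨_, rfl⟩
      rintro _ ⟨⟨t, ht⟩, rfl⟩
      by_cases ht0 : t = 0
      · subst ht0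
        exact (base_subset (m i 0 h) (proj_mem_base hp)).2
      · obtain ⟨k, hk, hk0, hki⟩ := hd t
        rw [τ.proj_f_eq ht hk]
        exact hW k i (hk0 ht0) (hki i (h ht)) (Subtype.coe_prop _)
    · rw [hmuniv i k h hk0]; trivial
  obtain ⟨s', F, hF⟩ := τ.exists_glue_const (c' := c) (U' := U) (fun i => {k | d.arc k ⊆ c.arc i})
    (fun i k h => ((ε i k g, (1 : O.Grp (W k))) • m i k h))
    (fun i t ht => by
      obtain ⟨k, hk, -, hk'⟩ := hd t
      exact ⟨k, hk' i ht, hk⟩)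
    (fun i k h t hk _ => by
      rw [source_left]; exact hτsrc i k h t hk)
    (fun i k h h' t hk hk' _ => by
      have h1 := (τ.compat k t hk hk').1
      rw [hρsrc] at h1
      have h2 := hmcomp' i k h h' _ h1
      -- Only the passage from `l` to `l + 1 = 0` involves `g`, and there the correction jumps from
      -- `e i g` to `1`. On every other passage inside the coarse arc the cut is not crossed, so the
      -- correction is constant.
      by_cases hkl : k = l
      · subst hkl
        have h3 : ¬ k < ks i := not_lt.2 (hlmax _)
        have h4 : k + 1 < ks i := by
          rw [hl]
          refine Fin.pos_iff_ne_zero.2 fun h5 => hks i ?_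
          rw [h5, ← hl]; exact h'
        have h5 : ε i k g = (isoExt (m i (k + 1) h') g⁻¹)⁻¹ := by
          have h6 : d.arc (k + 1) ⊆ c.arc i := h'
          simp only [ε, if_neg h3, e, dif_pos h6]
        have h6 : ε i (k + 1) g = 1 := if_pos h4
        rw [h5, h6, show ((1, 1) : O.Grp (U i) × O.Grp (W (k + 1))) • m i (k + 1) h' =
          m i (k + 1) h' from one_smul (O.Grp (U i) × O.Grp (W (k + 1))) _, hgρ]
        refine h2.smul_right g ?_
        rw [← hgρ, (τ.compat k t hk hk').2]
        exact hτsrc i _ h' t hk'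
      · rw [hρk k hkl]
        have h3 : ε i (k + 1) g = ε i k g := by
          have h4 : k + 1 < ks i ↔ k < ks i := by
            rw [Fin.lt_def, Fin.lt_def, hsucc k hkl]
            have h5 : (ks i : ℕ) ≠ k + 1 := fun h5 => hks i (by
              rw [show ks i = k + 1 from Fin.ext (h5.trans (hsucc k hkl).symm)]; exact h')
            omega
          simp only [ε, h4]
        rw [h3]
        exact h2.smul_left _)
    (by
      obtain ⟨k, hk, -, hk'⟩ := hd 0
      have hk0 : k = 0 := by
        by_contra h; exact h0 k h hk
      rw [hk0] at hk'
      exact hk' 0 c.zero_mem)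
    (by
      have hB : d.arc 0 ⊆ c.arc 0 := by
        obtain ⟨k, hk, -, hk'⟩ := hd 0
        have hk0 : k = 0 := by
          by_contra h; exact h0 k h hk
        rw [hk0] at hk'
        exact hk' 0 c.zero_mem
      have h4 : (0 : Fin (d.n + 3)) < ks 0 :=
        Fin.pos_iff_ne_zero.2 fun h5 => hks 0 (by rw [h5]; exact hB)
      have h6 : ε 0 0 g = 1 := if_pos h4
      rw [h6, show ((1, 1) : O.Grp (U 0) × O.Grp (W 0)) • m 0 0 hB =
          m 0 0 hB from one_smul (O.Grp (U 0) × O.Grp (W 0)) _, ← hm 0 0 hB 0 d.zero_mem c.zero_mem,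
          ← (congrArg Sigma.fst σ.basePt : W 0 = x.1)]
      exact E.base.arrow_eq)
  refine ⟨s', ⟨F⟩, ?_, fun i => ?_⟩
  · rintro i ⟨t, hi⟩ ht
    have h1 : t ∈ Subtype.val '' C.K i := ⟨_, ht, rfl⟩
    rw [hQK] at h1
    obtain ⟨k, -, hk⟩ := mem_iUnion₂.1 h1
    obtain ⟨hki, hkd⟩ := hQs i k hk
    have h2 : t ∈ R k := mem_iUnion.2 ⟨i, hk⟩
    have h3 := mem_iInter.1 (hτ.1 k (show (⟨t, hkd⟩ : d.arc k) ∈ D₀.K k from h2)) i hki ⟨t, hk⟩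
    have h4 := Hom.mp_eq (F.m t k i hkd hi)
    rw [hF i k hki] at h4
    have h5 := (mp_left (ε i k g) (m i k hki) h3.1).symm.trans h4
    rw [show s'.f i ⟨t, hi⟩ = ε i k g • O.mp (m i k hki) (τ.f k ⟨t, hkd⟩) from h5.symm]
    exact (hN g hgN).1 i k hki ⟨t, hk⟩ _ h3.2
  · obtain ⟨t, hi, hi', ht0⟩ := c.exists_mem_inter_ne_zero i
    obtain ⟨k, hk, hk0, hki⟩ := hd t
    have h1 := Hom.isComp (E.m t k i hk hi) (s.r i (i + 1) t hi hi')
    rw [E.m_right, LoopOver.r_succ, hm i k (hki i hi), hm (i + 1) k (hki _ hi')] at h1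
    have h2 := Hom.isComp (F.m t k i hk hi) (s'.r i (i + 1) t hi hi')
    rw [F.m_right, LoopOver.r_succ, hF i k (hki i hi), hF (i + 1) k (hki _ hi')] at h2
    have h3 := (h1.of_source_univ (hmuniv _ _ _ (hk0 ht0)) (hτsrc i k (hki i hi) t hk)).smul_smul
      (ε (i + 1) k g) (ε i k g)
    rw [h2.symm_right.unique h3.symm_right]
    exact (hN g hgN).2 i k

end Stability

/-! ### Refinement of systems to prescribed charts -/

section Refine

variable {X Y : Type u} [TopologicalSpace X] [TopologicalSpace Y]
variable {O : Orbispace X} {P : Orbispace Y} {x : O.BasePoint} {y : P.BasePoint}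

open Orbispace

/-- Every element of an orbit may serve as its origin, so continuity at `1` for all origins is
continuity everywhere. -/
theorem Orbispace.continuous_tran_iff {a b : O.basic} {Z : Type*} [TopologicalSpace Z]
    {F : O.Tran a b → Z} : Continuous F ↔
      ∀ t, ContinuousAt (fun h : O.Grp b => F (((h, 1) : O.Grp b × O.Grp a) • t)) 1 := by
  constructor
  · exact fun h t => (h.comp (continuous_left t)).continuousAt
  · intro h
    rw [tranTopology, continuous_iSup_dom]
    intro t
    rw [continuous_coinduced_dom, continuous_iff_continuousAt]
    intro h₀
    have h1 : ContinuousAt (fun k : O.Grp b => k * h₀⁻¹) h₀ := by fun_prop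
    have h2 := h (((h₀, 1) : O.Grp b × O.Grp a) • t)
    rw [← mul_inv_cancel h₀] at h2
    refine (ContinuousAt.comp (f := fun k : O.Grp b => k * h₀⁻¹) h2 h1).congr
      (Filter.Eventually.of_forall fun k => ?_)
    change F (((k * h₀⁻¹, 1) : O.Grp b × O.Grp a) • ((h₀, 1) : O.Grp b × O.Grp a) • t) = F _
    rw [← left_mul, inv_mul_cancel_right]

namespace SystemOver

variable {Λ I : Type u} {src : Λ → O.basic} {tgt : Λ → P.basic} (σ : SystemOver O P src tgt)

theorem proj_smul_f (α : Λ) (g : O.Grp (src α)) (z : O.Hat (src α)) :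
    ((P.chart (tgt α)).proj (σ.f α (g • z)) : Y) = (P.chart (tgt α)).proj (σ.f α z) := by
  have h := σ.onGerm α α (autGerm g z)
  rw [← proj_mp (Hom.mem h)]
  exact congrArg (fun w => ((P.chart (tgt α)).proj w : Y)) (Hom.mp_eq h).symm

variable {θ : I → Λ} {V : I → O.basic} {W : I → P.basic} (ι : ∀ i, O.Tran (V i) (src (θ i)))
  (n : ∀ i, P.Tran (tgt (θ i)) (W i)) (hV : ∀ i, (V i : Set X) ⊆ src (θ i))
  (hn : ∀ i p, σ.f (θ i) (O.mp (ι i) p) ∈ (P.mp (n i)).source)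

/-- The germ of the given transition map at a point of the finer chart. -/
def refineGerm (i : I) (p : O.Hat (V i)) : (⟨V i, p⟩ : O.Pt) ⟶ ⟨src (θ i), O.mp (ι i) p⟩ :=
  germ (ι i) p (by rw [source_univ (hV i)]; trivial)

/-- The map between the finer charts. -/
noncomputable def refineFun (i : I) (p : O.Hat (V i)) : P.Hat (W i) :=
  P.mp (n i) (σ.f (θ i) (O.mp (ι i) p))

/-- The germ of the given transition map of the target. -/
def refineGerm' (i : I) (p : O.Hat (V i)) :
    (⟨tgt (θ i), σ.f (θ i) (O.mp (ι i) p)⟩ : P.Pt) ⟶ ⟨W i, σ.refineFun ι n i p⟩ :=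
  germ (n i) _ (hn i p)

/-- The action on germs of the induced system over finer charts. -/
noncomputable def refineOnGerm (i j : I) {p : O.Hat (V i)} {q : O.Hat (V j)}
    (e : (⟨V i, p⟩ : O.Pt) ⟶ ⟨V j, q⟩) :
    (⟨W i, σ.refineFun ι n i p⟩ : P.Pt) ⟶ ⟨W j, σ.refineFun ι n j q⟩ :=
  Groupoid.inv (σ.refineGerm' ι n hn i p) ≫
    σ.onGerm (θ i) (θ j) (Groupoid.inv (refineGerm ι hV i p) ≫ e ≫ refineGerm ι hV j q) ≫
      σ.refineGerm' ι n hn j q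

theorem refineOnGerm_comp {i j k : I} {p : O.Hat (V i)} {q : O.Hat (V j)} {r : O.Hat (V k)}
    (e : (⟨V i, p⟩ : O.Pt) ⟶ ⟨V j, q⟩) (e' : (⟨V j, q⟩ : O.Pt) ⟶ ⟨V k, r⟩) :
    σ.refineOnGerm ι n hV hn i k (e ≫ e') =
      σ.refineOnGerm ι n hV hn i j e ≫ σ.refineOnGerm ι n hV hn j k e' := by
  have h : Groupoid.inv (refineGerm ι hV i p) ≫ (e ≫ e') ≫ refineGerm ι hV k r =
      (Groupoid.inv (refineGerm ι hV i p) ≫ e ≫ refineGerm ι hV j q) ≫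
        Groupoid.inv (refineGerm ι hV j q) ≫ e' ≫ refineGerm ι hV k r := by simp
  rw [refineOnGerm, h, onGerm_comp]
  simp [refineOnGerm]

/-- The conjugate of a transition map, as an iterated composition. -/
theorem exists_refineOnGerm {i j : I} {p : O.Hat (V i)} {q : O.Hat (V j)}
    (e : (⟨V i, p⟩ : O.Pt) ⟶ ⟨V j, q⟩) : ∃ a b r,
      O.IsComp e.1 (inv (ι i)) (O.mp (ι i) p) a ∧ O.IsComp (ι j) a (O.mp (ι i) p) b ∧
      P.IsComp (σ.ρ _ _ b) (inv (n i)) (σ.refineFun ι n i p) r ∧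
      P.IsComp (n j) r (σ.refineFun ι n i p) (σ.refineOnGerm ι n hV hn i j e).1 := by
  have h1 := Hom.isComp (Groupoid.inv (refineGerm ι hV i p)) e
  have h2 := Hom.isComp (Groupoid.inv (refineGerm ι hV i p) ≫ e) (refineGerm ι hV j q)
  rw [Category.assoc] at h2
  have h3 := Hom.isComp (Groupoid.inv (σ.refineGerm' ι n hn i p))
    (σ.onGerm (θ i) (θ j) (Groupoid.inv (refineGerm ι hV i p) ≫ e ≫ refineGerm ι hV j q))
  have h4 := Hom.isComp (Groupoid.inv (σ.refineGerm' ι n hn i p) ≫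
    σ.onGerm (θ i) (θ j) (Groupoid.inv (refineGerm ι hV i p) ≫ e ≫ refineGerm ι hV j q))
    (σ.refineGerm' ι n hn j q)
  rw [Category.assoc] at h4
  exact ⟨_, _, _, h1, h2, h3, h4⟩

/-- The conjugated transition map is an iterated composition, hence locally constant along the
connected domain of the given transition map. -/
theorem refineOnGerm_val_unique {i j : I} {p p' : O.Hat (V i)} {q q' : O.Hat (V j)}
    (e : (⟨V i, p⟩ : O.Pt) ⟶ ⟨V j, q⟩) (e' : (⟨V i, p'⟩ : O.Pt) ⟶ ⟨V j, q'⟩) (h : e.1 = e'.1) :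
    (σ.refineOnGerm ι n hV hn i j e).1 = (σ.refineOnGerm ι n hV hn i j e').1 := by
  have aux : ∀ (t : O.Tran (V i) (V j)) (p : O.Hat (V i)) (q : O.Hat (V j))
      (h1 : p ∈ (O.mp t).source) (h2 : O.mp t p = q),
      (σ.refineOnGerm ι n hV hn i j (⟨t, h1, h2⟩ : (⟨V i, p⟩ : O.Pt) ⟶ ⟨V j, q⟩)).1 =
        (σ.refineOnGerm ι n hV hn i j (germ t p h1)).1 := by
    rintro t p q h1 rfl; rfl
  suffices ∀ (t : O.Tran (V i) (V j)) p p' (h1 : p ∈ (O.mp t).source) (h1' : p' ∈ (O.mp t).source),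
      (σ.refineOnGerm ι n hV hn i j (germ t p h1)).1 =
        (σ.refineOnGerm ι n hV hn i j (germ t p' h1')).1 by
    obtain ⟨t, h1, h2⟩ := e
    obtain ⟨t', h1', h2'⟩ := e'
    obtain rfl : t = t' := h
    exact (aux t p q h1 h2).trans ((this t p p' h1 h1').trans (aux t p' q' h1' h2').symm)
  intro t p p' h1 h1'
  have hs : PreconnectedSpace (O.mp t).source :=
    isPreconnected_iff_preconnectedSpace.1 (isPreconnected_source t)
  have hιc : Continuous fun p : O.Hat (V i) => O.mp (ι i) p := by
    have := (O.mp (ι i)).continuousOn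
    rwa [source_univ (hV i), continuousOn_univ] at this
  have hfc : Continuous fun p : O.Hat (V i) => σ.refineFun ι n i p :=
    (P.mp (n i)).continuousOn.comp_continuous ((σ.f (θ i)).continuous.comp hιc) (hn i)
  have key : IsLocallyConstant (Y := P.Tran (W i) (W j)) fun p : (O.mp t).source =>
      ((σ.refineOnGerm ι n hV hn i j (germ t p p.2)).1 : P.Tran (W i) (W j)) := by
    choose a b r ha hb hr hc using fun p : (O.mp t).source =>
      σ.exists_refineOnGerm ι n hV hn (germ t p p.2)
    have ca := isLocallyConstant_comp (v := fun p : (O.mp t).source => O.mp (ι i) p)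
      (I := fun _ => inv (ι i)) (J := fun _ => t)
      (hιc.comp continuous_subtype_val) (IsLocallyConstant.const _) (IsLocallyConstant.const _) ha
    have cb := isLocallyConstant_comp (v := fun p : (O.mp t).source => O.mp (ι i) p)
      (J := fun _ => ι j)
      (hιc.comp continuous_subtype_val) ca (IsLocallyConstant.const _) hb
    have cr := isLocallyConstant_comp (v := fun p : (O.mp t).source => σ.refineFun ι n i p)
      (I := fun _ => inv (n i))
      (hfc.comp continuous_subtype_val) (IsLocallyConstant.const _)
      (cb.comp (σ.ρ (θ i) (θ j))) hr
    exact isLocallyConstant_comp (v := fun p : (O.mp t).source => σ.refineFun ι n i p)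
      (J := fun _ => n j)
      (hfc.comp continuous_subtype_val) cr (IsLocallyConstant.const _) hc
  exact key.apply_eq_of_preconnectedSpace ⟨p, h1⟩ ⟨p', h1'⟩

/-- The action on transition maps of the induced system over finer charts. -/
noncomputable def refineρ (i j : I) (t : O.Tran (V i) (V j)) : P.Tran (W i) (W j) :=
  (σ.refineOnGerm ι n hV hn i j (germ t _ (source_nonempty t).some_mem)).1

theorem refineρ_eq {i j : I} {p : O.Hat (V i)} {q : O.Hat (V j)}
    (e : (⟨V i, p⟩ : O.Pt) ⟶ ⟨V j, q⟩) :
    σ.refineρ ι n hV hn i j e.1 = (σ.refineOnGerm ι n hV hn i j e).1 :=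
  σ.refineOnGerm_val_unique ι n hV hn _ _ rfl

/-- Follow a left factor `h` near `1` through the conjugation. It passes through `ι j` by `isoExt`;
continuity of `ρ` and openness of orbit pieces turn it into a left factor `k` near `1`; and this
passes through `n j` by `isoExt`. -/
theorem continuous_refineρ (i j : I) : Continuous (σ.refineρ ι n hV hn i j) := by
  rw [continuous_tran_iff]
  intro t
  obtain ⟨p, hp⟩ := source_nonempty t
  have h1 : ∀ h : O.Grp (V j), p ∈ (O.mp (((h, 1) : O.Grp (V j) × O.Grp (V i)) • t)).source :=
    fun h => by rw [source_left]; exact hp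
  obtain ⟨a, b, r, ha, hb, hr, hc⟩ := σ.exists_refineOnGerm ι n hV hn (germ t p hp)
  have key : ∀ (h : O.Grp (V j)) (k : P.Grp (tgt (θ j))),
      σ.ρ (θ i) (θ j) ((((isoExt (ι j) h⁻¹)⁻¹, 1) : O.Grp (src (θ j)) × O.Grp (src (θ i))) • b) =
        ((k, 1) : P.Grp (tgt (θ j)) × P.Grp (tgt (θ i))) • σ.ρ (θ i) (θ j) b →
      σ.refineρ ι n hV hn i j (((h, 1) : O.Grp (V j) × O.Grp (V i)) • t) =
        (((isoExt (n j) k⁻¹)⁻¹, 1) : P.Grp (W j) × P.Grp (W i)) • σ.refineρ ι n hV hn i j t := by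
    intro h k hk
    obtain ⟨a', b', r', ha', hb', hr', hc'⟩ := σ.exists_refineOnGerm ι n hV hn (germ _ p (h1 h))
    obtain rfl := ha'.unique (ha.smul_left h)
    obtain rfl := hb'.unique (hb.smul_right h hb'.2.1)
    rw [hk] at hr'
    obtain rfl := hr'.unique (hr.smul_left k)
    have h2 := hc'.unique (hc.smul_right k hc'.2.1)
    rw [← refineρ_eq, ← refineρ_eq] at h2
    exact h2
  have hinv : ∀ {Q : Type u} [TopologicalSpace Q] (R : Orbispace Q) {c d : R.basic} (m : R.Tran c d),
      Filter.Tendsto (fun k : R.Grp c => (isoExt m k⁻¹)⁻¹) (𝓝 1) (𝓝 1) := by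
    intro Q _ R c d m
    have h1 : Filter.Tendsto (fun g : R.Grp c => g⁻¹) (𝓝 1) (𝓝 1) := by
      have := (continuous_inv (G := R.Grp c)).tendsto 1
      rwa [inv_one] at this
    have h2 := continuousAt_isoExt m
    rw [ContinuousAt, isoExt_one] at h2
    have h3 := (h2.comp h1).inv
    rwa [inv_one] at h3
  intro A hA
  change A ∈ 𝓝 (σ.refineρ ι n hV hn i j (((1, 1) : O.Grp (V j) × O.Grp (V i)) • t)) at hA
  rw [show ((1, 1) : O.Grp (V j) × O.Grp (V i)) • t = t from one_smul (O.Grp (V j) × O.Grp (V i)) t] at hA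
  have h2 : ∀ᶠ k in 𝓝 (1 : P.Grp (tgt (θ j))), (((isoExt (n j) k⁻¹)⁻¹, 1) :
      P.Grp (W j) × P.Grp (W i)) • σ.refineρ ι n hV hn i j t ∈ A := by
    have h3 := (continuous_left (σ.refineρ ι n hV hn i j t)).tendsto 1
    rw [show ((1, 1) : P.Grp (W j) × P.Grp (W i)) • σ.refineρ ι n hV hn i j t =
      σ.refineρ ι n hV hn i j t from one_smul (P.Grp (W j) × P.Grp (W i)) _] at h3
    exact (h3.comp (hinv P (n j))).eventually hA
  obtain ⟨N, hN, hNo, h1N⟩ := eventually_nhds_iff.1 h2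
  have h3 : ∀ᶠ h in 𝓝 (1 : O.Grp (V j)), σ.ρ (θ i) (θ j)
      ((((isoExt (ι j) h⁻¹)⁻¹, 1) : O.Grp (src (θ j)) × O.Grp (src (θ i))) • b) ∈
      (fun k : P.Grp (tgt (θ j)) => ((k, 1) : P.Grp (tgt (θ j)) × P.Grp (tgt (θ i))) •
        σ.ρ (θ i) (θ j) b) '' N := by
    have h4 := ((σ.ρ (θ i) (θ j)).continuous.comp (continuous_left b)).tendsto 1
    refine (h4.comp (hinv O (ι j))).eventually ((isOpen_left_image hNo _).mem_nhds ⟨1, h1N, ?_⟩)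
    change _ = σ.ρ (θ i) (θ j) (((1, 1) : O.Grp (src (θ j)) × O.Grp (src (θ i))) • b)
    rw [show ((1, 1) : O.Grp (src (θ j)) × O.Grp (src (θ i))) • b = b from
      one_smul (O.Grp (src (θ j)) × O.Grp (src (θ i))) b]
    exact one_smul (P.Grp (tgt (θ j)) × P.Grp (tgt (θ i))) _
  change ∀ᶠ h in 𝓝 (1 : O.Grp (V j)),
    σ.refineρ ι n hV hn i j (((h, 1) : O.Grp (V j) × O.Grp (V i)) • t) ∈ A
  filter_upwards [h3] with h hh
  obtain ⟨k, hk, hk'⟩ := hh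
  rw [key h k hk'.symm]
  exact hN k hk

/-- The system induced over finer charts. -/
noncomputable def refine : SystemOver O P V W where
  f i := ⟨σ.refineFun ι n i, by
    have hιc : Continuous fun p : O.Hat (V i) => O.mp (ι i) p := by
      have := (O.mp (ι i)).continuousOn
      rwa [source_univ (hV i), continuousOn_univ] at this
    exact (P.mp (n i)).continuousOn.comp_continuous ((σ.f (θ i)).continuous.comp hιc) (hn i)⟩
  ρ i j := ⟨σ.refineρ ι n hV hn i j, σ.continuous_refineρ ι n hV hn i j⟩
  map_mem {i j} t p hp := by
    have := Hom.mem (σ.refineOnGerm ι n hV hn i j (germ t p hp))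
    rw [← refineρ_eq] at this
    exact this
  map_eq {i j} t p hp := by
    have := Hom.mp_eq (σ.refineOnGerm ι n hV hn i j (germ t p hp))
    rw [← refineρ_eq] at this
    exact this
  map_comp {i j k} t' t p hp hp' := by
    have h1 := Hom.isComp (σ.refineOnGerm ι n hV hn i j (germ t p hp))
      (σ.refineOnGerm ι n hV hn j k (germ t' _ hp'))
    rw [← refineOnGerm_comp, ← refineρ_eq, ← refineρ_eq, ← refineρ_eq] at h1
    obtain ⟨_, _, h2⟩ := h1
    exact h2.symm

end SystemOver

namespace BasedSystem

theorem IsRefinement.refl (τ : BasedSystem O x P y) : τ.IsRefinement τ := by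
  refine ⟨fun i => i, fun i => O.one _, fun i => P.one _, rfl, rfl, rfl, fun _ => subset_rfl,
    fun i p => ⟨mem_source_one _, ?_⟩, fun i j a p hp b c h1 h2 => ?_⟩
  · rw [one_mp, one_mp]
  · obtain rfl := h1.unique (isComp_one_left a hp)
    obtain rfl := h2.unique (isComp_one_right b (by
      have := h2.2.1; rwa [one_mp] at this))
    exact ⟨_, isComp_one_left _ (τ.sys.map_mem _ _ hp), isComp_one_right _ (τ.sys.map_mem _ _ hp)⟩

theorem Isomorphic.refl (τ : BasedSystem O x P y) : Isomorphic τ τ := by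
  obtain ⟨Λ, src, tgt, o, cover, sys, hs⟩ := τ
  exact ⟨cover, sys, sys, hs, hs, fun _ => 1, rfl, fun α z => (one_smul _ _).symm, fun α β t =>
    (one_smul (P.Grp (tgt β) × P.Grp (tgt α)) (sys.ρ α β t)).symm⟩

theorem IsRefinement.mk_eq {τ' τ : BasedSystem O x P y} (h : τ'.IsRefinement τ) :
    BasedMor.mk τ' = BasedMor.mk τ :=
  Quot.sound ⟨τ', τ', IsRefinement.refl τ', h, Isomorphic.refl τ'⟩

/-- A system can be refined to prescribed charts. -/
theorem exists_refinement (τ : BasedSystem O x P y) {I : Type u} (θ : I → τ.Λ) (V : I → O.basic)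
    (W : I → P.basic) (ι : ∀ i, O.Tran (V i) (τ.src (θ i))) (n : ∀ i, P.Tran (τ.tgt (θ i)) (W i))
    (hV : ∀ i, (V i : Set X) ⊆ τ.src (θ i))
    (hn : ∀ i p, τ.sys.f (θ i) (O.mp (ι i) p) ∈ (P.mp (n i)).source)
    (cover : ∀ p : X, ∃ i, p ∈ (V i : Set X)) (o : I) (ho : θ o = τ.o)
    (hι : O.arrow (ι o) = O.arrow (O.one x.1)) (hn0 : P.arrow (n o) = P.arrow (P.one y.1)) :
    ∃ (s : SystemOver O P V W) (hs : ∃ z : O.Hat (V o), (⟨V o, z⟩ : O.BasePoint) = x ∧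
      (⟨W o, s.f o z⟩ : P.BasePoint) = y), BasedMor.mk ⟨I, V, W, o, cover, s, hs⟩ = BasedMor.mk τ := by
  let s := τ.sys.refine ι n hV hn
  have hVO : V o = x.1 := congrArg Sigma.fst hι
  have hs : ∃ z : O.Hat (V o), (⟨V o, z⟩ : O.BasePoint) = x ∧ (⟨W o, s.f o z⟩ : P.BasePoint) = y := by
    obtain ⟨z, hz⟩ : ∃ z : O.Hat (V o), (⟨V o, z⟩ : O.BasePoint) = x := by
      generalize V o = a at hVO ⊢
      subst hVO
      exact ⟨x.2, rfl⟩
    refine ⟨z, hz, ?_⟩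
    obtain ⟨h1, -⟩ := isTriv_of_arrow_eq (e := SystemOver.refineGerm ι hV o z) hι
    obtain ⟨h2, -⟩ := isTriv_of_arrow_eq (e := τ.sys.refineGerm' ι n hn o z) hn0
    injection h1 with h1 h1'
    injection h2 with h2 h2'
    have h3 : (⟨τ.src (θ o), O.mp (ι o) z⟩ : O.BasePoint) = x := (Sigma.ext h1 h1').symm.trans hz
    exact (Sigma.ext h2 h2').symm.trans (τ.map_base (θ o) ho _ h3)
  -- The target maps of a refinement run from the finer chart to the old one, so the inverses of the
  -- `n i` are required.
  refine ⟨s, hs, IsRefinement.mk_eq ⟨θ, ι, fun i => inv (n i), ho, ?_, ?_, hV, ?_, ?_⟩⟩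
  · change O.arrow (ι o) = O.arrow (O.one (V o))
    rw [hι, hVO]
  · obtain ⟨z, -⟩ := hs
    have h1 := isTriv_of_arrow_eq (e := τ.sys.refineGerm' ι n hn o z) hn0
    exact h1.inv.arrow_eq
  · intro i p
    exact ⟨mem_source_inv (hn i p), mp_inv_mp (hn i p)⟩
  · intro i j a p hp b c h1 h2
    let e : (⟨V i, p⟩ : O.Pt) ⟶ ⟨V j, O.mp a p⟩ := germ a p hp
    have h3 := Hom.isComp (τ.sys.refineOnGerm ι n hV hn i j e)
      (Groupoid.inv (τ.sys.refineGerm' ι n hn j (O.mp a p)))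
    have h4 := Hom.isComp (Groupoid.inv (τ.sys.refineGerm' ι n hn i p)) (τ.sys.onGerm (θ i) (θ j)
      (Groupoid.inv (SystemOver.refineGerm ι hV i p) ≫ e ≫ SystemOver.refineGerm ι hV j (O.mp a p)))
    have h5 : τ.sys.refineOnGerm ι n hV hn i j e ≫
        Groupoid.inv (τ.sys.refineGerm' ι n hn j (O.mp a p)) =
        Groupoid.inv (τ.sys.refineGerm' ι n hn i p) ≫ τ.sys.onGerm (θ i) (θ j)
          (Groupoid.inv (SystemOver.refineGerm ι hV i p) ≫ e ≫
            SystemOver.refineGerm ι hV j (O.mp a p)) := by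
      simp [SystemOver.refineOnGerm]
    have h6 := Hom.isComp e (SystemOver.refineGerm ι hV j (O.mp a p))
    have h7 := Hom.isComp (Groupoid.inv (SystemOver.refineGerm ι hV i p))
      (e ≫ SystemOver.refineGerm ι hV j (O.mp a p))
    obtain rfl := h1.unique h6
    obtain rfl := h2.symm_right.unique h7
    rw [← h5] at h4
    refine ⟨_, ?_, h4⟩
    rw [← SystemOver.refineρ_eq] at h3
    exact h3

end BasedSystem

end Refine

/-! ### Continuity of the composition of loops with morphisms -/

section Continuity

variable {X Y : Type u} [TopologicalSpace X] [TopologicalSpace Y]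
variable {O : Orbispace X} {P : Orbispace Y} {x : O.BasePoint} {y : P.BasePoint}

open Orbispace

theorem Orbispace.isOpen_image_proj {a : O.basic} {S : Set (O.Hat a)} (hS : IsOpen S) :
    IsOpen ((fun z => ((O.chart a).proj z : X)) '' S) := by
  have h1 : IsOpen ((O.chart a).proj '' S) := by
    rw [← (O.chart a).isQuotientMap.isOpen_preimage]
    have : (O.chart a).proj ⁻¹' ((O.chart a).proj '' S) = ⋃ g : O.Grp a, g • S := by
      ext z
      rw [mem_iUnion]
      constructor
      · rintro ⟨w, hw, e⟩
        obtain ⟨g, rfl⟩ := ((O.chart a).proj_eq_iff w z).1 e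
        exact ⟨g, smul_mem_smul_set hw⟩
      · rintro ⟨g, w, hw, rfl⟩
        exact ⟨w, hw, (proj_smul g w).symm⟩
    rw [this]
    exact isOpen_iUnion fun g => hS.smul g
  have h2 := (isOpen_basic a).isOpenMap_subtype_val _ h1
  rwa [image_image] at h2

/-- Take for `W` the component of `G` below the image of `z`, and for `V` the projection of the
component around `z` of the points mapped over `W`. Every point over `V` is a translate of a point
of the latter component, and its image has the same projection as that of the translate. Hence `f`
maps the domain of `j` over `W`, and connectedness places the image in the domain of `n`. -/
theorem BasedSystem.exists_chart_data (τ : BasedSystem O x P y) (α : τ.Λ) (z : O.Hat (τ.src α))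
    (G : Set Y) (hG : IsOpen G) (hGt : G ⊆ τ.tgt α) (C : Set (O.Hat (τ.src α)))
    (hC : IsPreconnected C) (hz : z ∈ C)
    (hCG : ∀ w ∈ C, ((P.chart (τ.tgt α)).proj (τ.sys.f α w) : Y) ∈ G) :
    ∃ (V : O.basic) (W : P.basic) (ι : O.Tran V (τ.src α)) (j : O.Tran (τ.src α) V)
      (n : P.Tran (τ.tgt α) W), (V : Set X) ⊆ τ.src α ∧ (W : Set Y) ⊆ G ∧
      (∀ p, τ.sys.f α (O.mp ι p) ∈ (P.mp n).source) ∧ C ⊆ (O.mp j).source := by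
  have := P.locallyConnectedSpace
  set q := ((P.chart (τ.tgt α)).proj (τ.sys.f α z) : Y) with hq
  have hqG : q ∈ G := hCG z hz
  have hWo : IsOpen (connectedComponentIn G q) := hG.connectedComponentIn
  let W : P.basic := ⟨connectedComponentIn G q, P.mem_of_subset _ (τ.tgt α).2 _
    ((connectedComponentIn_subset _ _).trans hGt) hWo
    ⟨⟨q, mem_connectedComponentIn hqG⟩, isPreconnected_connectedComponentIn⟩⟩
  have hfc : Continuous fun w => ((P.chart (τ.tgt α)).proj (τ.sys.f α w) : Y) :=
    (continuous_proj _).comp (τ.sys.f α).continuous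
  set D : Set (O.Hat (τ.src α)) := (fun w => ((P.chart (τ.tgt α)).proj (τ.sys.f α w) : Y)) ⁻¹'
    connectedComponentIn G q
  have hD : IsOpen D := hWo.preimage hfc
  have hzD : z ∈ D := mem_connectedComponentIn hqG
  have hCD : C ⊆ connectedComponentIn D z := by
    refine hC.subset_connectedComponentIn hz fun w hw => ?_
    refine (hC.image _ hfc.continuousOn).subset_connectedComponentIn (mem_image_of_mem _ hz) ?_
      (mem_image_of_mem _ hw)
    rintro _ ⟨v, hv, rfl⟩
    exact hCG v hv
  let V : O.basic := ⟨(fun w => ((O.chart (τ.src α)).proj w : X)) '' connectedComponentIn D z,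
    O.mem_of_subset _ (τ.src α).2 _ (by rintro _ ⟨w, -, rfl⟩; exact Subtype.coe_prop _)
      (isOpen_image_proj hD.connectedComponentIn)
      ⟨⟨_, mem_image_of_mem _ (mem_connectedComponentIn hzD)⟩,
        isPreconnected_connectedComponentIn.image _ (continuous_proj _).continuousOn⟩⟩
  have hV : (V : Set X) ⊆ τ.src α := by rintro _ ⟨w, -, rfl⟩; exact Subtype.coe_prop _
  obtain ⟨j, hj⟩ := exists_tran (τ.src α) V z ⟨z, mem_connectedComponentIn hzD, rfl⟩
  obtain ⟨n, hn⟩ := exists_tran (τ.tgt α) W (τ.sys.f α z) (mem_connectedComponentIn hqG)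
  have h1 : τ.sys.f α '' (O.mp j).source ⊆ (P.mp n).source := by
    refine subset_source_of_proj hn ((isPreconnected_source j).image _
      (τ.sys.f α).continuous.continuousOn) (mem_image_of_mem _ hj) ?_
    rintro _ ⟨w, hw, rfl⟩
    obtain ⟨w', hw', e⟩ := (base_subset j (proj_mem_base hw)).2
    obtain ⟨g, rfl⟩ := ((O.chart (τ.src α)).proj_eq_iff w' w).1 (Subtype.ext e)
    rw [SystemOver.proj_smul_f]
    exact connectedComponentIn_subset D z hw'
  refine ⟨V, W, inv j, j, n, hV, connectedComponentIn_subset _ _, fun p => h1 ⟨_, ?_, rfl⟩, ?_⟩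
  · have hp : p ∈ (O.mp (inv j)).source := by rw [source_univ hV]; trivial
    have := mem_source_inv hp
    rwa [Orbispace.inv_inv] at this
  · refine subset_source_of_proj hj hC hz fun w hw => ⟨w, hCD hw, rfl⟩

/-- The conditions on a loop which ensure given conditions on its image. -/
def LoopCond.pull {d : ArcCover} (τ : BasedSystem O x P y) (κ : Fin (d.n + 3) → τ.Λ)
    (D : LoopCond P d fun k => τ.tgt (κ k)) : LoopCond O d fun k => τ.src (κ k) where
  K := D.K
  V k := τ.sys.f (κ k) ⁻¹' D.V k
  A k := τ.sys.ρ (κ k) (κ (k + 1)) ⁻¹' D.A k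
  isCompact_K := D.isCompact_K
  isOpen_V k := (D.isOpen_V k).preimage (τ.sys.f (κ k)).continuous
  isOpen_A k := (D.isOpen_A k).preimage (τ.sys.ρ (κ k) (κ (k + 1))).continuous

namespace OrbiLoop

/-- The image of a loop lies in a basic open set as soon as the composition of some representatives
satisfies suitable conditions. -/
theorem exists_system_cond (f : BasedMor O x P y) (γ : OrbiLoop O x) {c : ArcCover}
    {U : Fin (c.n + 3) → P.basic} (C : LoopCond P c U) {s : LoopOver P y c U} (hs : s.Sat C)
    (hγ : map f γ = mk ⟨c, U, s⟩) :
    ∃ (τ : BasedSystem O x P y) (d : ArcCover) (κ : Fin (d.n + 3) → τ.Λ) (h0 : κ 0 = τ.o)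
      (σ : LoopOver O x d fun k => τ.src (κ k)) (D : LoopCond P d fun k => τ.tgt (κ k)),
      f = BasedMor.mk τ ∧ γ = mk ⟨d, _, σ⟩ ∧ Function.Injective κ ∧ (σ.comp τ κ h0).Sat D ∧
      ∀ ξ : LoopOver P y d fun k => τ.tgt (κ k), ξ.Sat D →
        ∃ s' : LoopOver P y c U, mk ⟨d, _, ξ⟩ = mk ⟨c, U, s'⟩ ∧ s'.Sat C := by
  classical
  obtain ⟨τ, rfl⟩ := Quot.exists_rep f
  change map (BasedMor.mk τ) γ = _ at hγ
  obtain ⟨c₁, κ₁, h₁, s₁, rfl⟩ := τ.exists_rep γ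
  have hi : ∀ t, ∃ i, t ∈ c₁.arc i ∧ (t = 0 → i = 0) := fun t => by
    by_cases h : t = 0
    · exact ⟨0, by rw [h]; exact c₁.zero_mem, fun _ => rfl⟩
    · obtain ⟨i, hi⟩ := c₁.exists_mem_arc t
      exact ⟨i, hi, fun h' => absurd h' h⟩
  choose i hi hi0 using hi
  -- The neighbourhoods ensure that a fine arc meeting `C.K j` is centred at a time of `C.K j`, and
  -- hence is mapped entirely into `C.V j`.
  obtain ⟨d, w, σ, ⟨E₁⟩, hw, hw0, hd0, hd⟩ := s₁.exists_rechart_fine c (fun t => τ.src (κ₁ (i t)))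
    (fun t j hj => by rw [s₁.proj_f_eq hj (hi t)]; exact Subtype.coe_prop _)
    (by rw [hi0 0 rfl]; exact congrArg Sigma.fst s₁.basePt)
    (fun t => ⋂ j, {u | ((∃ h, ⟨t, h⟩ ∈ C.K j) → ∃ h : u ∈ c.arc j, s.f j ⟨u, h⟩ ∈ C.V j) ∧
      ((¬ ∃ h, ⟨t, h⟩ ∈ C.K j) → ¬ ∃ h, ⟨u, h⟩ ∈ C.K j)})
    (fun t => Filter.iInter_mem.2 fun j => by
      by_cases h : ∃ h, ⟨t, h⟩ ∈ C.K j
      · obtain ⟨ht, hK⟩ := h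
        have h2 := (s.f j).continuous.continuousAt.preimage_mem_nhds
          ((C.isOpen_V j).mem_nhds (hs.1 j hK))
        rw [nhds_subtype_eq_comap, Filter.mem_comap] at h2
        obtain ⟨N, hN, hN'⟩ := h2
        filter_upwards [hN, (c.isOpen_arc j).mem_nhds ht] with u hu hu'
        exact ⟨fun _ => ⟨hu', hN' (show (⟨u, hu'⟩ : c.arc j) ∈ Subtype.val ⁻¹' N from hu)⟩,
          fun h => absurd ⟨ht, hK⟩ h⟩
      · have h2 : IsClosed (Subtype.val '' C.K j) :=
          ((C.isCompact_K j).image continuous_subtype_val).isClosed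
        have h3 : t ∉ Subtype.val '' C.K j := by
          rintro ⟨⟨u, hu⟩, hu', rfl⟩
          exact h ⟨hu, hu'⟩
        filter_upwards [h2.isOpen_compl.mem_nhds h3] with u hu
        exact ⟨fun h' => absurd h' h, fun _ ⟨h', h''⟩ => hu ⟨_, h'', rfl⟩⟩)
  set κ : Fin (d.n + 3) → τ.Λ := fun k => κ₁ (i (w k)) with hκ
  have h0 : κ 0 = τ.o := by
    simp only [hκ]; rw [hi0 _ hw0]; exact h₁
  have hγ' : mk ⟨c₁, _, s₁⟩ = mk ⟨d, fun k => τ.src (κ k), σ⟩ := mk_eq_iff.2 ⟨E₁⟩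
  rw [hγ', map_mk_mk τ κ h0 σ] at hγ
  obtain ⟨E₀⟩ := mk_eq_iff.1 hγ
  have hq : ∀ t k j (hk : t ∈ d.arc k) (hj : t ∈ c.arc j),
      ((P.chart (τ.tgt (κ k))).proj (τ.sys.f (κ k) (σ.f k ⟨t, hk⟩)) : Y) =
        (P.chart (U j)).proj (s.f j ⟨t, hj⟩) := by
    intro t k j hk hj
    have h1 := proj_mp (Hom.mem (E₀.m t k j hk hj))
    have h2 := Hom.mp_eq (E₀.m t k j hk hj)
    rw [h2] at h1
    exact h1.symm
  -- The target charts must become small enough to lie in the charts `U j`. The base charts are left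
  -- unchanged, since transition maps at the base index have to be identities.
  have data : ∀ k, ∃ (V : O.basic) (W : P.basic) (ι : O.Tran V (τ.src (κ k)))
      (j : O.Tran (τ.src (κ k)) V) (n : P.Tran (τ.tgt (κ k)) W), (V : Set X) ⊆ τ.src (κ k) ∧
      (k ≠ 0 → ∀ j, d.arc k ⊆ c.arc j → (W : Set Y) ⊆ U j) ∧
      (∀ p, τ.sys.f (κ k) (O.mp ι p) ∈ (P.mp n).source) ∧
      (∀ t (h : t ∈ d.arc k), σ.f k ⟨t, h⟩ ∈ (O.mp j).source) ∧
      (k = 0 → O.arrow ι = O.arrow (O.one x.1) ∧ O.arrow j = O.arrow (O.one x.1) ∧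
        P.arrow n = P.arrow (P.one y.1)) := by
    intro k
    by_cases hk : k = 0
    · subst hk
      have hx : τ.src (κ 0) = x.1 := congrArg Sigma.fst σ.basePt
      have hy : τ.tgt (κ 0) = y.1 := congrArg Sigma.fst (σ.comp τ κ h0).basePt
      exact ⟨_, _, O.one _, O.one _, P.one _, subset_rfl, fun h => absurd rfl h,
        fun p => mem_source_one _, fun t h => mem_source_one _, fun _ => by rw [hx, hy]; simp⟩
    · obtain ⟨t₀, ht₀⟩ := d.arc_nonempty k
      have : PreconnectedSpace (d.arc k) := isPreconnected_iff_preconnectedSpace.1 (d.isPreconnected_arc k)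
      obtain ⟨V, W, ι, j, n, h1, h2, h3, h4⟩ := τ.exists_chart_data (κ k) (σ.f k ⟨t₀, ht₀⟩)
        ((τ.tgt (κ k) : Set Y) ∩ ⋂ j, {q | d.arc k ⊆ c.arc j → q ∈ (U j : Set Y)})
        ((isOpen_basic _).inter (isOpen_iInter_of_finite fun j => by
          by_cases h : d.arc k ⊆ c.arc j
          · simpa only [h, forall_true_left, ofPred_mem_eq] using isOpen_basic (U j)
          · simp only [h, false_imp_iff]; exact isOpen_univ)) inter_subset_left
        (range (σ.f k)) (isPreconnected_range (σ.f k).continuous) ⟨_, rfl⟩ (by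
          rintro _ ⟨⟨t, ht⟩, rfl⟩
          refine ⟨Subtype.coe_prop _, mem_iInter.2 fun j hj => ?_⟩
          rw [hq t k j ht (hj ht)]
          exact Subtype.coe_prop _)
      exact ⟨V, W, ι, j, n, h1, fun _ j hj q hq => mem_iInter.1 (h2 hq).2 j hj, h3,
        fun t h => h4 ⟨_, rfl⟩, fun h => absurd h hk⟩
  choose V W ι j n hV hW hn hj hbase using data
  -- Each fine arc gets its own index, which makes `κ'` injective. The old indices are kept so that
  -- the charts still cover the space.
  let I : Type u := ULift (Fin (d.n + 3)) ⊕ τ.Λ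
  let θ : I → τ.Λ := Sum.elim (fun k => κ k.down) fun α => α
  let V' : I → O.basic := Sum.elim (fun k => V k.down) τ.src
  let W' : I → P.basic := Sum.elim (fun k => W k.down) τ.tgt
  let ι' : ∀ i, O.Tran (V' i) (τ.src (θ i)) := fun i => match i with
    | Sum.inl k => ι k.down
    | Sum.inr α => O.one _
  let n' : ∀ i, P.Tran (τ.tgt (θ i)) (W' i) := fun i => match i with
    | Sum.inl k => n k.down
    | Sum.inr α => P.one _
  obtain ⟨S, hS, hSτ⟩ := τ.exists_refinement θ V' W' ι' n'
    (by rintro (k | α); exacts [hV k.down, subset_rfl])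
    (by rintro (k | α) p; exacts [hn k.down p, mem_source_one _])
    (fun p => (τ.cover p).imp' Sum.inr fun α h => h) (Sum.inl ⟨0⟩) h0 (hbase 0 rfl).1 (hbase 0 rfl).2.2
  set τ' : BasedSystem O x P y := ⟨I, V', W', Sum.inl ⟨0⟩, _, S, hS⟩ with hτ'
  obtain ⟨σ', E', -⟩ := σ.exists_rechart (c' := d) (U' := V) (fun k => k) (fun k => subset_rfl) rfl
    j hj (hbase 0 rfl).2.1
  let κ' : Fin (d.n + 3) → τ'.Λ := fun k => Sum.inl ⟨k⟩
  have hσ' : mk ⟨d, fun k => τ.src (κ k), σ⟩ = mk ⟨d, fun k => τ'.src (κ' k), σ'⟩ :=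
    mk_eq_iff.2 ⟨E'⟩
  have h2 : mk ⟨d, _, LoopOver.comp τ' κ' rfl σ'⟩ = mk ⟨c, U, s⟩ := by
    rw [← map_mk_mk τ' κ' rfl σ', hSτ, ← hσ', map_mk_mk τ κ h0 σ]
    exact hγ
  obtain ⟨E⟩ := mk_eq_iff.1 h2
  obtain ⟨D, hD, hD'⟩ := LoopOver.exists_cond_of_eqv hs E hd0 hd (fun k j hk hkj => hW k hk j hkj)
    (by
      rintro k j hkj ⟨⟨u, hu⟩, huK, hud⟩ t h ht
      have h3 := mem_iInter.1 (hw k hud) j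
      have h4 := mem_iInter.1 (hw k ht) j
      by_cases h5 : ∃ h, ⟨w k, h⟩ ∈ C.K j
      · exact (h4.1 h5).2
      · exact absurd ⟨hu, huK⟩ (h3.2 h5))
  refine ⟨τ', d, κ', rfl, σ', D, hSτ.symm, hγ'.trans hσ', fun k l h => ?_, hD, hD'⟩
  exact congrArg ULift.down (Sum.inl_injective h)

theorem continuous_map (f : BasedMor O x P y) : Continuous (map f) := by
  refine continuous_generateFrom_iff.2 ?_
  rintro _ ⟨c, U, K, V, A, hK, hV, hA, rfl⟩
  rw [isOpen_iff_mem_nhds]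
  rintro γ ⟨s, hγ, hs⟩
  obtain ⟨τ, d, κ, h0, σ, D, rfl, rfl, -, hD, h⟩ := exists_system_cond f γ
    (⟨K, V, A, hK, hV, hA⟩ : LoopCond P c U) hs hγ
  filter_upwards [basicSet_mem_nhds (D.pull τ κ) (s := σ) hD] with γ' hγ'
  obtain ⟨σ', rfl, hσ'⟩ := hγ'
  obtain ⟨s', hs', hs''⟩ := h (σ'.comp τ κ h0) hσ'
  exact ⟨s', (map_mk_mk τ κ h0 σ').trans hs', hs''⟩

end OrbiLoop

/-- Conditions prescribed arc by arc become conditions on a system indexed by its charts. This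
requires distinct arcs to have distinct indices. -/
theorem Function.Injective.exists_dependent_extension {ι Λ : Type*} {κ : ι → Λ}
    (hκ : Function.Injective κ) {β : Λ → Type*} [∀ a, Nonempty (β a)] (F : ∀ k, β (κ k)) :
    ∃ F' : ∀ a, β a, ∀ k, F' (κ k) = F k := by
  classical
  refine ⟨fun a => if h : ∃ k, κ k = a then h.choose_spec ▸ F h.choose else Classical.arbitrary _,
    fun k => ?_⟩
  have h : ∃ l, κ l = κ k := ⟨k, rfl⟩
  have key : ∀ l (e : κ l = κ k), (e ▸ F l : β (κ k)) = F k := by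
    intro l e
    obtain rfl := hκ e
    rfl
  simp only [h, dif_pos]
  exact key _ _

namespace OrbiLoop

/-- The composition of morphisms and loops is continuous in families over a locally compact
space. -/
theorem continuous_map_family {S T : Type*} [TopologicalSpace S] [TopologicalSpace T]
    [LocallyCompactSpace T] {φ : S → BasedMor O x P y} (hφ : Continuous φ) {a : T → OrbiLoop O x}
    (ha : Continuous a) : Continuous fun p : S × T => map (φ p.1) (a p.2) := by
  refine continuous_generateFrom_iff.2 ?_
  rintro _ ⟨c, U, K, V, A, hK, hV, hA, rfl⟩
  rw [isOpen_iff_mem_nhds]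
  rintro ⟨p₀, u₀⟩ ⟨s, hγ, hs⟩
  obtain ⟨τ, d, κ, h0, σ, D, hf, hγσ, hκ, hD, h⟩ := exists_system_cond (φ p₀) (a u₀)
    (⟨K, V, A, hK, hV, hA⟩ : LoopCond P c U) hs hγ
  obtain ⟨T₀, r, hT₀, hu₀, hr₀, hr, hrf, hrρ⟩ := exists_local_rep ha hγσ
  have h1 : ∀ᶠ u in 𝓝 u₀, u ∈ T₀ ∧ (∀ k, ∀ t ∈ D.K k, τ.sys.f (κ k) ((r u).f k t) ∈ D.V k) ∧
      ∀ k, τ.sys.ρ (κ k) (κ (k + 1)) ((r u).ρ k) ∈ D.A k := by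
    refine Filter.Eventually.and (hT₀.eventually_mem hu₀) (Filter.Eventually.and ?_ ?_)
    · rw [Filter.eventually_all]
      intro k
      refine (D.isCompact_K k).eventually_forall_of_forall_eventually fun t ht => ?_
      refine (hrf k u₀ hu₀ t).eventually (((D.isOpen_V k).preimage (τ.sys.f (κ k)).continuous
        ).mem_nhds ?_)
      change τ.sys.f (κ k) ((r u₀).f k t) ∈ D.V k
      rw [hr₀]; exact hD.1 k ht
    · rw [Filter.eventually_all]
      intro k
      refine (hrρ k u₀ hu₀).eventually (((D.isOpen_A k).preimage
        (τ.sys.ρ (κ k) (κ (k + 1))).continuous).mem_nhds ?_)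
      change τ.sys.ρ (κ k) (κ (k + 1)) ((r u₀).ρ k) ∈ D.A k
      rw [hr₀]; exact hD.2 k
  -- Over the compact neighbourhood `T₁` the representatives sweep out compact sets of points and of
  -- transition maps. These serve as the sets `K'` and `L'` of a basic open set of morphisms
  -- containing `φ p₀`.
  obtain ⟨T₁, hT₁, hT₁s, hT₁c⟩ := LocallyCompactSpace.local_compact_nhds u₀ _ h1
  obtain ⟨K', hK'⟩ := hκ.exists_dependent_extension (β := fun α => Set (O.Hat (τ.src α)))
    fun k => (fun p : T × d.arc k => (r p.1).f k p.2) '' (T₁ ×ˢ D.K k)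
  obtain ⟨V', hV'⟩ := hκ.exists_dependent_extension (β := fun α => Set (P.Hat (τ.tgt α))) D.V
  have hκ2 : Function.Injective fun k => (κ k, κ (k + 1)) := fun k l hkl => hκ (congrArg Prod.fst hkl)
  obtain ⟨L', hL'⟩ := hκ2.exists_dependent_extension
    (β := fun p => Set (O.Tran (τ.src p.1) (τ.src p.2))) fun k => (fun u => (r u).ρ k) '' T₁
  obtain ⟨A', hA'⟩ := hκ2.exists_dependent_extension
    (β := fun p => Set (P.Tran (τ.tgt p.1) (τ.tgt p.2))) D.A
  have h2 : IsOpen (BasedMor.basicSet (x := x) (y := y) τ.src τ.tgt τ.o (range κ) K' V'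
      (range fun k => (κ k, κ (k + 1))) (fun α β => L' (α, β)) fun α β => A' (α, β)) := by
    refine isOpen_generateFrom_of_mem ⟨τ.Λ, τ.src, τ.tgt, τ.o, _, K', V', _, _, _,
      finite_range _, ?_, finite_range _, ?_, rfl⟩
    · rintro _ ⟨k, rfl⟩
      rw [hK', hV']
      refine ⟨(hT₁c.prod (D.isCompact_K k)).image_of_continuousOn ?_, D.isOpen_V k⟩
      rintro ⟨u, t⟩ ⟨hu, -⟩
      exact (hrf k u (hT₁s hu).1 t).continuousWithinAt
    · rintro α β ⟨k, hk⟩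
      obtain ⟨rfl, rfl⟩ := Prod.mk.inj hk
      rw [hL', hA']
      exact ⟨hT₁c.image_of_continuousOn fun u hu => (hrρ k u (hT₁s hu).1).continuousWithinAt,
        D.isOpen_A k⟩
  have h3 : φ p₀ ∈ BasedMor.basicSet (x := x) (y := y) τ.src τ.tgt τ.o (range κ) K' V'
      (range fun k => (κ k, κ (k + 1))) (fun α β => L' (α, β)) fun α β => A' (α, β) := by
    refine ⟨τ.cover, τ.sys, τ.basePt_map, hf, ?_, ?_⟩
    · rintro _ ⟨k, rfl⟩
      rw [hK', hV']
      rintro _ ⟨⟨u, t⟩, ⟨hu, ht⟩, rfl⟩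
      exact (hT₁s hu).2.1 k t ht
    · rintro α β ⟨k, hk⟩
      obtain ⟨rfl, rfl⟩ := Prod.mk.inj hk
      change MapsTo (τ.sys.ρ (κ k) (κ (k + 1))) (L' (κ k, κ (k + 1))) (A' (κ k, κ (k + 1)))
      rw [hL', hA']
      rintro _ ⟨u, hu, rfl⟩
      exact (hT₁s hu).2.2 k
  rw [nhds_prod_eq]
  have h4 : ∀ᶠ p in 𝓝 p₀, φ p ∈ BasedMor.basicSet (x := x) (y := y) τ.src τ.tgt τ.o (range κ) K' V'
      (range fun k => (κ k, κ (k + 1))) (fun α β => L' (α, β)) fun α β => A' (α, β) :=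
    hφ.continuousAt.preimage_mem_nhds (h2.mem_nhds h3)
  filter_upwards [h4.prod_mk (show ∀ᶠ u in 𝓝 u₀, u ∈ T₁ from hT₁)] with p hp
  obtain ⟨⟨cover, S, hS, hSφ, hS1, hS2⟩, hu⟩ := hp
  -- Every nearby morphism has a system over the families of `τ`, so it can be composed with the
  -- representative `r p.2` and the conditions `D` checked directly.
  obtain ⟨s', hs', hs''⟩ := h ((r p.2).comp ⟨τ.Λ, τ.src, τ.tgt, τ.o, cover, S, hS⟩ κ h0) (by
    refine ⟨fun k t ht => ?_, fun k => ?_⟩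
    · have := hS1 (κ k) ⟨k, rfl⟩
      rw [hK', hV'] at this
      exact this ⟨(p.2, t), ⟨hu, ht⟩, rfl⟩
    · have : MapsTo (S.ρ (κ k) (κ (k + 1))) (L' (κ k, κ (k + 1))) (A' (κ k, κ (k + 1))) :=
        hS2 (κ k) (κ (k + 1)) ⟨k, rfl⟩
      rw [hL', hA'] at this
      exact this ⟨p.2, hu, rfl⟩)
  refine ⟨s', Eq.trans ?_ hs', hs''⟩
  change map (φ p.1) (a p.2) = _
  rw [hSφ, hr p.2 (hT₁s hu).1]
  exact map_mk_mk ⟨τ.Λ, τ.src, τ.tgt, τ.o, cover, S, hS⟩ κ h0 (r p.2)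

end OrbiLoop

end Continuity

/-! ### Induced maps on homotopy groups -/

section Functoriality

variable {X Y Z : Type u} [TopologicalSpace X] [TopologicalSpace Y] [TopologicalSpace Z]
variable {O : Orbispace X} {P : Orbispace Y} {Q : Orbispace Z}
variable {x : O.BasePoint} {y : P.BasePoint} {z : Q.BasePoint}

namespace OrbiLoop

theorem map_id (γ : OrbiLoop O x) : map (BasedMor.id O x) γ = γ := by
  obtain ⟨⟨c, U, s⟩, rfl⟩ := Quot.exists_rep γ
  exact map_mk_mk (BasedSystem.id O x) U (congrArg Sigma.fst s.basePt) s

theorem map_isComposite {g : BasedMor P y Q z} {f : BasedMor O x P y} {h : BasedMor O x Q z}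
    (H : BasedMor.IsComposite g f h) (γ : OrbiLoop O x) : map h γ = map g (map f γ) := by
  obtain ⟨τ, Λ, src, κ, o, cover, s, hs, ho, rfl, rfl, rfl⟩ := H
  obtain ⟨c, θ, h0, l, rfl⟩ := BasedSystem.exists_rep
    (⟨Λ, src, fun α => τ.src (κ α), o, cover, s, hs⟩ : BasedSystem O x P y) γ
  refine (map_mk_mk (⟨Λ, src, fun α => τ.tgt (κ α), o, cover, τ.sys.comp κ s, _⟩ :
    BasedSystem O x Q z) θ h0 l).trans ?_
  refine Eq.trans ?_ (congrArg (map (BasedMor.mk τ)) (map_mk_mk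
    (⟨Λ, src, fun α => τ.src (κ α), o, cover, s, hs⟩ : BasedSystem O x P y) θ h0 l).symm)
  exact (map_mk_mk τ (fun k => κ (θ k)) ((congrArg κ h0).trans ho) (LoopOver.comp
    (⟨Λ, src, fun α => τ.src (κ α), o, cover, s, hs⟩ : BasedSystem O x P y) θ h0 l)).symm

end OrbiLoop

namespace BasedMor

theorem piMap_eq (n : ℕ) (f : BasedMor O x P y) : piMap n f =
    HomotopyGroup.mapOfContinuous n ⟨OrbiLoop.map f, OrbiLoop.continuous_map f⟩
      (OrbiLoop.map_base f) :=
  dif_pos ⟨OrbiLoop.continuous_map f, OrbiLoop.map_base f⟩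

/-- The image of a generalized loop in the loop space. -/
noncomputable def mapGenLoop {n : ℕ} (f : BasedMor O x P y)
    (p : GenLoop (Fin n) (OrbiLoop O x) (OrbiLoop.base O x)) :
    GenLoop (Fin n) (OrbiLoop P y) (OrbiLoop.base P y) :=
  ⟨(⟨OrbiLoop.map f, OrbiLoop.continuous_map f⟩ : C(_, _)).comp p.1, fun t ht => by
    rw [ContinuousMap.comp_apply, p.2 t ht]
    exact OrbiLoop.map_base f⟩

theorem mapGenLoop_apply {n : ℕ} (f : BasedMor O x P y)
    (p : GenLoop (Fin n) (OrbiLoop O x) (OrbiLoop.base O x)) (t) :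
    mapGenLoop f p t = OrbiLoop.map f (p t) := rfl

theorem piMap_mk {n : ℕ} (f : BasedMor O x P y)
    (p : GenLoop (Fin n) (OrbiLoop O x) (OrbiLoop.base O x)) :
    piMap n f (Quotient.mk _ p) = (Quotient.mk _ (mapGenLoop f p) : OrbiPi n P y) := by
  rw [piMap_eq]
  rfl

/-- The homotopy is `(s, t) ↦ φ s ∘ p t`, jointly continuous because the cube is locally compact. It
is constant on the boundary because every morphism preserves the constant loop. -/
theorem piMap_eq_of_homotopic {f₁ f₂ : BasedMor O x P y} (h : Homotopic f₁ f₂) (n : ℕ) :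
    piMap n f₁ = piMap n f₂ := by
  obtain ⟨φ⟩ := h
  funext a
  induction a using Quotient.inductionOn with
  | h p =>
    rw [piMap_mk, piMap_mk]
    refine Quotient.sound ⟨⟨⟨⟨fun q => OrbiLoop.map (φ q.1) (p q.2),
      OrbiLoop.continuous_map_family φ.continuous p.1.continuous⟩, fun t => ?_, fun t => ?_⟩, ?_⟩⟩
    · exact congrArg (fun f => OrbiLoop.map f (p t)) φ.source
    · exact congrArg (fun f => OrbiLoop.map f (p t)) φ.target
    · intro s t ht
      have hp : p t = OrbiLoop.base O x := p.2 t ht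
      change OrbiLoop.map (φ s) (p t) = OrbiLoop.map f₁ (p t)
      rw [hp, OrbiLoop.map_base, OrbiLoop.map_base]

theorem piMap_id (n : ℕ) (a : OrbiPi n O x) : piMap n (id O x) a = a := by
  induction a using Quotient.inductionOn with
  | h p =>
    rw [piMap_mk]
    exact congrArg _ (GenLoop.ext _ _ fun t => OrbiLoop.map_id (p t))

theorem IsComposite.piMap_apply {g : BasedMor P y Q z} {f : BasedMor O x P y}
    {h : BasedMor O x Q z} (H : IsComposite g f h) (n : ℕ) (a : OrbiPi n O x) :
    piMap n h a = piMap n g (piMap n f a) := by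
  induction a using Quotient.inductionOn with
  | h p =>
    rw [piMap_mk, piMap_mk, piMap_mk]
    exact congrArg _ (GenLoop.ext _ _ fun t => OrbiLoop.map_isComposite H (p t))

theorem IsHomotopyEquivalence.exists_inverse {f : BasedMor O x P y} (h : f.IsHomotopyEquivalence) :
    ∃ g : BasedMor P y O x, ∀ n, Function.LeftInverse (piMap n g) (piMap n f) ∧
      Function.RightInverse (piMap n g) (piMap n f) := by
  obtain ⟨g, ⟨h₁, hc₁, hh₁⟩, h₂, hc₂, hh₂⟩ := h
  refine ⟨g, fun n => ⟨fun a => ?_, fun a => ?_⟩⟩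
  · rw [← hc₁.piMap_apply, piMap_eq_of_homotopic hh₁, piMap_id]
  · rw [← hc₂.piMap_apply, piMap_eq_of_homotopic hh₂, piMap_id]

/-- By `mul_spec` the product is represented by concatenation in the coordinate `0`, with the
factors in reverse order. Composition with `OrbiLoop.map f` commutes with it pointwise. -/
theorem piMap_mul {n : ℕ} (f : BasedMor O x P y) (a b : OrbiPi (n + 1) O x) :
    piMap (n + 1) f (a * b) = piMap (n + 1) f a * piMap (n + 1) f b := by
  induction a, b using Quotient.inductionOn₂ with
  | h p q =>
    have h1 : (HMul.hMul (α := OrbiPi (n + 1) O x) (β := OrbiPi (n + 1) O x) (Quotient.mk _ p)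
        (Quotient.mk _ q) : OrbiPi (n + 1) O x) = Quotient.mk _ (GenLoop.transAt 0 q p) :=
      HomotopyGroup.mul_spec
    have h2 : (HMul.hMul (α := OrbiPi (n + 1) P y) (β := OrbiPi (n + 1) P y)
        (Quotient.mk _ (mapGenLoop f p)) (Quotient.mk _ (mapGenLoop f q)) : OrbiPi (n + 1) P y) =
        Quotient.mk _ (GenLoop.transAt 0 (mapGenLoop f q) (mapGenLoop f p)) :=
      HomotopyGroup.mul_spec
    refine (congrArg (piMap (n + 1) f) h1).trans ((piMap_mk f _).trans ?_)
    refine Eq.trans ?_ (h2.symm.trans (congrArg₂ (HMul.hMul (α := OrbiPi (n + 1) P y))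
      (piMap_mk f p) (piMap_mk f q)).symm)
    refine congrArg _ (GenLoop.ext _ _ fun t => ?_)
    rw [mapGenLoop_apply]
    simp only [GenLoop.transAt, GenLoop.coe_copy, mapGenLoop_apply]
    split_ifs <;> rfl

end BasedMor

end Functoriality

/-! ### Concatenation of covers by arcs -/

namespace ArcCover

/-- An interval with `0 < k < n + 3` that started below `0` would contain `0`, because `b k ≥ b 0 >
0`. With `b_le_one`, the arcs other than the base arc have lifts in `[0, 1]`. -/
theorem nonneg_a {c : ArcCover} (hc : ∀ i : Fin (c.n + 3), i ≠ 0 → (0 : UnitAddCircle) ∉ c.arc i)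
    {k : ℕ} (h0 : 0 < k) (hk : k < c.n + 3) : 0 ≤ c.a k := by
  by_contra h
  refine hc ⟨k, hk⟩ (fun h => h0.ne' (congrArg Fin.val h)) ⟨0, ⟨not_le.1 h, ?_⟩, by simp⟩
  exact c.b_zero.trans_le (c.b_strictMono.monotone h0.le)

theorem b_le_one {c : ArcCover} (hc : ∀ i : Fin (c.n + 3), i ≠ 0 → (0 : UnitAddCircle) ∉ c.arc i)
    {k : ℕ} (hk : k < c.n + 3) : c.b k ≤ 1 := by
  by_contra h
  have h1 := c.a_zero
  rcases Nat.eq_zero_or_pos k with rfl | h0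
  · have := c.b_lt_add_one 0
    linarith
  refine hc ⟨k, hk⟩ (fun h => h0.ne' (congrArg Fin.val h)) ⟨1, ⟨?_, not_le.1 h⟩, by simp⟩
  have h2 := c.a_strictMono hk
  have h3 := c.a_add 0
  rw [zero_add] at h3
  change c.a k < 1
  linarith

theorem a_card (c : ArcCover) : c.a (c.n + 3) = c.a 0 + 1 := by
  have := c.a_add 0
  rwa [zero_add] at this

theorem b_card (c : ArcCover) : c.b (c.n + 3) = c.b 0 + 1 := by
  have := c.b_add 0
  rwa [zero_add] at this

theorem index_card (c : ArcCover) : c.index (c.n + 3) = 0 := Fin.ext (Nat.mod_self _)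

theorem index_zero (c : ArcCover) : c.index 0 = 0 := Fin.ext (Nat.zero_mod _)

theorem index_coe (c : ArcCover) {I : ℕ} (h : I < c.n + 3) : (c.index I : ℕ) = I := Nat.mod_eq_of_lt h

theorem arc_index (c : ArcCover) (I : ℕ) :
    c.arc (c.index I) = (fun t : ℝ => (t : UnitAddCircle)) '' Ioo (c.a I) (c.b I) := by
  have e : I = I % (c.n + 3) + I / (c.n + 3) * (c.n + 3) := (Nat.mod_add_div' I (c.n + 3)).symm
  have ha := c.a_add_mul (I % (c.n + 3)) (I / (c.n + 3))
  have hb := c.b_add_mul (I % (c.n + 3)) (I / (c.n + 3))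
  rw [← e] at ha hb
  refine Subset.antisymm ?_ ?_
  · rintro _ ⟨u, ⟨h1, h2⟩, rfl⟩
    change c.a (I % (c.n + 3)) < u at h1
    change u < c.b (I % (c.n + 3)) at h2
    refine ⟨u + (I / (c.n + 3) : ℕ), ⟨by linarith, by linarith⟩, ?_⟩
    exact unitAddCircle_coe_add_int u ((I / (c.n + 3) : ℕ) : ℤ)
  · rintro _ ⟨u, ⟨h1, h2⟩, rfl⟩
    exact c.mem_arc_index h1 h2

theorem arc_index_subset {c d : ArcCover} {I k : ℕ} (ha : c.a I ≤ d.a k) (hb : d.b k ≤ c.b I) :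
    d.arc (d.index k) ⊆ c.arc (c.index I) := by
  rw [arc_index, arc_index]
  exact image_mono (Ioo_subset_Ioo ha hb)

/-- The cover `d` refines `c`, the interval number `k` of `d` being contained in the interval
number `I k` of `c`. -/
structure RefinesVia (d c : ArcCover) (I : ℕ → ℕ) : Prop where
  zero : I 0 = 0
  card : I (d.n + 3) = c.n + 3
  le : ∀ k ≤ d.n + 3, I k ≤ c.n + 3
  a_le : ∀ k ≤ d.n + 3, c.a (I k) ≤ d.a k
  b_le : ∀ k ≤ d.n + 3, d.b k ≤ c.b (I k)

/-- The inclusion of images holds only modulo integers. If `α` or `β` were inside `(a, b)`, its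
class would be that of an interior point of `(α, β)`, at a nonzero integral distance less than `1`.
-/
theorem Ioo_subset_of_image {a b α β p : ℝ} (hp : p ∈ Ioo a b) (hp' : p ∈ Ioo α β) (h : β ≤ α + 1)
    (hs : (fun t : ℝ => (t : UnitAddCircle)) '' Ioo a b ⊆ (fun t : ℝ => (t : UnitAddCircle)) '' Ioo α β) :
    α ≤ a ∧ b ≤ β := by
  obtain ⟨h1, h2⟩ := hp
  obtain ⟨h3, h4⟩ := hp'
  constructor
  · by_contra hlt
    obtain ⟨v, ⟨h5, h6⟩, e⟩ := hs ⟨α, ⟨not_le.1 hlt, h3.trans h2⟩, rfl⟩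
    obtain ⟨z, hz⟩ := unitAddCircle_coe_eq_iff.1 e
    have h7 : (0 : ℝ) < z := by linarith
    have h8 : (z : ℝ) < 1 := by linarith
    have h9 : 0 < z := by exact_mod_cast h7
    have h10 : z < 1 := by exact_mod_cast h8
    omega
  · by_contra hlt
    obtain ⟨v, ⟨h5, h6⟩, e⟩ := hs ⟨β, ⟨h1.trans h4, not_le.1 hlt⟩, rfl⟩
    obtain ⟨z, hz⟩ := unitAddCircle_coe_eq_iff.1 e
    have h7 : (-1 : ℝ) < z := by linarith
    have h8 : (z : ℝ) < 0 := by linarith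
    have h9 : -1 < z := by exact_mod_cast h7
    have h10 : z < 0 := by exact_mod_cast h8
    omega

/-- A lift of a sufficiently small neighborhood of a point of the circle to an interval of the
cover. -/
theorem exists_small_interval {c : ArcCover}
    (hc : ∀ i : Fin (c.n + 3), i ≠ 0 → (0 : UnitAddCircle) ∉ c.arc i) (t : UnitAddCircle) :
    ∃ (I : ℕ) (α β : ℝ), (fun u : ℝ => (u : UnitAddCircle)) '' Ioo α β ∈ 𝓝 t ∧
      c.a I ≤ α ∧ β ≤ c.b I ∧ β ≤ α + 1 ∧ (t = 0 → I = 0 ∧ α < 0 ∧ 0 < β) ∧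
      ((I = 0 ∧ -1 ≤ α ∧ β ≤ 1) ∨ (I ≤ c.n + 3 ∧ 0 ≤ α ∧ β ≤ 1)) := by
  have hopen : ∀ (α β u : ℝ), α < u → u < β →
      (fun u : ℝ => (u : UnitAddCircle)) '' Ioo α β ∈ 𝓝 (u : UnitAddCircle) := fun α β u h h' =>
    (QuotientAddGroup.isOpenMap_coe _ isOpen_Ioo).mem_nhds ⟨u, ⟨h, h'⟩, rfl⟩
  have h1 := c.a_zero
  have h2 := c.b_zero
  have h3 := c.b_lt_add_one 0
  by_cases ht : t = 0
  · subst ht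
    exact ⟨0, c.a 0, c.b 0, by simpa using hopen _ _ 0 h1 h2, le_rfl, le_rfl, h3.le,
      fun _ => ⟨rfl, h1, h2⟩, Or.inl ⟨rfl, by linarith, by linarith⟩⟩
  obtain ⟨u, rfl, hu0, hu1⟩ := exists_coe_unitAddCircle t
  have hu : 0 < u := lt_of_le_of_ne hu0 (by rintro rfl; simp at ht)
  have key : ∃ I ≤ c.n + 3, c.a I < u ∧ u < c.b I := by
    obtain ⟨i, v, ⟨hv1, hv2⟩, e⟩ := c.exists_mem_arc (u : UnitAddCircle)
    obtain ⟨z, hz⟩ := unitAddCircle_coe_eq_iff.1 e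
    have h4 := b_le_one hc i.2
    by_cases hi : (i : ℕ) = 0
    · rw [hi] at hv1 hv2
      have h5 : (z : ℝ) < 1 := by linarith
      have h6 : (-2 : ℝ) < z := by linarith
      have h7 : z < 1 := by exact_mod_cast h5
      have h8 : -2 < z := by exact_mod_cast h6
      obtain rfl | rfl : z = 0 ∨ z = -1 := by omega
      · rw [Int.cast_zero, add_zero] at hz
        subst hz
        exact ⟨0, by omega, hv1, hv2⟩
      · push_cast at hz
        exact ⟨c.n + 3, le_rfl, by rw [a_card]; linarith, by rw [b_card]; linarith⟩
    · have h5 := nonneg_a hc (Nat.pos_of_ne_zero hi) i.2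
      have h6 : (z : ℝ) < 1 := by linarith
      have h7 : (-1 : ℝ) < z := by linarith
      have h8 : z < 1 := by exact_mod_cast h6
      have h9 : -1 < z := by exact_mod_cast h7
      obtain rfl : z = 0 := by omega
      rw [Int.cast_zero, add_zero] at hz
      subst hz
      exact ⟨i, i.2.le, hv1, hv2⟩
  obtain ⟨I, hI, h4, h5⟩ := key
  -- The interval is cut down to `[0, 1]`, so that its lift can be compared with the lifts of the
  -- other arcs without an integer shift.
  refine ⟨I, max (c.a I) 0, min (c.b I) 1, hopen _ _ u (max_lt h4 hu) (lt_min h5 hu1), le_max_left _ _,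
    min_le_left _ _, (min_le_right _ _).trans ?_, fun h => absurd h ht,
    Or.inr ⟨hI, le_max_right _ _, min_le_right _ _⟩⟩
  linarith [le_max_right (c.a I) 0]

/-- A cover by arcs which is finer than suitable neighborhoods lifts to a refinement. -/
theorem exists_refinesVia {c : ArcCover}
    (hc : ∀ i : Fin (c.n + 3), i ≠ 0 → (0 : UnitAddCircle) ∉ c.arc i) :
    ∃ 𝒲 : UnitAddCircle → Set UnitAddCircle, (∀ t, 𝒲 t ∈ 𝓝 t) ∧
      ∀ (d : ArcCover) (w : Fin (d.n + 3) → UnitAddCircle), (∀ k, d.arc k ⊆ 𝒲 (w k)) → w 0 = 0 →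
        (∀ i : Fin (d.n + 3), i ≠ 0 → (0 : UnitAddCircle) ∉ d.arc i) → ∃ I, d.RefinesVia c I := by
  choose J α β h𝒲 hα hβ hαβ h0 hcase using exists_small_interval hc
  refine ⟨fun t => (fun u : ℝ => (u : UnitAddCircle)) '' Ioo (α t) (β t), h𝒲, fun d w hw hw0 hd => ?_⟩
  have key : ∀ k, ∃ I ≤ c.n + 3, (k = 0 → I = 0) ∧ (k = d.n + 3 → I = c.n + 3) ∧
      (k ≤ d.n + 3 → c.a I ≤ d.a k ∧ d.b k ≤ c.b I) := by
    intro k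
    have hz : c.a 0 ≤ d.a 0 ∧ d.b 0 ≤ c.b 0 := by
      obtain ⟨h1, h2, h3⟩ := h0 (w 0) hw0
      have := Ioo_subset_of_image ⟨d.a_zero, d.b_zero⟩ ⟨h2, h3⟩ (hαβ _) (hw 0)
      have h4 := hα (w 0)
      have h5 := hβ (w 0)
      rw [h1] at h4 h5
      exact ⟨h4.trans this.1, this.2.trans h5⟩
    rcases Nat.eq_zero_or_pos k with rfl | hk0
    · exact ⟨0, by omega, fun _ => rfl, fun h => by omega, fun _ => hz⟩
    rcases lt_trichotomy k (d.n + 3) with hk | rfl | hk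
    · obtain ⟨p, hp⟩ := nonempty_Ioo.2 (d.a_lt_b k)
      have h1 := nonneg_a hd hk0 hk
      have h2 := b_le_one hd hk
      obtain ⟨v, ⟨hv1, hv2⟩, e⟩ := hw ⟨k, hk⟩ ⟨p, hp, rfl⟩
      obtain ⟨z, hz⟩ := unitAddCircle_coe_eq_iff.1 e
      have hp1 := hp.1
      have hp2 := hp.2
      rcases hcase (w ⟨k, hk⟩) with ⟨h3, h4, h5⟩ | ⟨h3, h4, h5⟩
      · have h6 : (z : ℝ) < 1 := by linarith
        have h7 : (-2 : ℝ) < z := by linarith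
        have h8 : z < 1 := by exact_mod_cast h6
        have h9 : -2 < z := by exact_mod_cast h7
        have h10 := hα (w ⟨k, hk⟩)
        have h11 := hβ (w ⟨k, hk⟩)
        rw [h3] at h10 h11
        -- An arc inside the base arc of `c` lies either just after the time `0`, in the interval
        -- number `0`, or just before the time `1`, in the interval number `c.n + 3`.
        obtain rfl | rfl : z = 0 ∨ z = -1 := by omega
        · rw [Int.cast_zero, add_zero] at hz
          subst hz
          have := Ioo_subset_of_image hp ⟨hv1, hv2⟩ (hαβ _) (hw ⟨k, hk⟩)
          exact ⟨0, by omega, fun _ => rfl, fun h => by omega, fun _ =>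
            ⟨h10.trans this.1, this.2.trans h11⟩⟩
        · push_cast at hz
          have := Ioo_subset_of_image (α := α (w ⟨k, hk⟩) + 1) (β := β (w ⟨k, hk⟩) + 1) hp
            ⟨by linarith, by linarith⟩ (by linarith [hαβ (w ⟨k, hk⟩)]) ((hw ⟨k, hk⟩).trans (by
              rintro _ ⟨u, ⟨hu1, hu2⟩, rfl⟩
              refine ⟨u + 1, ⟨by linarith, by linarith⟩, ?_⟩
              have := unitAddCircle_coe_add_int u 1
              rwa [Int.cast_one] at this))
          refine ⟨c.n + 3, le_rfl, fun h => by omega, fun _ => rfl, fun _ => ?_⟩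
          rw [a_card, b_card]
          exact ⟨by linarith, by linarith⟩
      · have h6 : (z : ℝ) < 1 := by linarith
        have h7 : (-1 : ℝ) < z := by linarith
        have h8 : z < 1 := by exact_mod_cast h6
        have h9 : -1 < z := by exact_mod_cast h7
        obtain rfl : z = 0 := by omega
        rw [Int.cast_zero, add_zero] at hz
        subst hz
        have := Ioo_subset_of_image hp ⟨hv1, hv2⟩ (hαβ _) (hw ⟨k, hk⟩)
        exact ⟨_, h3, fun h => by omega, fun h => by omega, fun _ =>
          ⟨(hα _).trans this.1, this.2.trans (hβ _)⟩⟩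
    · refine ⟨c.n + 3, le_rfl, fun h => by omega, fun _ => rfl, fun _ => ?_⟩
      rw [a_card, a_card, b_card, b_card]
      exact ⟨by linarith, by linarith⟩
    · exact ⟨c.n + 3, le_rfl, fun h => by omega, fun _ => rfl, fun h => by omega⟩
  choose I h1 h2 h3 h4 using key
  exact ⟨I, h2 0 rfl, h3 _ rfl, fun k _ => h1 k, fun k hk => (h4 k hk).1, fun k hk => (h4 k hk).2⟩

/-- The cover `c` is obtained from `c₁` (on the first half of the circle) and `c₂` (on the second
half), by joining the halves of the arcs containing the base point. -/
structure IsConcat (c₁ c₂ c : ArcCover) : Prop where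
  only₁ : ∀ i : Fin (c₁.n + 3), i ≠ 0 → (0 : UnitAddCircle) ∉ c₁.arc i
  only₂ : ∀ i : Fin (c₂.n + 3), i ≠ 0 → (0 : UnitAddCircle) ∉ c₂.arc i
  card : c.n + 3 = (c₁.n + 3) + (c₂.n + 3)
  a_zero : c.a 0 = c₂.a 0 / 2
  b_zero : c.b 0 = c₁.b 0 / 2
  a_mid : c.a (c₁.n + 3) = (c₁.a 0 + 1) / 2
  b_mid : c.b (c₁.n + 3) = (c₂.b 0 + 1) / 2
  arc₁ : ∀ i, 0 < i → i < c₁.n + 3 → c.a i = c₁.a i / 2 ∧ c.b i = c₁.b i / 2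
  arc₂ : ∀ i, 0 < i → i < c₂.n + 3 →
    c.a (c₁.n + 3 + i) = (c₂.a i + 1) / 2 ∧ c.b (c₁.n + 3 + i) = (c₂.b i + 1) / 2

/-- The end points are prescribed on one period and continued quasi-periodically. At the two joints,
disjointness holds because the arcs other than the base arcs lie in `[0, 1]`. -/
theorem exists_isConcat {c₁ c₂ : ArcCover}
    (h₁ : ∀ i : Fin (c₁.n + 3), i ≠ 0 → (0 : UnitAddCircle) ∉ c₁.arc i)
    (h₂ : ∀ i : Fin (c₂.n + 3), i ≠ 0 → (0 : UnitAddCircle) ∉ c₂.arc i) :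
    ∃ c, IsConcat c₁ c₂ c := by
  set M := c₁.n + 3 with hM
  set K := c₂.n + 3 with hK
  -- The arc number `0` begins with the left half of the base arc of `c₂`. The arc number `M` begins
  -- with the left half of that of `c₁`, since `c₁.a M = c₁.a 0 + 1`.
  let A : ℕ → ℝ := fun r => if r = 0 then c₂.a 0 / 2 else if r ≤ M then c₁.a r / 2 else
    (c₂.a (r - M) + 1) / 2
  let B : ℕ → ℝ := fun r => if r < M then c₁.b r / 2 else (c₂.b (r - M) + 1) / 2
  let ext : (ℕ → ℝ) → ℕ → ℝ := fun F i => F (i % (M + K)) + (i / (M + K) : ℕ)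
  have hpos : 0 < M + K := by omega
  have hadd : ∀ F i z, ext F (i + z * (M + K)) = ext F i + z := by
    intro F i z
    simp only [ext, Nat.add_mul_mod_self_right, Nat.add_mul_div_right _ _ hpos]
    push_cast; ring
  have hadd1 : ∀ F i, ext F (i + (M + K)) = ext F i + 1 := fun F i => by
    simpa using hadd F i 1
  have hlt : ∀ F i, i < M + K → ext F i = F i := fun F i hi => by
    simp only [ext, Nat.mod_eq_of_lt hi, Nat.div_eq_of_lt hi, Nat.cast_zero, add_zero]
  have hA0 : A 0 = c₂.a 0 / 2 := if_pos rfl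
  have hA₁ : ∀ r, 0 < r → r ≤ M → A r = c₁.a r / 2 := fun r h h' => by
    simp only [A, if_neg h.ne', if_pos h']
  have hA₂ : ∀ i, 0 < i → A (M + i) = (c₂.a i + 1) / 2 := fun i h => by
    simp only [A, if_neg (show ¬ M + i = 0 by omega), if_neg (show ¬ M + i ≤ M by omega),
      Nat.add_sub_cancel_left]
  have hB₁ : ∀ r < M, B r = c₁.b r / 2 := fun r h => if_pos h
  have hB₂ : ∀ i, B (M + i) = (c₂.b i + 1) / 2 := fun i => by
    simp only [B, if_neg (show ¬ M + i < M by omega), Nat.add_sub_cancel_left]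
  have hA : ∀ r ≤ M + K, ext A r = A r := by
    intro r hr
    rcases hr.lt_or_eq with h | rfl
    · exact hlt A r h
    · have := hadd1 A 0
      rw [zero_add, hlt A 0 hpos, hA0] at this
      rw [this, hA₂ K (by omega), hK, a_card]
      ring
  have hdecomp : ∀ i : ℕ, ∃ r < M + K, ∃ q, i = r + q * (M + K) := fun i =>
    ⟨i % (M + K), Nat.mod_lt _ hpos, i / (M + K), (Nat.mod_add_div' i (M + K)).symm⟩
  have hsplit : ∀ r < M + K, r < M ∨ ∃ j < K, r = M + j := fun r hr => by
    rcases Nat.lt_or_ge r M with h | h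
    · exact Or.inl h
    · exact Or.inr ⟨r - M, by omega, by omega⟩
  have hcard : M + K - 3 + 3 = M + K := by omega
  let c : ArcCover :=
    { n := M + K - 3
      a := ext A
      b := ext B
      a_add := fun i => by rw [hcard]; exact hadd1 A i
      b_add := fun i => by rw [hcard]; exact hadd1 B i
      overlap := fun i => by
        obtain ⟨r, hr, q, rfl⟩ := hdecomp i
        rw [add_right_comm r (q * (M + K)) 1, hadd, hadd, hlt B r hr, hA (r + 1) hr]
        rcases hsplit r hr with h | ⟨j, hj, rfl⟩
        · rw [hA₁ _ (by omega) h, hB₁ _ h]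
          linarith [c₁.overlap r]
        · rw [add_assoc M j 1, hA₂ _ (by omega), hB₂]
          linarith [c₂.overlap j]
      disjoint := fun i => by
        obtain ⟨r, hr, q, rfl⟩ := hdecomp i
        rw [add_right_comm r (q * (M + K)) 2, hadd, hadd, hlt B r hr]
        have h1 := nonneg_a h₁ one_pos (by omega)
        have h2 := nonneg_a h₂ one_pos (by omega)
        rcases hsplit r hr with h | ⟨j, hj, rfl⟩
        · rw [hA _ (by omega), hB₁ _ h]
          rcases Nat.lt_or_ge M (r + 2) with h' | h'
          · obtain rfl : r = M - 1 := by omega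
            rw [show M - 1 + 2 = M + 1 by omega, hA₂ _ one_pos]
            have h3 : c₁.b (M - 1) ≤ 1 := b_le_one h₁ (by omega)
            linarith
          · rw [hA₁ _ (by omega) h']
            linarith [c₁.disjoint r]
        · rw [hB₂]
          rcases Nat.lt_or_ge K (j + 2) with h' | h'
          · obtain rfl : j = K - 1 := by omega
            rw [show M + (K - 1) + 2 = 1 + (M + K) by omega, hadd1, hA _ (by omega),
              hA₁ _ one_pos (by omega)]
            have h3 : c₂.b (K - 1) ≤ 1 := b_le_one h₂ (by omega)
            linarith
          · rw [add_assoc M j 2, hA _ (by omega), hA₂ _ (by omega)]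
            linarith [c₂.disjoint j]
      a_zero := by
        rw [hlt A 0 hpos, hA0]
        linarith [c₂.a_zero]
      b_zero := by
        rw [hlt B 0 hpos, hB₁ 0 (by omega)]
        linarith [c₁.b_zero] }
  refine ⟨c, h₁, h₂, hcard, ?_, ?_, ?_, ?_, fun i h h' => ⟨?_, ?_⟩, fun i h h' => ⟨?_, ?_⟩⟩
  · exact (hlt A 0 hpos).trans hA0
  · exact (hlt B 0 hpos).trans (hB₁ 0 (by omega))
  · refine (hA M (by omega)).trans ((hA₁ M (by omega) le_rfl).trans ?_)
    rw [hM, a_card]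
  · exact (hlt B M (by omega)).trans (hB₂ 0)
  · exact (hA i (by omega)).trans (hA₁ i h h'.le)
  · exact (hlt B i (by omega)).trans (hB₁ i h')
  · exact (hA (M + i) (by omega)).trans (hA₂ i h)
  · exact (hlt B (M + i) (by omega)).trans (hB₂ i)

/-- The cover `c` contains a copy of `c₁`, starting at the index `L`, on the arc
`[ε / 2, (1 + ε) / 2]`. -/
structure IsHalf (c₁ c : ArcCover) (L : ℕ) (ε : ℝ) : Prop where
  only : ∀ i : Fin (c₁.n + 3), i ≠ 0 → (0 : UnitAddCircle) ∉ c₁.arc i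
  a_eq : ∀ i, 0 < i → i ≤ c₁.n + 3 → c.a (L + i) = (c₁.a i + ε) / 2
  b_eq : ∀ i, i < c₁.n + 3 → c.b (L + i) = (c₁.b i + ε) / 2
  a_lt : c.a L < ε / 2
  lt_b : (1 + ε) / 2 < c.b (L + (c₁.n + 3))

theorem IsConcat.isHalf_left {c₁ c₂ c : ArcCover} (h : IsConcat c₁ c₂ c) : IsHalf c₁ c 0 0 where
  only := h.only₁
  a_eq i h0 hi := by
    rw [zero_add, add_zero]
    rcases hi.lt_or_eq with hi | rfl
    · exact (h.arc₁ i h0 hi).1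
    · rw [h.a_mid, a_card]
  b_eq i hi := by
    rw [zero_add, add_zero]
    rcases Nat.eq_zero_or_pos i with rfl | h0
    · exact h.b_zero
    · exact (h.arc₁ i h0 hi).2
  a_lt := by rw [h.a_zero]; linarith [c₂.a_zero]
  lt_b := by rw [zero_add, h.b_mid]; linarith [c₂.b_zero]

theorem IsConcat.isHalf_right {c₁ c₂ c : ArcCover} (h : IsConcat c₁ c₂ c) :
    IsHalf c₂ c (c₁.n + 3) 1 where
  only := h.only₂
  a_eq i h0 hi := by
    rcases hi.lt_or_eq with hi | rfl
    · exact (h.arc₂ i h0 hi).1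
    · rw [← h.card, a_card, a_card, h.a_zero]; ring
  b_eq i hi := by
    rcases Nat.eq_zero_or_pos i with rfl | h0
    · exact h.b_mid
    · exact (h.arc₂ i h0 hi).2
  a_lt := by rw [h.a_mid]; linarith [c₁.a_zero]
  lt_b := by rw [← h.card, b_card, h.b_zero]; linarith [c₁.b_zero]

/-- Only half of each of the two end intervals of `c₁` is copied into `c`. If `I k` is one of them,
the missing bound comes from `a_lt` or `lt_b`, because non-base arcs of `d₁` lie in `[0, 1]`. -/
theorem IsHalf.refines {c₁ c d₁ d : ArcCover} {L L' : ℕ} {ε : ℝ} (h : IsHalf c₁ c L ε)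
    (h' : IsHalf d₁ d L' ε) {I : ℕ → ℕ} (hI : d₁.RefinesVia c₁ I) {k : ℕ} (hk0 : 0 < k)
    (hk : k < d₁.n + 3) : c.a (L + I k) ≤ d.a (L' + k) ∧ d.b (L' + k) ≤ c.b (L + I k) := by
  rw [h'.a_eq k hk0 hk.le, h'.b_eq k hk]
  have h1 := hI.a_le k hk.le
  have h2 := hI.b_le k hk.le
  constructor
  · rcases Nat.eq_zero_or_pos (I k) with h0 | h0
    · rw [h0, add_zero]
      linarith [h.a_lt, nonneg_a h'.only hk0 hk]
    · rw [h.a_eq _ h0 (hI.le k hk.le)]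
      linarith
  · rcases (hI.le k hk.le).lt_or_eq with h0 | h0
    · rw [h.b_eq _ h0]
      linarith
    · rw [h0]
      linarith [h.lt_b, b_le_one h'.only hk]

theorem IsConcat.exists_refinesVia {c₁ c₂ c d₁ d₂ d : ArcCover} (h : IsConcat c₁ c₂ c)
    (h' : IsConcat d₁ d₂ d) {I₁ I₂ : ℕ → ℕ} (hI₁ : d₁.RefinesVia c₁ I₁) (hI₂ : d₂.RefinesVia c₂ I₂) :
    ∃ J, d.RefinesVia c J ∧ (∀ k ≤ d₁.n + 3, J k = I₁ k) ∧
      ∀ k, J (d₁.n + 3 + k) = c₁.n + 3 + I₂ k := by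
  let J : ℕ → ℕ := fun k => if k < d₁.n + 3 then I₁ k else c₁.n + 3 + I₂ (k - (d₁.n + 3))
  have hJ₂ : ∀ k, J (d₁.n + 3 + k) = c₁.n + 3 + I₂ k := fun k => by
    simp only [J, if_neg (show ¬ d₁.n + 3 + k < d₁.n + 3 by omega), Nat.add_sub_cancel_left]
  have hJ₁ : ∀ k ≤ d₁.n + 3, J k = I₁ k := by
    intro k hk
    rcases hk.lt_or_eq with hk | rfl
    · exact if_pos hk
    · have := hJ₂ 0
      rwa [add_zero, hI₂.zero, add_zero, ← hI₁.card] at this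
  have key : ∀ k ≤ d.n + 3, J k ≤ c.n + 3 ∧ c.a (J k) ≤ d.a k ∧ d.b k ≤ c.b (J k) := by
    intro k hk
    have e1 := h.card
    have e2 := h'.card
    have a1 := hI₁.a_le 0 (by omega)
    have b1 := hI₁.b_le 0 (by omega)
    have a2 := hI₂.a_le 0 (by omega)
    have b2 := hI₂.b_le 0 (by omega)
    rw [hI₁.zero] at a1 b1
    rw [hI₂.zero] at a2 b2
    rcases Nat.eq_zero_or_pos k with rfl | hk0
    · rw [hJ₁ 0 (by omega), hI₁.zero, h.a_zero, h'.a_zero, h.b_zero, h'.b_zero]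
      exact ⟨by omega, by linarith, by linarith⟩
    rcases lt_trichotomy k (d₁.n + 3) with h1 | rfl | h1
    · have := h.isHalf_left.refines h'.isHalf_left hI₁ hk0 h1
      simp only [zero_add] at this
      rw [hJ₁ k h1.le]
      exact ⟨(hI₁.le k h1.le).trans (by omega), this⟩
    · rw [hJ₁ _ le_rfl, hI₁.card, h.a_mid, h'.a_mid, h.b_mid, h'.b_mid]
      exact ⟨by omega, by linarith, by linarith⟩
    · obtain ⟨j, rfl⟩ : ∃ j, k = d₁.n + 3 + j := ⟨k - (d₁.n + 3), by omega⟩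
      rw [hJ₂]
      rcases Nat.lt_or_ge j (d₂.n + 3) with hj | hj
      · refine ⟨?_, h.isHalf_right.refines h'.isHalf_right hI₂ (by omega) hj⟩
        have := hI₂.le j hj.le
        omega
      · obtain rfl : j = d₂.n + 3 := by omega
        rw [hI₂.card, ← e1, ← e2, a_card, a_card, b_card, b_card, h.a_zero, h'.a_zero, h.b_zero,
          h'.b_zero]
        exact ⟨le_rfl, by linarith, by linarith⟩
  refine ⟨J, ⟨(hJ₁ 0 (by omega)).trans hI₁.zero, ?_, fun k hk => (key k hk).1,
    fun k hk => (key k hk).2.1, fun k hk => (key k hk).2.2⟩, hJ₁, hJ₂⟩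
  rw [h'.card, hJ₂, hI₂.card, h.card]

end ArcCover

/-! ### Morphisms preserve concatenations -/

section Concatenation

variable {X Y : Type u} [TopologicalSpace X] [TopologicalSpace Y]
variable {O : Orbispace X} {P : Orbispace Y} {x : O.BasePoint} {y : P.BasePoint}

namespace Orbispace

theorem exists_arrow_eq {a b : O.basic} {A : O.Arrow} (h1 : A.1 = a) (h2 : A.2.1 = b) :
    ∃ n : O.Tran a b, O.arrow n = A := by
  obtain ⟨a', b', t⟩ := A
  subst h1 h2
  exact ⟨t, rfl⟩

theorem arrow_injective {a b : O.basic} {t t' : O.Tran a b} (h : O.arrow t = O.arrow t') : t = t' :=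
  eq_of_heq (Sigma.mk.inj (eq_of_heq (Sigma.mk.inj h).2)).2

theorem mem_source_of_arrow_one {a b d : O.basic} {t : O.Tran a b} (h : O.arrow t = O.arrow (O.one d))
    (z : O.Hat a) : z ∈ (O.mp t).source := by
  cases h
  exact mem_source_one z

variable {a b a' b' : O.basic} {t : O.Tran a b} {t' : O.Tran a' b'} {z : O.Hat a} {z' : O.Hat a'}

theorem mp_congr (h : O.arrow t = O.arrow t') (hz : (⟨a, z⟩ : O.BasePoint) = ⟨a', z'⟩) :
    (⟨b, O.mp t z⟩ : O.BasePoint) = ⟨b', O.mp t' z'⟩ := by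
  cases h
  cases hz
  rfl

theorem mem_source_congr (h : O.arrow t = O.arrow t') (hz : (⟨a, z⟩ : O.BasePoint) = ⟨a', z'⟩)
    (hz' : z' ∈ (O.mp t').source) : z ∈ (O.mp t).source := by
  cases h
  cases hz
  exact hz'

theorem arrow_inv_congr (h : O.arrow t = O.arrow t') : O.arrow (inv t) = O.arrow (inv t') := by
  cases h
  rfl

/-- In a commutative square of transition maps, three sides and the point determine the fourth side.
-/
theorem arrow_eq_of_isComp {c d c' d' : O.basic} {n : O.Tran a c} {m : O.Tran b d} {ρ : O.Tran c d}
    {e : O.Tran a d} {n' : O.Tran a' c'} {m' : O.Tran b' d'} {ρ' : O.Tran c' d'} {e' : O.Tran a' d'}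
    (h1 : O.IsComp m t z e) (h2 : O.IsComp ρ n z e) (h1' : O.IsComp m' t' z' e')
    (h2' : O.IsComp ρ' n' z' e') (hz : (⟨a, z⟩ : O.BasePoint) = ⟨a', z'⟩)
    (ht : O.arrow t = O.arrow t') (hn : O.arrow n = O.arrow n') (hm : O.arrow m = O.arrow m') :
    O.arrow ρ = O.arrow ρ' := by
  cases hz
  cases ht
  cases hm
  obtain rfl := h1.unique h1'
  obtain rfl : c = c' := congrArg (fun A : O.Arrow => A.2.1) hn
  obtain rfl := arrow_injective hn
  rw [h2.symm_right.unique h2'.symm_right]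

end Orbispace

open Orbispace

section Systems

variable {τ : BasedSystem O x P y}

theorem BasedSystem.f_congr {α α' : τ.Λ} (h : α = α') {z : O.Hat (τ.src α)} {z' : O.Hat (τ.src α')}
    (hz : (⟨τ.src α, z⟩ : O.BasePoint) = ⟨τ.src α', z'⟩) :
    (⟨τ.tgt α, τ.sys.f α z⟩ : P.BasePoint) = ⟨τ.tgt α', τ.sys.f α' z'⟩ := by
  subst h
  rw [eq_of_heq (Sigma.mk.inj hz).2]

theorem BasedSystem.ρ_congr {α β α' β' : τ.Λ} (h : α = α') (h' : β = β')
    {t : O.Tran (τ.src α) (τ.src β)} {t' : O.Tran (τ.src α') (τ.src β')}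
    (ht : O.arrow t = O.arrow t') :
    P.arrow (τ.sys.ρ α β t) = P.arrow (τ.sys.ρ α' β' t') := by
  subst h h'
  rw [arrow_injective ht]

end Systems

section Eqv

variable {c c' : ArcCover} {U : Fin (c.n + 3) → O.basic} {U' : Fin (c'.n + 3) → O.basic}
  {σ : LoopOver O x c U} {σ' : LoopOver O x c' U'}

theorem LoopEqv.m_arrow_congr (E : LoopEqv σ σ') {t : UnitAddCircle} {i i' : Fin (c.n + 3)}
    {k k' : Fin (c'.n + 3)} (h : i = i') (h' : k = k') (hi : t ∈ c.arc i) (hk : t ∈ c'.arc k)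
    (hi' : t ∈ c.arc i') (hk' : t ∈ c'.arc k') :
    O.arrow (E.m t i k hi hk).1 = O.arrow (E.m t i' k' hi' hk').1 := by
  subst h h'
  rfl

/-- The transition maps along which an equivalence re-charts a loop over a finer cover. -/
theorem LoopEqv.exists_arrow (E : LoopEqv σ σ') {I : ℕ → ℕ} (hI : c'.RefinesVia c I) :
    ∃ A : ℕ → O.Arrow, (∀ k ≤ c'.n + 3, ∀ t hi hk,
      O.arrow (E.m t (c.index (I k)) (c'.index k) hi hk).1 = A k) ∧
      A 0 = O.arrow (O.one x.1) ∧ A (c'.n + 3) = O.arrow (O.one x.1) := by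
  have h1 : ∀ k, ∃ A : O.Arrow, k ≤ c'.n + 3 → ∀ t hi hk,
      O.arrow (E.m t (c.index (I k)) (c'.index k) hi hk).1 = A := by
    intro k
    by_cases hk : k ≤ c'.n + 3
    · have hs := ArcCover.arc_index_subset (hI.a_le k hk) (hI.b_le k hk)
      obtain ⟨t₀, h₀⟩ := c'.arc_nonempty (c'.index k)
      refine ⟨O.arrow (E.m t₀ (c.index (I k)) (c'.index k) (hs h₀) h₀).1, fun _ t hi hk => ?_⟩
      exact congrArg O.arrow (E.m_const (c'.isPreconnected_arc (c'.index k)) (fun t h => hs h)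
        (fun _ h => h) hk h₀)
    · exact ⟨O.arrow (O.one x.1), fun h => absurd h hk⟩
  choose A hA using h1
  have h2 : O.arrow (E.m 0 0 0 c.zero_mem c'.zero_mem).1 = O.arrow (O.one x.1) := by
    rw [E.base.arrow_eq, show (σ.pt 0 0 c.zero_mem).chart = x.1 from congrArg Sigma.fst σ.basePt]
  have h3 : ∀ k ≤ c'.n + 3, c.index (I k) = 0 → c'.index k = 0 → A k = O.arrow (O.one x.1) :=
    fun k hk e e' => by
      rw [← hA k hk 0 (e ▸ c.zero_mem) (e' ▸ c'.zero_mem), ← h2]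
      exact E.m_arrow_congr e e' _ _ _ _
  exact ⟨A, hA, h3 0 (by omega) (by rw [hI.zero, c.index_zero]) c'.index_zero,
    h3 _ le_rfl (by rw [hI.card, c.index_card]) c'.index_card⟩

theorem LoopOver.arrow_r_succ {i j : Fin (c.n + 3)} (h : j = i + 1) {t : UnitAddCircle} (hi hj) :
    O.arrow (σ.r i j t hi hj).1 = O.arrow (σ.ρ i) := by
  subst h
  rw [LoopOver.r_succ]

end Eqv

namespace LoopSystem

/-- The loop `σ` contains a copy of `σ₁`, starting at the index `L`, on the arc
`[ε / 2, (1 + ε) / 2]`. -/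
structure IsHalf (σ₁ σ : LoopSystem O x) (L : ℕ) (ε : ℝ) : Prop where
  ρ : ∀ i < σ₁.c.n + 3, O.arrow (σ.sys.ρ (σ.c.index (L + i))) = O.arrow (σ₁.sys.ρ (σ₁.c.index i))
  f : ∀ i ≤ σ₁.c.n + 3, ∀ t ∈ Icc (0 : ℝ) 1, ∀ s : ℝ, s = (t + ε) / 2 →
    ∀ (h : (t : UnitAddCircle) ∈ σ₁.c.arc (σ₁.c.index i))
      (h' : (s : UnitAddCircle) ∈ σ.c.arc (σ.c.index (L + i))),
    (⟨σ.U (σ.c.index (L + i)), σ.sys.f _ ⟨_, h'⟩⟩ : O.BasePoint) =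
      ⟨σ₁.U (σ₁.c.index i), σ₁.sys.f _ ⟨_, h⟩⟩

/-- Both halves become instances of one notion, with offsets `0` and `1`. The interval number `n +
3`, which repeats the base arc at the end of a half, removes the special clauses at the joints. -/
theorem isConcat_iff {σ₁ σ₂ σ : LoopSystem O x} : IsConcat σ₁ σ₂ σ ↔
    ArcCover.IsConcat σ₁.c σ₂.c σ.c ∧ IsHalf σ₁ σ 0 0 ∧ IsHalf σ₂ σ (σ₁.c.n + 3) 1 := by
  constructor
  · intro h
    have e := h.card
    refine ⟨⟨h.only₁, h.only₂, h.card, h.a_zero, h.b_zero, h.a_mid, h.b_mid, h.arc₁, h.arc₂⟩,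
      ⟨fun i hi => h.ρ₁ _ _ ?_, fun i hi t ht s hs h1 h2 => ?_⟩,
      ⟨fun i hi => h.ρ₂ _ _ ?_, fun i hi t ht s hs h1 h2 => ?_⟩⟩
    · rw [ArcCover.index_coe _ hi, ArcCover.index_coe _ (by omega), zero_add]
    · obtain rfl : s = t / 2 := by rw [hs, add_zero]
      refine h.f₁ _ _ ?_ t ht h1 h2
      rw [ArcCover.index_coe _ (by omega), zero_add]
      rcases hi.lt_or_eq with hi | rfl
      · exact Or.inl (ArcCover.index_coe _ hi).symm
      · exact Or.inr ⟨ArcCover.index_card _, rfl⟩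
    · rw [ArcCover.index_coe _ hi, ArcCover.index_coe _ (by omega)]
    · subst hs
      refine h.f₂ _ _ ?_ t ht h1 h2
      rcases hi.lt_or_eq with hi | rfl
      · rw [ArcCover.index_coe _ hi, ArcCover.index_coe _ (by omega)]
        exact Or.inl rfl
      · rw [← h.card]
        exact Or.inr ⟨ArcCover.index_card _, ArcCover.index_card _⟩
  · rintro ⟨h, h1, h2⟩
    have e := h.card
    have hk : ∀ (k : Fin (σ.c.n + 3)) (I : ℕ), (k : ℕ) = I → k = σ.c.index I := fun k I hI => by
      rw [← hI, ArcCover.index_val]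
    refine ⟨h.only₁, h.only₂, h.card, h.a_zero, h.b_zero, h.a_mid, h.b_mid, h.arc₁, h.arc₂,
      fun i k hik => ?_, fun i k hik => ?_, fun i k hik => ?_, fun i k hik => ?_⟩
    · obtain rfl := hk k (0 + i) (by rw [hik, zero_add])
      exact (h1.ρ i i.2).trans (congrArg (fun j => O.arrow (σ₁.sys.ρ j)) (ArcCover.index_val _ i))
    · obtain rfl := hk k _ hik
      exact (h2.ρ i i.2).trans (congrArg (fun j => O.arrow (σ₂.sys.ρ j)) (ArcCover.index_val _ i))
    · obtain ⟨j, hj, rfl, rfl⟩ : ∃ j ≤ σ₁.c.n + 3, i = σ₁.c.index j ∧ k = σ.c.index (0 + j) := by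
        rcases hik with hik | ⟨rfl, hik⟩
        · exact ⟨i, i.2.le, (ArcCover.index_val _ i).symm, hk k _ (by rw [hik, zero_add])⟩
        · exact ⟨_, le_rfl, (ArcCover.index_card _).symm, hk k _ (by rw [hik, zero_add])⟩
      exact fun t ht => h1.f j hj t ht _ (by rw [add_zero])
    · obtain ⟨j, hj, rfl, rfl⟩ : ∃ j ≤ σ₂.c.n + 3, i = σ₂.c.index j ∧
          k = σ.c.index (σ₁.c.n + 3 + j) := by
        rcases hik with hik | ⟨rfl, rfl⟩
        · exact ⟨i, i.2.le, (ArcCover.index_val _ i).symm, hk k _ hik⟩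
        · exact ⟨_, le_rfl, (ArcCover.index_card _).symm, by rw [← e, ArcCover.index_card]⟩
      exact fun t ht => h2.f j hj t ht _ rfl

namespace IsHalf

variable {σ₁ σ σ₁' σ' : LoopSystem O x} {L L' : ℕ} {ε : ℝ}

theorem U_eq (h : IsHalf σ₁ σ L ε) {i : ℕ} (hi : i ≤ σ₁.c.n + 3) :
    σ.U (σ.c.index (L + i)) = σ₁.U (σ₁.c.index i) := by
  cases i with
  | zero => exact congrArg Sigma.fst (h.ρ 0 (by omega))
  | succ j =>
    rw [← add_assoc, ArcCover.index_succ, ArcCover.index_succ]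
    exact congrArg (fun A : O.Arrow => A.2.1) (h.ρ j hi)

theorem arrow_r (h : IsHalf σ₁ σ L ε) {I J : ℕ} (hI : I ≤ σ₁.c.n + 3) (hJ : J ≤ σ₁.c.n + 3)
    {u : ℝ} (h1 : σ₁.c.a I < u) (h2 : u < σ₁.c.b I) (h3 : σ₁.c.a J < u) (h4 : u < σ₁.c.b J)
    {s : UnitAddCircle} (hs hs' hu hu') :
    O.arrow (σ.sys.r (σ.c.index (L + I)) (σ.c.index (L + J)) s hs hs').1 =
      O.arrow (σ₁.sys.r (σ₁.c.index I) (σ₁.c.index J) (u : UnitAddCircle) hu hu').1 := by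
  have key : ∀ {I}, ∀ J, J = I + 1 → J ≤ σ₁.c.n + 3 → ∀ hs hs' hu hu',
      O.arrow (σ.sys.r (σ.c.index (L + I)) (σ.c.index (L + J)) s hs hs').1 =
      O.arrow (σ₁.sys.r (σ₁.c.index I) (σ₁.c.index J) (u : UnitAddCircle) hu hu').1 := by
    rintro I _ rfl hI hs hs' hu hu'
    refine (LoopOver.arrow_r_succ ?_ hs hs').trans ((h.ρ I hI).trans
      (LoopOver.arrow_r_succ ?_ hu hu').symm)
    · rw [← add_assoc, ArcCover.index_succ]
    · rw [ArcCover.index_succ]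
  rcases lt_trichotomy I J with hIJ | rfl | hIJ
  · exact key J (ArcCover.lift_adj _ h2 h3 hIJ) hJ hs hs' hu hu'
  · rw [LoopOver.r_self, LoopOver.r_self]
    change O.arrow (O.one (σ.U (σ.c.index (L + I)))) = O.arrow (O.one (σ₁.U (σ₁.c.index I)))
    rw [h.U_eq hI]
  · rw [← LoopOver.r_inv, ← LoopOver.r_inv (σ := σ₁.sys)]
    exact arrow_inv_congr (key I (ArcCover.lift_adj _ h4 h1 hIJ) hI hs' hs hu' hu)

/-- The naturality squares of `E₁` at `u` and of `E` at `(u + ε) / 2` agree on the original loop and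
on the re-charting maps. By `arrow_eq_of_isComp` the new transition maps then agree too. -/
theorem rechart (h : IsHalf σ₁ σ L ε) (hc : σ₁'.c.IsHalf σ'.c L' ε) {I J : ℕ → ℕ}
    (hI : σ₁'.c.RefinesVia σ₁.c I) (hJ : σ'.c.RefinesVia σ.c J)
    (hL : L' + (σ₁'.c.n + 3) ≤ σ'.c.n + 3) (hIJ : ∀ k ≤ σ₁'.c.n + 3, J (L' + k) = L + I k)
    (E₁ : LoopEqv σ₁.sys σ₁'.sys) (E : LoopEqv σ.sys σ'.sys)
    (hE : ∀ k ≤ σ₁'.c.n + 3, ∀ s u hs hs' hu hu',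
      O.arrow (E.m s (σ.c.index (L + I k)) (σ'.c.index (L' + k)) hs hs').1 =
        O.arrow (E₁.m u (σ₁.c.index (I k)) (σ₁'.c.index k) hu hu').1) : IsHalf σ₁' σ' L' ε := by
  have hs₁ : ∀ k ≤ σ₁'.c.n + 3, σ₁'.c.arc (σ₁'.c.index k) ⊆ σ₁.c.arc (σ₁.c.index (I k)) :=
    fun k hk => ArcCover.arc_index_subset (hI.a_le k hk) (hI.b_le k hk)
  have hs : ∀ k ≤ σ₁'.c.n + 3, σ'.c.arc (σ'.c.index (L' + k)) ⊆ σ.c.arc (σ.c.index (L + I k)) :=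
    fun k hk => by
      rw [← hIJ k hk]
      exact ArcCover.arc_index_subset (hJ.a_le _ (by omega)) (hJ.b_le _ (by omega))
  constructor
  · intro i hi
    obtain ⟨u, hu1, hu2⟩ := exists_between (σ₁'.c.overlap i)
    have hu0 : 0 ≤ u := by
      rcases Nat.lt_or_ge (i + 1) (σ₁'.c.n + 3) with hi' | hi'
      · exact (ArcCover.nonneg_a hc.only (Nat.succ_pos i) hi').trans hu1.le
      · rw [show i + 1 = σ₁'.c.n + 3 by omega, ArcCover.a_card] at hu1
        linarith [σ₁'.c.neg_one_lt_a_zero]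
    have hu01 : u ∈ Icc (0 : ℝ) 1 := ⟨hu0, hu2.le.trans (ArcCover.b_le_one hc.only hi)⟩
    have hv1 : σ₁'.c.a i < u := (σ₁'.c.a_lt_succ i).trans hu1
    have hv2 : u < σ₁'.c.b (i + 1) := hu2.trans (σ₁'.c.b_strictMono (Nat.lt_succ_self i))
    have hw1 : σ'.c.a (L' + (i + 1)) < (u + ε) / 2 := by rw [hc.a_eq _ (Nat.succ_pos i) hi]; linarith
    have hw2 : (u + ε) / 2 < σ'.c.b (L' + i) := by rw [hc.b_eq _ hi]; linarith
    have m1 := ArcCover.mem_arc_index _ hv1 hu2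
    have m2 := ArcCover.mem_arc_index _ hu1 hv2
    have m3 := ArcCover.mem_arc_index _ ((σ'.c.a_strictMono (show L' + i < L' + (i + 1) by omega)).trans hw1) hw2
    have m4 := ArcCover.mem_arc_index _ hw1
      (hw2.trans (σ'.c.b_strictMono (show L' + i < L' + (i + 1) by omega)))
    have n1 := hs₁ i hi.le m1
    have n2 := hs₁ (i + 1) hi m2
    have n3 := hs i hi.le m3
    have n4 := hs (i + 1) hi m4
    have k1 := Hom.isComp (σ.sys.r _ _ _ n3 n4) (E.m _ _ _ n4 m4)
    have k2 := Hom.isComp (E.m _ _ _ n3 m3) (σ'.sys.r _ _ _ m3 m4)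
    rw [← E.nat _ _ _ _ _ n3 n4 m3 m4] at k2
    have k3 := Hom.isComp (σ₁.sys.r _ _ _ n1 n2) (E₁.m _ _ _ n2 m2)
    have k4 := Hom.isComp (E₁.m _ _ _ n1 m1) (σ₁'.sys.r _ _ _ m1 m2)
    rw [← E₁.nat _ _ _ _ _ n1 n2 m1 m2] at k4
    have := arrow_eq_of_isComp k1 k2 k3 k4 (h.f _ (hI.le i hi.le) u hu01 _ rfl n1 n3)
      (h.arrow_r (hI.le i hi.le) (hI.le (i + 1) hi) ((hI.a_le i hi.le).trans_lt hv1)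
        (hu2.trans_le (hI.b_le i hi.le)) ((hI.a_le _ hi).trans_lt hu1) (hv2.trans_le (hI.b_le _ hi))
        n3 n4 n1 n2)
      (hE i hi.le _ _ n3 m3 n1 m1) (hE (i + 1) hi _ _ n4 m4 n2 m2)
    refine (LoopOver.arrow_r_succ ?_ m3 m4).symm.trans (this.trans (LoopOver.arrow_r_succ ?_ m1 m2))
    · rw [← add_assoc, ArcCover.index_succ]
    · rw [ArcCover.index_succ]
  · intro k hk t ht s hst h1 h2
    have h3 := mp_congr (hE k hk s t (hs k hk h2) h2 (hs₁ k hk h1) h1)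
      (h.f (I k) (hI.le k hk) t ht s hst (hs₁ k hk h1) (hs k hk h2))
    have e1 := Hom.mp_eq (E.m s _ _ (hs k hk h2) h2)
    have e2 := Hom.mp_eq (E₁.m t _ _ (hs₁ k hk h1) h1)
    exact (congrArg (Sigma.mk (σ'.U (σ'.c.index (L' + k)))) e1).symm.trans
      (h3.trans (congrArg (Sigma.mk (σ₁'.U (σ₁'.c.index k))) e2))

theorem mem_source (h : IsHalf σ₁ σ L ε) {d : ArcCover} (hc : σ₁'.c.IsHalf d L' ε) {I : ℕ → ℕ}
    (hI : σ₁'.c.RefinesVia σ₁.c I) (E₁ : LoopEqv σ₁.sys σ₁'.sys) {k : ℕ} (hk0 : 0 < k)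
    (hk : k < σ₁'.c.n + 3) {i : Fin (σ.c.n + 3)} (hi : i = σ.c.index (L + I k)) {b : O.basic}
    {n : O.Tran (σ.U i) b} (hn : ∀ t hi hk,
      O.arrow n = O.arrow (E₁.m t (σ₁.c.index (I k)) (σ₁'.c.index k) hi hk).1) {t : UnitAddCircle}
    (ht : t ∈ d.arc (d.index (L' + k))) (ht' : t ∈ σ.c.arc i) :
    σ.sys.f i ⟨t, ht'⟩ ∈ (O.mp n).source := by
  subst hi
  rw [ArcCover.arc_index, hc.a_eq k hk0 hk.le, hc.b_eq k hk] at ht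
  obtain ⟨v, ⟨h1, h2⟩, rfl⟩ := ht
  have h3 : σ₁'.c.a k < 2 * v - ε := by linarith
  have h4 : 2 * v - ε < σ₁'.c.b k := by linarith
  have h5 := ArcCover.mem_arc_index _ h3 h4
  have h6 := ArcCover.mem_arc_index _ ((hI.a_le k hk.le).trans_lt h3) (h4.trans_le (hI.b_le k hk.le))
  refine mem_source_congr (hn _ h6 h5) (h.f _ (hI.le k hk.le) (2 * v - ε) ⟨?_, ?_⟩ v (by ring) h6 ht')
    (Hom.mem (E₁.m _ _ _ h6 h5))
  · linarith [ArcCover.nonneg_a hc.only hk0 hk]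
  · linarith [ArcCover.b_le_one hc.only hk]

theorem comp {c₁ c : ArcCover} {τ : BasedSystem O x P y} {κ₁ : Fin (c₁.n + 3) → τ.Λ}
    {h₁ : κ₁ 0 = τ.o} {κ : Fin (c.n + 3) → τ.Λ} {h₀ : κ 0 = τ.o}
    {s₁ : LoopOver O x c₁ fun i => τ.src (κ₁ i)} {s : LoopOver O x c fun i => τ.src (κ i)}
    (h : IsHalf ⟨c₁, _, s₁⟩ ⟨c, _, s⟩ L ε)
    (hκ : ∀ i ≤ c₁.n + 3, κ (c.index (L + i)) = κ₁ (c₁.index i)) :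
    IsHalf ⟨c₁, _, s₁.comp τ κ₁ h₁⟩ ⟨c, _, s.comp τ κ h₀⟩ L ε where
  ρ i hi := τ.ρ_congr (hκ i hi.le) (by
    have := hκ (i + 1) hi
    rwa [← add_assoc, ArcCover.index_succ, ArcCover.index_succ] at this) (h.ρ i hi)
  f i hi t ht u hu h1 h2 := τ.f_congr (hκ i hi) (h.f i hi t ht u hu h1 h2)

end IsHalf

/-- Concatenations can be re-charted. -/
theorem IsConcat.exists_rechart {σ₁ σ₂ σ σ₁' σ₂' : LoopSystem O x} (h : IsConcat σ₁ σ₂ σ)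
    (E₁ : LoopEqv σ₁.sys σ₁'.sys) (E₂ : LoopEqv σ₂.sys σ₂'.sys) {I₁ I₂ : ℕ → ℕ}
    (hI₁ : σ₁'.c.RefinesVia σ₁.c I₁) (hI₂ : σ₂'.c.RefinesVia σ₂.c I₂) {d : ArcCover}
    (hd : ArcCover.IsConcat σ₁'.c σ₂'.c d) {V : Fin (d.n + 3) → O.basic}
    (hV₁ : ∀ i ≤ σ₁'.c.n + 3, V (d.index i) = σ₁'.U (σ₁'.c.index i))
    (hV₂ : ∀ i ≤ σ₂'.c.n + 3, V (d.index (σ₁'.c.n + 3 + i)) = σ₂'.U (σ₂'.c.index i)) :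
    ∃ s : LoopOver O x d V, Nonempty (LoopEqv σ.sys s) ∧ IsConcat σ₁' σ₂' ⟨d, V, s⟩ := by
  obtain ⟨hc, H₁, H₂⟩ := isConcat_iff.1 h
  obtain ⟨J, hJ, hJ₁, hJ₂⟩ := hc.exists_refinesVia hd hI₁ hI₂
  obtain ⟨A₁, hA₁, hA₁0, hA₁1⟩ := E₁.exists_arrow hI₁
  obtain ⟨A₂, hA₂, hA₂0, hA₂1⟩ := E₂.exists_arrow hI₂
  have e := hd.card
  -- The re-charting maps of the two halves fit together, since at both joints they are the identity
  -- of the base chart.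
  let A : ℕ → O.Arrow := fun k => if k < σ₁'.c.n + 3 then A₁ k else A₂ (k - (σ₁'.c.n + 3))
  have hAA₂ : ∀ k, A (σ₁'.c.n + 3 + k) = A₂ k := fun k => by
    simp only [A, if_neg (show ¬ σ₁'.c.n + 3 + k < σ₁'.c.n + 3 by omega), Nat.add_sub_cancel_left]
  have hAA₁ : ∀ k ≤ σ₁'.c.n + 3, A k = A₁ k := by
    intro k hk
    rcases hk.lt_or_eq with hk | rfl
    · exact if_pos hk
    · have := hAA₂ 0
      rwa [add_zero, hA₂0, ← hA₁1] at this
  have hA0 : A 0 = O.arrow (O.one x.1) := (hAA₁ 0 (by omega)).trans hA₁0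
  have hA1 : A (d.n + 3) = O.arrow (O.one x.1) := by rw [e, hAA₂, hA₂1]
  have hAfst₁ : ∀ k ≤ σ₁'.c.n + 3, (A₁ k).1 = σ₁.U (σ₁.c.index (I₁ k)) ∧
      (A₁ k).2.1 = σ₁'.U (σ₁'.c.index k) := fun k hk => by
    obtain ⟨t, ht⟩ := σ₁'.c.arc_nonempty (σ₁'.c.index k)
    rw [← hA₁ k hk t (ArcCover.arc_index_subset (hI₁.a_le k hk) (hI₁.b_le k hk) ht) ht]
    exact ⟨rfl, rfl⟩
  have hAfst₂ : ∀ k ≤ σ₂'.c.n + 3, (A₂ k).1 = σ₂.U (σ₂.c.index (I₂ k)) ∧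
      (A₂ k).2.1 = σ₂'.U (σ₂'.c.index k) := fun k hk => by
    obtain ⟨t, ht⟩ := σ₂'.c.arc_nonempty (σ₂'.c.index k)
    rw [← hA₂ k hk t (ArcCover.arc_index_subset (hI₂.a_le k hk) (hI₂.b_le k hk) ht) ht]
    exact ⟨rfl, rfl⟩
  have hn : ∀ k : Fin (d.n + 3), ∃ n : O.Tran (σ.U (σ.c.index (J k))) (V k), O.arrow n = A k := by
    intro k
    have hk := k.2
    rcases Nat.lt_or_ge k (σ₁'.c.n + 3) with hk' | hk'
    · refine exists_arrow_eq ?_ ?_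
      · rw [hAA₁ k hk'.le, (hAfst₁ k hk'.le).1, hJ₁ k hk'.le, ← H₁.U_eq (hI₁.le k hk'.le), zero_add]
      · rw [hAA₁ k hk'.le, (hAfst₁ k hk'.le).2, ← hV₁ k hk'.le, ArcCover.index_val]
    · obtain ⟨j, hj⟩ : ∃ j, (k : ℕ) = σ₁'.c.n + 3 + j := ⟨k - (σ₁'.c.n + 3), by omega⟩
      have hj' : j ≤ σ₂'.c.n + 3 := by omega
      refine exists_arrow_eq ?_ ?_
      · rw [hj, hAA₂, (hAfst₂ j hj').1, hJ₂, ← H₂.U_eq (hI₂.le j hj')]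
      · rw [hj, hAA₂, (hAfst₂ j hj').2, ← hV₂ j hj', ← hj, ArcCover.index_val]
  choose n hn using hn
  have hθ : ∀ k : Fin (d.n + 3), d.arc k ⊆ σ.c.arc (σ.c.index (J k)) := fun k => by
    have := ArcCover.arc_index_subset (hJ.a_le k k.2.le) (hJ.b_le k k.2.le)
    rwa [ArcCover.index_val] at this
  obtain ⟨s, E, hE⟩ := σ.sys.exists_rechart (c' := d) (U' := V) (fun k => σ.c.index (J k)) hθ
    (by change σ.c.index (J 0) = 0; rw [hJ.zero, ArcCover.index_zero]) n (by
      intro k t ht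
      have hk := k.2
      rcases Nat.eq_zero_or_pos (k : ℕ) with h0 | h0
      · refine mem_source_of_arrow_one (d := x.1) ?_ _
        rw [hn, h0, hA0]
      rcases lt_trichotomy (k : ℕ) (σ₁'.c.n + 3) with hk' | hk' | hk'
      · refine H₁.mem_source hd.isHalf_left hI₁ E₁ h0 hk' ?_ (fun u hi hk => ?_) ?_ _
        · rw [hJ₁ k hk'.le, zero_add]
        · rw [hn, hAA₁ k hk'.le, hA₁ k hk'.le u hi hk]
        · rwa [zero_add, ArcCover.index_val]
      · refine mem_source_of_arrow_one (d := x.1) ?_ _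
        rw [hn, hk', hAA₁ _ le_rfl, hA₁1]
      · obtain ⟨j, hj⟩ : ∃ j, (k : ℕ) = σ₁'.c.n + 3 + j := ⟨k - (σ₁'.c.n + 3), by omega⟩
        refine H₂.mem_source hd.isHalf_right hI₂ E₂ (k := j) (by omega) (by omega) ?_
          (fun u hi hk => ?_) ?_ _
        · rw [hj, hJ₂]
        · rw [hn, hj, hAA₂, hA₂ j (by omega) u hi hk]
        · rwa [← hj, ArcCover.index_val])
    (by rw [hn]; exact hA0)
  have hEA : ∀ k ≤ d.n + 3, ∀ t hi hk, O.arrow (E.m t (σ.c.index (J k)) (d.index k) hi hk).1 = A k := by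
    have key : ∀ (k : Fin (d.n + 3)) t hi hk, O.arrow (E.m t (σ.c.index (J k)) k hi hk).1 = A k :=
      fun k t hi hk => (congrArg O.arrow (hE k t hi hk)).trans (hn k)
    intro k hk t hi hk'
    have e1 : σ.c.index (J k) = σ.c.index (J (d.index k : ℕ)) ∧ A (d.index k : ℕ) = A k := by
      rcases hk.lt_or_eq with hk | rfl
      · rw [ArcCover.index_coe _ hk]
        exact ⟨rfl, rfl⟩
      · rw [ArcCover.index_card, hJ.card, hA1]
        change _ = σ.c.index (J 0) ∧ A 0 = _
        rw [hJ.zero, ArcCover.index_card, ArcCover.index_zero, hA0]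
        exact ⟨rfl, rfl⟩
    rw [← e1.2, ← key (d.index k) t (e1.1 ▸ hi) hk']
    exact E.m_arrow_congr e1.1 rfl _ _ _ _
  refine ⟨s, ⟨E⟩, isConcat_iff.2 ⟨hd, ?_, ?_⟩⟩
  · refine H₁.rechart (σ' := ⟨d, V, s⟩) hd.isHalf_left hI₁ hJ (by change _ ≤ d.n + 3; omega)
      (fun k hk => by rw [zero_add, zero_add, hJ₁ k hk]) E₁ E fun k hk u v hu hu' hv hv' => ?_
    rw [hA₁ k hk v hv hv', ← hAA₁ k hk]
    have e1 : σ.c.index (0 + I₁ k) = σ.c.index (J k) := by rw [zero_add, hJ₁ k hk]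
    have e2 : d.index (0 + k) = d.index k := by rw [zero_add]
    rw [← hEA k (by omega) u (e1 ▸ hu) (e2 ▸ hu')]
    exact E.m_arrow_congr e1 e2 _ _ _ _
  · refine H₂.rechart (σ' := ⟨d, V, s⟩) hd.isHalf_right hI₂ hJ (by change _ ≤ d.n + 3; omega)
      (fun k hk => hJ₂ k) E₂ E fun k hk u v hu hu' hv hv' => ?_
    rw [hA₂ k hk v hv hv', ← hAA₂ k]
    have e1 : σ.c.index (σ₁.c.n + 3 + I₂ k) = σ.c.index (J (σ₁'.c.n + 3 + k)) := by rw [hJ₂]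
    rw [← hEA (σ₁'.c.n + 3 + k) (by omega) u (e1 ▸ hu) hu']
    exact E.m_arrow_congr e1 rfl _ _ _ _

end LoopSystem

theorem BasedSystem.exists_refining_rep (τ : BasedSystem O x P y) {c : ArcCover}
    {U : Fin (c.n + 3) → O.basic} (σ : LoopOver O x c U)
    (hc : ∀ i : Fin (c.n + 3), i ≠ 0 → (0 : UnitAddCircle) ∉ c.arc i) :
    ∃ (d : ArcCover) (κ : Fin (d.n + 3) → τ.Λ) (_ : κ 0 = τ.o)
      (s : LoopOver O x d (fun i => τ.src (κ i))) (I : ℕ → ℕ), Nonempty (LoopEqv σ s) ∧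
      (∀ k, k ≠ 0 → (0 : UnitAddCircle) ∉ d.arc k) ∧ d.RefinesVia c I := by
  obtain ⟨𝒲, h𝒲, H⟩ := ArcCover.exists_refinesVia hc
  obtain ⟨d, w, κ, h0, s, hE, hw, hw0, hd⟩ := τ.exists_rechart_src σ 𝒲 h𝒲
  obtain ⟨I, hI⟩ := H d w hw hw0 hd
  exact ⟨d, κ, h0, s, I, hE, hd, hI⟩

/-- Based morphisms preserve concatenations. -/
theorem OrbiLoop.IsConcat.map (f : BasedMor O x P y) {γ₁ γ₂ γ : OrbiLoop O x}
    (h : OrbiLoop.IsConcat γ₁ γ₂ γ) :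
    OrbiLoop.IsConcat (OrbiLoop.map f γ₁) (OrbiLoop.map f γ₂) (OrbiLoop.map f γ) := by
  obtain ⟨τ, rfl⟩ := Quot.exists_rep f
  obtain ⟨⟨c₁, U₁, s₁⟩, ⟨c₂, U₂, s₂⟩, ⟨c, U, s⟩, rfl, rfl, rfl, h⟩ := h
  obtain ⟨d₁, κ₁, h₁, s₁', I₁, ⟨E₁⟩, hd₁, hI₁⟩ := τ.exists_refining_rep s₁ h.only₁
  obtain ⟨d₂, κ₂, h₂, s₂', I₂, ⟨E₂⟩, hd₂, hI₂⟩ := τ.exists_refining_rep s₂ h.only₂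
  obtain ⟨d, hd⟩ := ArcCover.exists_isConcat hd₁ hd₂
  have e := hd.card
  -- The chart indices of the two halves are juxtaposed. They agree at the joints, where both are
  -- the base index of `τ`.
  let κ : Fin (d.n + 3) → τ.Λ := fun k => if (k : ℕ) < d₁.n + 3 then κ₁ (d₁.index k) else
    κ₂ (d₂.index (k - (d₁.n + 3)))
  have hκ0 : κ 0 = τ.o := by
    have : κ 0 = κ₁ (d₁.index 0) := if_pos (by change 0 < _; omega)
    rw [this, ArcCover.index_zero, h₁]
  have hκ₂ : ∀ i ≤ d₂.n + 3, κ (d.index (d₁.n + 3 + i)) = κ₂ (d₂.index i) := by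
    intro i hi
    rcases hi.lt_or_eq with hi | rfl
    · simp only [κ, d.index_coe (show d₁.n + 3 + i < d.n + 3 by omega),
        if_neg (show ¬ d₁.n + 3 + i < d₁.n + 3 by omega), Nat.add_sub_cancel_left]
    · rw [← e, ArcCover.index_card, ArcCover.index_card, hκ0, h₂]
  have hκ₁ : ∀ i ≤ d₁.n + 3, κ (d.index i) = κ₁ (d₁.index i) := by
    intro i hi
    rcases hi.lt_or_eq with hi | rfl
    · simp only [κ, d.index_coe (show i < d.n + 3 by omega), if_pos hi]
    · have := hκ₂ 0 (by omega)
      rw [add_zero] at this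
      rw [this, ArcCover.index_card, ArcCover.index_zero, h₁, h₂]
  obtain ⟨s', ⟨E⟩, hs'⟩ := h.exists_rechart (σ₁' := ⟨d₁, _, s₁'⟩) (σ₂' := ⟨d₂, _, s₂'⟩) E₁ E₂ hI₁ hI₂
    hd (V := fun k => τ.src (κ k)) (fun i hi => congrArg τ.src (hκ₁ i hi))
    (fun i hi => congrArg τ.src (hκ₂ i hi))
  obtain ⟨-, H₁, H₂⟩ := LoopSystem.isConcat_iff.1 hs'
  have key : ∀ {c d : ArcCover} {U : Fin (c.n + 3) → O.basic} {s : LoopOver O x c U}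
      (κ : Fin (d.n + 3) → τ.Λ) (h0 : κ 0 = τ.o) (s' : LoopOver O x d fun i => τ.src (κ i)),
      LoopEqv s s' → OrbiLoop.map (BasedMor.mk τ) (OrbiLoop.mk ⟨c, U, s⟩) =
        OrbiLoop.mk ⟨d, _, s'.comp τ κ h0⟩ := fun κ h0 s' E => by
    rw [OrbiLoop.mk_eq_iff.2 (⟨E⟩ : Nonempty (LoopEqv (LoopSystem.sys ⟨_, _, _⟩)
      (LoopSystem.sys ⟨_, _, s'⟩)))]
    exact OrbiLoop.map_mk_mk τ κ h0 s'
  exact ⟨_, _, _, key κ₁ h₁ s₁' E₁, key κ₂ h₂ s₂' E₂, key κ hκ0 s' E, LoopSystem.isConcat_iff.2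
    ⟨hd, H₁.comp fun i hi => by rw [zero_add]; exact hκ₁ i hi, H₂.comp hκ₂⟩⟩

theorem IsPiOneProduct.piMap (f : BasedMor O x P y) {a b c : OrbiPi 0 O x}
    (h : IsPiOneProduct a b c) :
    IsPiOneProduct (f.piMap 0 a) (f.piMap 0 b) (f.piMap 0 c) := by
  obtain ⟨u, v, w, rfl, rfl, rfl, h⟩ := h
  exact ⟨_, _, _, f.piMap_mk u, f.piMap_mk v, f.piMap_mk w, fun t => (h t).map f⟩

end Concatenation

theorem theorem3p2p3 {X Y : Type u} [TopologicalSpace X] [TopologicalSpace Y]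
    (O : Orbispace X) (x : O.BasePoint) (P : Orbispace Y) (y : P.BasePoint) :
    (∀ f : BasedMor O x P y,
      (∀ γ, ∃! γ', OrbiLoop.IsComposite f γ γ') ∧
      Continuous (OrbiLoop.map f) ∧
      OrbiLoop.map f (OrbiLoop.base O x) = OrbiLoop.base P y) ∧
    (∀ f₁ f₂ : BasedMor O x P y, BasedMor.Homotopic f₁ f₂ →
      ∀ n, BasedMor.piMap n f₁ = BasedMor.piMap n f₂) ∧
    (∀ f : BasedMor O x P y, BasedMor.IsHomotopyEquivalence f →
      (∀ n, Function.Bijective (BasedMor.piMap n f)) ∧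
      (∀ a b c : OrbiPi 0 O x, IsPiOneProduct a b c ↔
        IsPiOneProduct (BasedMor.piMap 0 f a) (BasedMor.piMap 0 f b) (BasedMor.piMap 0 f c)) ∧
      (∀ n, ∀ a b : OrbiPi (n + 1) O x,
        BasedMor.piMap (n + 1) f (a * b) =
          BasedMor.piMap (n + 1) f a * BasedMor.piMap (n + 1) f b)) := by
  refine ⟨fun f => ⟨OrbiLoop.existsUnique_isComposite f, OrbiLoop.continuous_map f,
    OrbiLoop.map_base f⟩, fun f₁ f₂ h n => BasedMor.piMap_eq_of_homotopic h n, fun f hf => ?_⟩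
  obtain ⟨g, hg⟩ := hf.exists_inverse
  refine ⟨fun n => ⟨(hg n).1.injective, (hg n).2.surjective⟩, fun a b c => ⟨fun h => h.piMap f,
    fun h => ?_⟩, fun n => f.piMap_mul⟩
  -- The homotopy inverse also preserves products, and it carries the three images back to `a`, `b`
  -- and `c`.
  have := h.piMap g
  rwa [(hg 0).1 a, (hg 0).1 b, (hg 0).1 c] at this
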